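/- Let $n\ge 1$, let $\Omega\subset\mathbb R^n$ be a bounded domain with smooth boundary, $H=L^2(\Omega)$ with norm $\|\cdot\|$ and inner product $(\cdot,\cdot)$. Let $A=-\Delta$ be the Dirichlet Laplacian, $\mathcal D(A)=H^2(\Omega)\cap H^1_0(\Omega)$, with its fractional powers $A^s$, and let $A_1=\Delta^2$ with either clamped ($u=\partial_\nu u=0$) or hinged ($u=\Delta u=0$) boundary conditions, so that $\mathcal D(A_1^{1/2})=H^2_0(\Omega)$, respectively $H^2(\Omega)\cap H^1_0(\Omega)$, and $\|A_1^{1/2}u\|=\|Au\|$. Let $\sigma_1>0$ be the smallest eigenvalue of $A_1$. Fix $\alpha\in[0,1]$, $q\ge\frac12$, $\gamma>0$ and $c_f\in[0,\sigma_1)$. Let $\kappa\ge0$, $\lambda\in[0,1]$, $h\in H$, $h_\lambda=\lambda h$, and let $f\in C^1(\mathbb R)$ with $f(0)=0$ satisfy, with $\widehat f(s)=\int_0^s f(\tau)\,d\tau$ and for all $s\in\mathbb R$, $$|f'(s)|\le C_{f'}(1+|s|^p),\qquad -C_f-\tfrac{c_f}{2}s^2\le\widehat f(s)\le f(s)s+\tfrac{c_f}{2}s^2,$$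 where $C_{f'}>0$, $C_f\ge0$, $p\ge0$, and $p\le\frac{4}{n-4}$ if $n\ge5$. Let $(u,u_t)\in C([0,\infty);\mathcal D(A_1^{1/2})\times H)$ be a weak solution of $$u_{tt}+\kappa Au+A_1u+\gamma\big[\|A^\alpha u\|^2+\|u_t\|^2\big]^q u_t+f(u)=h_\lambda,\quad t>0,\qquad u(0)=u_0,\ u_t(0)=u_1 .$$ Put $\omega=1-c_f/\sigma_1$, $K_\lambda=C_f|\Omega|+\frac{1}{\sigma_1\omega}\|h_\lambda\|^2$, $$E(t)=\tfrac12\big[\|u_t\|^2+\|A_1^{1/2}u\|^2+\kappa\|A^{1/2}u\|^2\big]+\int_\Omega\widehat f(u)\,dx-(h_\lambda,u),\qquad \widetilde E(t)=E(t)+K_\lambda .$$ There are a constant $C_{\alpha,q,\gamma}>0$ and, for each $e\in\mathbb R$, a constant $C_e>0$, depending only on $\Omega$, the boundary condition, $\alpha,q,\gamma,c_f$ (and on $e$ in the case of $C_e$), such that for all such $\kappa,\lambda,h,f$ and all such solutions: (1) If $K_\lambda>0$ (in particular if $C_f>0$) or $(u_0,u_1)\ne(0,0)$, then $\widetilde E(0)>0$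 and, for all $t>0$, $$\Big[\tfrac{q}{C_{\alpha,q,\gamma}}t+\tfrac{1}{\widetilde E(0)^q}\Big]^{-1/q}\le\widetilde E(t)\le\Big[\tfrac{q}{C_{\widetilde E(0)}}(t-1)^++\tfrac{1}{\widetilde E(0)^q}\Big]^{-1/q}+8K_\lambda .$$ (2) Suppose $h=0$ and $C_f=0$. If $(u_0,u_1)\neq(0,0)$, then $E(0)>0$ and, for all $t>0$, $$\Big[\tfrac{q}{C_{\alpha,q,\gamma}}t+\tfrac{1}{E(0)^q}\Big]^{-1/q}\le E(t)\le\Big[\tfrac{q}{C_{E(0)}}(t-1)^++\tfrac{1}{E(0)^q}\Big]^{-1/q};$$ if $(u_0,u_1)=(0,0)$, then $E\equiv0$. (3) Consequently, when $h=0$ and $C_f=0$, the problem is polynomially stable with rate $1/q$: there is a nondecreasing function $M$, depending only on $\Omega$, the boundary condition, $\alpha,q,\gamma,c_f$, with $E(t)\le M(E(0))(1+t)^{-1/q}$ for all $t\ge0$ and all solutions. It is not exponentially stable: for no solution with $(u_0,u_1)\ne(0,0)$ are there $B\in\mathbb R$ and $\nu>0$ with $E(t)\le Be^{-\nu t}$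 for all $t\ge0$. -/

import Mathlib

open MeasureTheory TopologicalSpace Filter Set
open scoped Topology Distributions LineDeriv Laplacian ContDiff RealInnerProductSpace

noncomputable section

namespace EnergyDampedBeam

/-- Euclidean space `ℝⁿ`. -/
abbrev E (n : ℕ) := EuclideanSpace ℝ (Fin n)

/-- A bounded domain (nonempty, connected, open) of `ℝⁿ` with smooth boundary: near each boundary
point it is the sublevel set `{ρ < 0}` of a smooth function `ρ` with nonzero differential. -/
structure IsSmoothBoundedDomain {n : ℕ} (Ω : Opens (E n)) : Prop where
  isConnected : IsConnected (Ω : Set (E n))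
  isBounded : Bornology.IsBounded (Ω : Set (E n))
  smooth_boundary : ∀ x ∈ frontier (Ω : Set (E n)), ∃ U : Set (E n), IsOpen U ∧ x ∈ U ∧
    ∃ ρ : E n → ℝ, ContDiffOn ℝ ∞ ρ U ∧ fderiv ℝ ρ x ≠ 0 ∧
      (Ω : Set (E n)) ∩ U = {y ∈ U | ρ y < 0}

/-- The Hilbert space `H = L²(Ω)`. -/
abbrev H {n : ℕ} (Ω : Opens (E n)) := Lp ℝ 2 (volume.restrict (Ω : Set (E n)))

/-- The iterated partial derivative `∂_{i 0} ⋯ ∂_{i (k-1)} φ` of a test function. -/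
def partialDeriv {n : ℕ} {Ω : Opens (E n)} {k : ℕ} (i : Fin k → Fin n) (φ : 𝓓(Ω, ℝ)) : 𝓓(Ω, ℝ) :=
  ∂^{fun j => (EuclideanSpace.single (i j) 1 : E n)} φ

/-- `u ∈ H^m_0(Ω)`, the closure of `C_c^∞(Ω)` in `H^m(Ω)`: there are test functions `φ_j` with
`φ_j → u` in `L²(Ω)`, all of whose partial derivatives of order at most `m` converge in `L²(Ω)`
(the limits are then the weak derivatives of `u`). -/
def MemSobolevZero {n : ℕ} (Ω : Opens (E n)) (m : ℕ) (u : H Ω) : Prop :=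
  ∃ φ : ℕ → 𝓓(Ω, ℝ),
    Tendsto (fun j => eLpNorm (fun x => φ j x - u x) 2 (volume.restrict (Ω : Set (E n))))
      atTop (𝓝 0) ∧
    ∀ k ≤ m, ∀ i : Fin k → Fin n, ∃ g : H Ω,
      Tendsto (fun j => eLpNorm (fun x => partialDeriv i (φ j) x - g x) 2
        (volume.restrict (Ω : Set (E n)))) atTop (𝓝 0)

/-! ### The Dirichlet Laplacian `A = -Δ` and its fractional powers -/

/-- `u ∈ D(A)` and `A u = g`, for the Dirichlet Laplacian `A = -Δ`: `u ∈ H¹_0(Ω)` and `-Δu = g`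
in the sense of distributions, with `g ∈ L²(Ω)`. On a bounded domain with smooth boundary,
`D(A) = H²(Ω) ∩ H¹_0(Ω)` by elliptic regularity. -/
def IsDirichletLaplacian {n : ℕ} (Ω : Opens (E n)) (u g : H Ω) : Prop :=
  MemSobolevZero Ω 1 u ∧
    ∀ φ : 𝓓(Ω, ℝ), -∫ x in (Ω : Set (E n)), u x * Δ (φ : E n → ℝ) x =
      ∫ x in (Ω : Set (E n)), g x * φ x

/-- The domain `D(A)`. -/
def domA {n : ℕ} (Ω : Opens (E n)) : Set (H Ω) := {u | ∃ g, IsDirichletLaplacian Ω u g}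

open Classical in
/-- The function `A u = -Δu`, for `u ∈ D(A)` (and `0` outside `D(A)`). -/
def opA {n : ℕ} (Ω : Opens (E n)) (u : H Ω) : H Ω :=
  if h : ∃ g, IsDirichletLaplacian Ω u g then h.choose else 0

lemma integrable_mul_testFunction {n : ℕ} {Ω : Opens (E n)} (g : H Ω) (φ : 𝓓(Ω, ℝ)) :
    Integrable (fun x => g x * φ x) (volume.restrict (Ω : Set (E n))) := by
  have h1 : MemLp (g : E n → ℝ) 2 (volume.restrict (Ω : Set (E n))) := Lp.memLp g
  have h2 : MemLp (φ : E n → ℝ) 2 (volume.restrict (Ω : Set (E n))) :=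
    (φ.continuous.memLp_of_hasCompactSupport φ.hasCompactSupport).restrict _
  exact h1.integrable_mul h2

/-- The value `A u` is determined by `u`. -/
lemma IsDirichletLaplacian.unique {n : ℕ} {Ω : Opens (E n)} {u g g' : H Ω}
    (h : IsDirichletLaplacian Ω u g) (h' : IsDirichletLaplacian Ω u g') : g = g' := by
  have key : ∀ᵐ x ∂(volume : Measure (E n)), x ∈ (Ω : Set (E n)) → (g x - g' x) = 0 := by
    refine Ω.isOpen.ae_eq_zero_of_integral_contDiff_smul_eq_zero ?_ ?_
    · have h1 : LocallyIntegrable (fun x => g x - g' x) (volume.restrict (Ω : Set (E n))) :=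
        ((Lp.memLp g).sub (Lp.memLp g')).locallyIntegrable (by norm_num)
      exact locallyIntegrableOn_of_locallyIntegrable_restrict h1
    · intro φ hφ hc hs
      let ψ : 𝓓(Ω, ℝ) := ⟨φ, hφ, hc, hs⟩
      have e1 : ∫ x in (Ω : Set (E n)), g x * ψ x = ∫ x in (Ω : Set (E n)), g' x * ψ x := by
        rw [← h.2 ψ, ← h'.2 ψ]
      have e2 : ∫ x in (Ω : Set (E n)), (g x * ψ x - g' x * ψ x) = 0 := by
        rw [integral_sub (integrable_mul_testFunction g ψ) (integrable_mul_testFunction g' ψ),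
          e1, sub_self]
      rw [← setIntegral_eq_integral_of_forall_compl_eq_zero (s := (Ω : Set (E n)))]
      · rw [← e2]
        congr 1
        ext x
        change φ x * (g x - g' x) = g x * φ x - g' x * φ x
        ring
      · intro x hx
        have : φ x = 0 := image_eq_zero_of_notMem_tsupport (fun hx' => hx (hs hx'))
        simp [this]
  apply Lp.ext
  filter_upwards [(ae_restrict_iff' Ω.isOpen.measurableSet).2 key] with x hx
  linarith

lemma opA_eq {n : ℕ} {Ω : Opens (E n)} {u g : H Ω} (h : IsDirichletLaplacian Ω u g) :
    opA Ω u = g := by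
  have hex : ∃ g, IsDirichletLaplacian Ω u g := ⟨g, h⟩
  unfold opA
  rw [dif_pos hex]
  exact hex.choose_spec.unique h

/-- The (closed) eigenspace of `A` for the eigenvalue `μ`; it is zero if `μ` is not an
eigenvalue. -/
def eigenspaceA {n : ℕ} (Ω : Opens (E n)) (μ : ℝ) : Submodule ℝ (H Ω) :=
  (Submodule.span ℝ {w | IsDirichletLaplacian Ω w (μ • w)}).topologicalClosure

instance {n : ℕ} (Ω : Opens (E n)) (μ : ℝ) : CompleteSpace (eigenspaceA Ω μ) :=
  inferInstanceAs (CompleteSpace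
    (Submodule.span ℝ {w | IsDirichletLaplacian Ω w (μ • w)}).topologicalClosure)

/-- `‖A^s u‖²`, through the spectral decomposition of `A` (which has a complete orthonormal system
of eigenvectors): `‖A^s u‖² = ∑_μ μ^{2s} ‖P_μ u‖²`, where `μ` runs over the eigenvalues of `A`
and `P_μ` is the orthogonal projection onto the eigenspace of `μ`. It is used for
`u ∈ D(A)` and `s ∈ [0,1]`, where the sum converges. -/
def fracNormSq {n : ℕ} (Ω : Opens (E n)) (s : ℝ) (u : H Ω) : ℝ :=
  ∑' μ : ℝ, μ ^ (2 * s) * ‖(eigenspaceA Ω μ).starProjection u‖ ^ 2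

/-! ### The biharmonic operator `A₁ = Δ²` -/

/-- The boundary conditions: clamped (`u = ∂u/∂ν = 0`) or hinged (`u = Δu = 0`). -/
inductive BoundaryCondition
  | clamped
  | hinged

/-- The energy space `D(A₁^{1/2})`: it is `H²_0(Ω)` for the clamped boundary condition and
`D(A) = H²(Ω) ∩ H¹_0(Ω)` for the hinged one. In both cases `D(A₁^{1/2}) ⊆ D(A)`, and its norm is
`‖A₁^{1/2} u‖ = ‖A u‖`. -/
def energySpace {n : ℕ} (bc : BoundaryCondition) (Ω : Opens (E n)) : Set (H Ω) :=
  match bc with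
  | .clamped => {u | MemSobolevZero Ω 2 u}
  | .hinged => domA Ω

/-- `u ∈ D(A₁)` and `A₁ u = g`, where `A₁ = Δ²` is the operator of the form `(Δu, Δw)` on
`D(A₁^{1/2})`. -/
def IsBiharmonic {n : ℕ} (bc : BoundaryCondition) (Ω : Opens (E n)) (u g : H Ω) : Prop :=
  u ∈ energySpace bc Ω ∧ ∀ w ∈ energySpace bc Ω, ⟪opA Ω u, opA Ω w⟫ = ⟪g, w⟫

/-- The first (smallest) eigenvalue `σ₁` of `A₁`. -/
def sigmaOne {n : ℕ} (bc : BoundaryCondition) (Ω : Opens (E n)) : ℝ :=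
  sInf {σ : ℝ | ∃ w : H Ω, w ≠ 0 ∧ IsBiharmonic bc Ω w (σ • w)}

/-! ### The nonlinear problem -/

/-- The primitive `f̂(s) = ∫₀ˢ f(τ) dτ`. -/
def primitive (f : ℝ → ℝ) (s : ℝ) : ℝ := ∫ τ in (0 : ℝ)..s, f τ

/-- The assumptions on the source `f`, with growth exponent `p` and constants `C_{f'}`, `C_f`,
`c_f`, on a domain of `ℝⁿ` whose first eigenvalue is `σ₁`. -/
structure IsSource (n : ℕ) (σ₁ : ℝ) (f : ℝ → ℝ) (p Cf' Cf cf : ℝ) : Prop where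
  contDiff : ContDiff ℝ 1 f
  map_zero : f 0 = 0
  p_nonneg : 0 ≤ p
  p_le : 5 ≤ n → p ≤ 4 / ((n : ℝ) - 4)
  Cf'_pos : 0 < Cf'
  Cf_nonneg : 0 ≤ Cf
  cf_nonneg : 0 ≤ cf
  cf_lt : cf < σ₁
  abs_deriv_le : ∀ s, |deriv f s| ≤ Cf' * (1 + |s| ^ p)
  le_primitive : ∀ s, -Cf - cf / 2 * s ^ 2 ≤ primitive f s
  primitive_le : ∀ s, primitive f s ≤ f s * s + cf / 2 * s ^ 2

/-- `(u, v)` with `v = u_t` is a global weak solution of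
`u_tt + κ A u + A₁ u + γ (‖A^α u‖² + ‖u_t‖²)^q u_t + f(u) = hl`, `u(0) = u₀`, `u_t(0) = u₁`,
in the class `(u, u_t) ∈ C([0,∞), D(A₁^{1/2}) × H)`. -/
structure IsWeakSolution {n : ℕ} (bc : BoundaryCondition) (Ω : Opens (E n)) (α q γ κ : ℝ)
    (f : ℝ → ℝ) (hl u₀ u₁ : H Ω) (u v : ℝ → H Ω) : Prop where
  mem_energySpace : ∀ t, 0 ≤ t → u t ∈ energySpace bc Ω
  /-- continuity with values in `D(A₁^{1/2})` -/
  continuousOn_left : ContinuousOn (fun t => opA Ω (u t)) (Ici 0)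
  continuousOn_left_H : ContinuousOn u (Ici 0)
  continuousOn_right : ContinuousOn v (Ici 0)
  init_left : u 0 = u₀
  init_right : v 0 = u₁
  hasDerivAt : ∀ t, 0 < t → HasDerivAt u (v t) t
  equation : ∀ w ∈ energySpace bc Ω, ∀ t, 0 < t →
    HasDerivAt (fun s => ⟪v s, w⟫)
      (⟪hl, w⟫ - κ * ⟪opA Ω (u t), w⟫ - ⟪opA Ω (u t), opA Ω w⟫
        - γ * (fracNormSq Ω α (u t) + ‖v t‖ ^ 2) ^ q * ⟪v t, w⟫
        - ∫ x in (Ω : Set (E n)), f (u t x) * w x) t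

/-- The energy `E(u, v)`. -/
def energy {n : ℕ} (Ω : Opens (E n)) (κ : ℝ) (f : ℝ → ℝ) (hl u v : H Ω) : ℝ :=
  1 / 2 * (‖v‖ ^ 2 + ‖opA Ω u‖ ^ 2 + κ * fracNormSq Ω (1 / 2) u)
    + (∫ x in (Ω : Set (E n)), primitive f (u x)) - ⟪hl, u⟫

/-- `ω = 1 - c_f / σ₁`. -/
def omega {n : ℕ} (bc : BoundaryCondition) (Ω : Opens (E n)) (cf : ℝ) : ℝ :=
  1 - cf / sigmaOne bc Ω

/-- `K_λ = C_f |Ω| + ‖h_λ‖² / (σ₁ ω)`. -/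
def Kconst {n : ℕ} (bc : BoundaryCondition) (Ω : Opens (E n)) (Cf cf : ℝ) (hl : H Ω) : ℝ :=
  Cf * (volume (Ω : Set (E n))).toReal + 1 / (sigmaOne bc Ω * omega bc Ω cf) * ‖hl‖ ^ 2

/-- The modified energy `Ẽ(u, v) = E(u, v) + K_λ`. -/
def modEnergy {n : ℕ} (bc : BoundaryCondition) (Ω : Opens (E n)) (κ : ℝ) (f : ℝ → ℝ)
    (Cf cf : ℝ) (hl u v : H Ω) : ℝ :=
  energy Ω κ f hl u v + Kconst bc Ω Cf cf hl

/-- The polynomial profile `[(q / C) s + 1 / e^q]^{-1/q}`. -/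
def profile (q C e s : ℝ) : ℝ := (q / C * s + 1 / e ^ q) ^ (-(1 / q))

end EnergyDampedBeam

end

open EnergyDampedBeam

open MeasureTheory TopologicalSpace Filter Set
open scoped Topology Distributions LineDeriv Laplacian ContDiff RealInnerProductSpace ENNReal NNReal

noncomputable section

namespace EnergyDampedBeam

/-! ### Continuously differentiable functions with compact support on `ℝⁿ` -/

/-! The decay comes from Nakao's method, applied to the scalar quantities Y = Ẽ, V = ‖u_t‖², N =
‖A^α u‖² + ‖u_t‖² and m = (u_t, u), which `IsDissipative` collects. The energy identity is Y' = -γ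
N^q V. Coercivity of Ẽ (`le_modEnergy`) gives V ≤ 2Y and N ≤ c₀Y, so -Y' ≤ 2γc₀^q Y^(q+1);
integrating this gives the lower profile, which in turn excludes exponential decay.

For the upper profile, N ≥ V shows that the energy lost over a unit interval controls V there: if
the loss is at most γδ^(q+1), then V has mean at most 2δ. The multiplier u gives Y ≤ K + (3/2)V - m'
+ γN^q|m|. Integrated between two times at which V = O(δ), it bounds Y - 2K by a multiple of δ
(`IsDissipative.energy_le`). Hence (Y(t) - 2K)^(q+1) ≤ C(Y(t) - Y(t+1)), and iterating
`rpow_neg_add_le` produces the profile. Here C depends on q, γ, c₀, c₁, Y(0) alone, and c₀, c₁ on σ₁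
and c_f alone, so the estimates are uniform in κ, λ, h and f.

The rest justifies these relations for weak solutions. H¹_0(Ω) is realised as the closure of the
gradients of test functions, with an embedding J into L², and A⁻¹ = JJ*
(`isDirichletLaplacian_iff_eq_solG`). J is compact because averages over a fine grid approximate it
(`isCompactOperator_embJ`), so the spectral theorem governs the series for ‖A^s u‖², and σ₁‖u‖² ≤
‖Au‖² follows from a largest eigenvalue (`sigmaOne_mul_norm_sq_le`). The growth of f calls for D(A)
⊂ L^{2(p+1)}, obtained by testing the equation with truncated powers of its solution rather than
from elliptic regularity (`exists_eLpNorm_solG_le`). Since u_t lies only in H, it is not an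
admissible multiplier; the energy identity is proved with symmetric difference quotients of u, which
stay in the energy space (`energy_sub_eq_integral`). -/

lemma norm_sq_dual_eq_sum {n : ℕ} (L : E n →L[ℝ] ℝ) :
    ‖L‖ ^ 2 = ∑ i, L (EuclideanSpace.single i 1) ^ 2 := by
  have h : ‖L‖ = ‖(InnerProductSpace.toDual ℝ (E n)).symm L‖ := by simp
  rw [h, EuclideanSpace.real_norm_sq_eq]
  refine Finset.sum_congr rfl fun i _ => ?_
  have h2 := InnerProductSpace.toDual_symm_apply (𝕜 := ℝ) (x := EuclideanSpace.single i 1) (y := L)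
  rw [← h2, EuclideanSpace.inner_single_right]
  simp

lemma sq_lintegral_le {X : Type*} [MeasurableSpace X] {μ : Measure X} {g : X → ℝ≥0∞}
    (hg : AEMeasurable g μ) : (∫⁻ x, g x ∂μ) ^ 2 ≤ μ univ * ∫⁻ x, g x ^ 2 ∂μ := by
  have h := ENNReal.lintegral_mul_le_Lp_mul_Lq μ Real.HolderConjugate.two_two
    (aemeasurable_const (b := (1 : ℝ≥0∞))) hg
  have h2 := pow_le_pow_left₀ (zero_le) h 2
  simp only [Pi.mul_apply, one_mul, ENNReal.one_rpow, lintegral_one] at h2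
  refine h2.trans (le_of_eq ?_)
  rw [mul_pow, ← ENNReal.rpow_mul_natCast, ← ENNReal.rpow_mul_natCast]
  simp

/-- The increment is the integral of the derivative along the segment from x to x + z;
Cauchy–Schwarz in the parameter, Tonelli and translation invariance do the rest. Both Poincaré's
inequality and the compactness theorem rest on this bound. -/
lemma lintegral_translate_sub_sq_le {n : ℕ} {f : E n → ℝ} (hf : ContDiff ℝ 1 f) (z : E n) :
    ∫⁻ x, ‖f (x + z) - f x‖ₑ ^ 2 ≤ ‖z‖ₑ ^ 2 * ∫⁻ x, ‖fderiv ℝ f x‖ₑ ^ 2 := by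
  have hc : Continuous (fderiv ℝ f) := hf.continuous_fderiv (by norm_num)
  have hpt : ∀ x, ‖f (x + z) - f x‖ₑ ^ 2 ≤
      ∫⁻ t in Ioc (0 : ℝ) 1, ‖z‖ₑ ^ 2 * ‖fderiv ℝ f (x + t • z)‖ₑ ^ 2 := by
    intro x
    have hd : ∀ t ∈ uIcc (0 : ℝ) 1, HasDerivAt (fun t : ℝ => f (x + t • z))
        (fderiv ℝ f (x + t • z) z) t := by
      intro t _
      have h1 : HasDerivAt (fun t : ℝ => x + t • z) z t := by
        simpa using ((hasDerivAt_id t).smul_const z).const_add x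
      exact ((hf.differentiable (by norm_num)).differentiableAt.hasFDerivAt).comp_hasDerivAt t h1
    have hcont : Continuous fun t : ℝ => fderiv ℝ f (x + t • z) z :=
      (hc.comp (by fun_prop)).clm_apply continuous_const
    have hi := intervalIntegral.integral_eq_sub_of_hasDerivAt hd (hcont.intervalIntegrable _ _)
    simp only [one_smul, zero_smul, add_zero] at hi
    rw [← hi, intervalIntegral.integral_of_le zero_le_one]
    calc _ ≤ (∫⁻ t in Ioc (0 : ℝ) 1, ‖fderiv ℝ f (x + t • z) z‖ₑ) ^ 2 := by
          gcongr; exact enorm_integral_le_lintegral_enorm _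
      _ ≤ ∫⁻ t in Ioc (0 : ℝ) 1, ‖fderiv ℝ f (x + t • z) z‖ₑ ^ 2 := by
          refine (sq_lintegral_le hcont.enorm.measurable.aemeasurable).trans ?_
          simp
      _ ≤ _ := by
          gcongr with t
          rw [mul_comm, ← mul_pow]
          gcongr
          exact ContinuousLinearMap.le_opENorm _ _
  calc _ ≤ ∫⁻ x, ∫⁻ t in Ioc (0 : ℝ) 1, ‖z‖ₑ ^ 2 * ‖fderiv ℝ f (x + t • z)‖ₑ ^ 2 :=
        lintegral_mono hpt
    _ = ∫⁻ t in Ioc (0 : ℝ) 1, ∫⁻ x, ‖z‖ₑ ^ 2 * ‖fderiv ℝ f (x + t • z)‖ₑ ^ 2 := by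
        rw [lintegral_lintegral_swap]
        refine Continuous.aemeasurable ?_
        refine ENNReal.continuous_const_mul (by finiteness) |>.comp ?_
        exact (ENNReal.continuous_pow 2).comp (hc.comp (by fun_prop)).enorm
    _ = ∫⁻ t in Ioc (0 : ℝ) 1, ‖z‖ₑ ^ 2 * ∫⁻ x, ‖fderiv ℝ f x‖ₑ ^ 2 := by
        refine lintegral_congr fun t => ?_
        rw [lintegral_const_mul' _ _ (by finiteness)]
        rw [lintegral_add_right_eq_self (fun x => ‖fderiv ℝ f x‖ₑ ^ 2) (t • z)]
    _ = _ := by simp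

/-- Poincaré's inequality on bounded sets. -/
lemma exists_poincare_const {n : ℕ} (hn : 1 ≤ n) {s : Set (E n)} (hs : Bornology.IsBounded s) :
    ∃ C : ℝ≥0, ∀ f : E n → ℝ, ContDiff ℝ 1 f → Function.support f ⊆ s →
      ∫⁻ x, ‖f x‖ₑ ^ 2 ≤ (C : ℝ≥0∞) ^ 2 * ∫⁻ x, ‖fderiv ℝ f x‖ₑ ^ 2 := by
  obtain ⟨R, hR⟩ := hs.subset_ball 0
  -- A translation by the diameter of a ball containing the support moves the support off itself, so
  -- f(x) vanishes wherever f(x + z) does not, and there f(x + z) is the whole increment.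
  let z : E n := EuclideanSpace.single ⟨0, hn⟩ (2 * R)
  have hz : ‖z‖ = ‖2 * R‖ := by simp [z]
  refine ⟨‖z‖₊, fun f hf hsupp => le_trans ?_ (lintegral_translate_sub_sq_le hf z)⟩
  have hfz : ∀ x, f (x + z) ≠ 0 → f x = 0 := by
    intro x hx
    by_contra h0
    have h1 := hR (hsupp hx)
    have h2 := hR (hsupp h0)
    simp only [Metric.mem_ball, dist_zero_right] at h1 h2
    have h3 : ‖z‖ ≤ ‖x + z‖ + ‖x‖ := by
      calc ‖z‖ = ‖(x + z) - x‖ := by simp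
        _ ≤ _ := norm_sub_le _ _
    rw [hz] at h3
    have := le_abs_self (2 * R)
    rw [Real.norm_eq_abs] at h3
    linarith
  rw [← lintegral_add_right_eq_self (fun x => ‖f x‖ₑ ^ 2) z]
  refine lintegral_mono fun x => ?_
  by_cases h : f (x + z) = 0
  · simp [h]
  · simp [hfz x h]

/-- The cell of the grid of mesh `ε` with index `k`. -/
def gridCell {n : ℕ} (ε : ℝ) (k : Fin n → ℤ) : Set (E n) := {x | ∀ i, ⌊x i / ε⌋ = k i}

lemma volume_box {n : ℕ} (a b : Fin n → ℝ) :
    volume {x : E n | ∀ i, x i ∈ Ico (a i) (b i)} = ∏ i, ENNReal.ofReal (b i - a i) := by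
  rw [← Real.volume_pi_Ico, ← (EuclideanSpace.volume_preserving_symm_measurableEquiv_toLp
    (Fin n)).symm.measure_preimage_equiv]
  congr 1
  ext x
  simp [Set.mem_pi]

lemma gridCell_eq {n : ℕ} {ε : ℝ} (hε : 0 < ε) (k : Fin n → ℤ) :
    gridCell ε k = {x : E n | ∀ i, x i ∈ Ico (k i * ε) (k i * ε + ε)} := by
  ext x
  refine forall_congr' fun i => ?_
  rw [Int.floor_eq_iff, mem_Ico, le_div_iff₀ hε, div_lt_iff₀ hε, add_mul, one_mul]

lemma measurableSet_gridCell {n : ℕ} (ε : ℝ) (k : Fin n → ℤ) :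
    MeasurableSet (gridCell ε k : Set (E n)) := by
  unfold gridCell
  have : {x : E n | ∀ i, ⌊x i / ε⌋ = k i} = ⋂ i, {x : E n | ⌊x i / ε⌋ = k i} := by
    ext; simp
  rw [this]
  refine MeasurableSet.iInter fun i => ?_
  exact (Int.measurable_floor.comp (by fun_prop : Measurable fun x : E n => x i / ε))
    (measurableSet_singleton (k i))

lemma volume_gridCell {n : ℕ} {ε : ℝ} (hε : 0 < ε) (k : Fin n → ℤ) :
    volume (gridCell ε k : Set (E n)) = ENNReal.ofReal ε ^ n := by
  rw [gridCell_eq hε, volume_box]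
  simp

/-- Replacing a function by its averages over the cells of a fine grid is a small perturbation
in `L²`, uniformly on bounded subsets of `H¹`. -/
lemma lintegral_sub_average_sq_le {n : ℕ} {ε : ℝ} (hε : 0 < ε) {f : E n → ℝ}
    (hf : ContDiff ℝ 1 f) (hc : HasCompactSupport f) :
    ∫⁻ x, ‖f x - ⨍ y in gridCell ε (fun i => ⌊x i / ε⌋), f y‖ₑ ^ 2 ≤
      2 ^ n * (n * ENNReal.ofReal ε ^ 2) * ∫⁻ x, ‖fderiv ℝ f x‖ₑ ^ 2 := by
  set V : ℝ≥0∞ := ENNReal.ofReal ε ^ n with hV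
  have hV0 : V ≠ 0 := by simp [V, hε]
  have hVt : V ≠ ⊤ := ENNReal.pow_ne_top ENNReal.ofReal_ne_top
  -- If x lies in a cell Q, then Q - x is contained in B whatever the cell. Replacing Q - x by B
  -- decouples the domain of integration from x, at the cost of the factor |B|/|Q| = 2^n; on B one
  -- has ‖z‖² ≤ nε².
  let B : Set (E n) := {z | ∀ i, z i ∈ Ico (-ε) ε}
  have hBm : MeasurableSet B := by
    have : B = ⋂ i, {z : E n | z i ∈ Ico (-ε) ε} := by ext; simp [B]
    rw [this]
    exact MeasurableSet.iInter fun i =>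
      (by fun_prop : Measurable fun x : E n => x i) measurableSet_Ico
  have hBvol : volume B = 2 ^ n * V := by
    have := volume_box (n := n) (fun _ => -ε) (fun _ => ε)
    rw [show B = {x : E n | ∀ i, x i ∈ Ico ((fun _ => -ε) i) ((fun _ => ε) i)} from rfl, this]
    simp only [sub_neg_eq_add, Finset.prod_const, Finset.card_univ, Fintype.card_fin, V]
    rw [← two_mul, ENNReal.ofReal_mul (by norm_num), mul_pow]
    simp
  have hpt : ∀ x, ‖f x - ⨍ y in gridCell ε (fun i => ⌊x i / ε⌋), f y‖ₑ ^ 2 ≤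
      V⁻¹ * ∫⁻ z in B, ‖f (x + z) - f x‖ₑ ^ 2 := by
    intro x
    set Q := (gridCell ε (fun i => ⌊x i / ε⌋) : Set (E n))
    have hQ : volume Q = V := volume_gridCell hε _
    have hfi : IntegrableOn f Q := (hf.continuous.integrable_of_hasCompactSupport hc).integrableOn
    have hci : IntegrableOn (fun _ => f x) Q :=
      integrableOn_const (by rw [hQ]; exact hVt)
    have h1 : f x - ⨍ y in Q, f y = V.toReal⁻¹ * ∫ y in Q, (f x - f y) := by
      rw [integral_sub hci hfi, setAverage_eq, setIntegral_const, measureReal_def, hQ]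
      have : V.toReal ≠ 0 := ENNReal.toReal_ne_zero.2 ⟨hV0, hVt⟩
      simp only [smul_eq_mul]
      field_simp
    have h2 : ‖∫ y in Q, (f x - f y)‖ₑ ^ 2 ≤ V * ∫⁻ y in Q, ‖f x - f y‖ₑ ^ 2 := by
      calc _ ≤ (∫⁻ y in Q, ‖f x - f y‖ₑ) ^ 2 := by
            gcongr; exact enorm_integral_le_lintegral_enorm _
        _ ≤ _ := by
          refine (sq_lintegral_le (by
            have := hf.continuous
            exact (by fun_prop : Continuous fun y => ‖f x - f y‖ₑ).aemeasurable)).trans ?_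
          rw [Measure.restrict_apply_univ, hQ]
    have h3 : ∫⁻ y in Q, ‖f x - f y‖ₑ ^ 2 ≤ ∫⁻ z in B, ‖f (x + z) - f x‖ₑ ^ 2 := by
      rw [← lintegral_indicator (measurableSet_gridCell _ _), ← lintegral_indicator hBm,
        ← lintegral_add_right_eq_self _ x]
      refine lintegral_mono fun z => ?_
      classical
      rw [indicator_apply, indicator_apply]
      by_cases hz : z + x ∈ Q
      · have hzB : z ∈ B := by
          intro i
          have e1 : x ∈ Q := fun i => rfl
          rw [show Q = _ from gridCell_eq hε _] at hz e1
          have a1 := hz i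
          have a2 := e1 i
          simp only [PiLp.add_apply, mem_Ico] at a1 a2 ⊢
          constructor <;> linarith [a1.1, a1.2, a2.1, a2.2]
        rw [if_pos hz, if_pos hzB, ← enorm_neg, neg_sub, add_comm z x]
      · rw [if_neg hz]; exact zero_le
    rw [h1, enorm_mul, mul_pow]
    have h4 : ‖V.toReal⁻¹‖ₑ = V⁻¹ := by
      rw [enorm_inv (ENNReal.toReal_ne_zero.2 ⟨hV0, hVt⟩), Real.enorm_of_nonneg ENNReal.toReal_nonneg,
        ENNReal.ofReal_toReal hVt]
    rw [h4]
    calc _ ≤ V⁻¹ ^ 2 * (V * ∫⁻ z in B, ‖f (x + z) - f x‖ₑ ^ 2) := by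
          gcongr; exact h2.trans (by gcongr)
      _ = _ := by
        rw [sq, ← mul_assoc, mul_assoc V⁻¹ V⁻¹ V, ENNReal.inv_mul_cancel hV0 hVt, mul_one]
  have hfc := hf.continuous
  calc _ ≤ ∫⁻ x, V⁻¹ * ∫⁻ z in B, ‖f (x + z) - f x‖ₑ ^ 2 := lintegral_mono hpt
    _ = V⁻¹ * ∫⁻ z in B, ∫⁻ x, ‖f (x + z) - f x‖ₑ ^ 2 := by
        rw [lintegral_const_mul' _ _ (ENNReal.inv_ne_top.2 hV0), lintegral_lintegral_swap]
        exact (by fun_prop : Continuous fun p : E n × E n =>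
          ‖f (p.1 + p.2) - f p.1‖ₑ ^ 2).aemeasurable
    _ ≤ V⁻¹ * ∫⁻ z in B, (n * ENNReal.ofReal ε ^ 2) * ∫⁻ x, ‖fderiv ℝ f x‖ₑ ^ 2 := by
        gcongr V⁻¹ * ?_
        refine setLIntegral_mono' hBm fun z hz => (lintegral_translate_sub_sq_le hf z).trans ?_
        gcongr
        have hz2 : ‖z‖ ^ 2 ≤ n * ε ^ 2 := by
          rw [EuclideanSpace.real_norm_sq_eq]
          calc ∑ i, z i ^ 2 ≤ ∑ _i : Fin n, ε ^ 2 := by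
                refine Finset.sum_le_sum fun i _ => ?_
                exact sq_le_sq' (by linarith [(hz i).1]) (hz i).2.le
            _ = _ := by simp
        rw [← ofReal_norm, ← ENNReal.ofReal_pow (norm_nonneg _),
          ← ENNReal.ofReal_pow hε.le, ← ENNReal.ofReal_natCast n, ← ENNReal.ofReal_mul (by simp)]
        exact ENNReal.ofReal_le_ofReal hz2
    _ = _ := by
        rw [setLIntegral_const, hBvol]
        calc _ = (V⁻¹ * V) * (2 ^ n * (n * ENNReal.ofReal ε ^ 2) *
              ∫⁻ x, ‖fderiv ℝ f x‖ₑ ^ 2) := by ring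
          _ = _ := by rw [ENNReal.inv_mul_cancel hV0 hVt, one_mul]

/-! ### Sobolev inequalities for functions supported in a bounded set -/

/-- On the line, a function of compact support is the integral of its derivative over a half-line.
This serves dimension one, where no integrability exponent p ≥ 1 lies below the dimension. -/
lemma enorm_le_lintegral_fderiv {f : E 1 → ℝ} (hf : ContDiff ℝ 1 f) (hc : HasCompactSupport f)
    (x : E 1) : ‖f x‖ₑ ≤ ∫⁻ y, ‖fderiv ℝ f y‖ₑ := by
  let e : ℝ ≃ₗᵢ[ℝ] E 1 := (OrthonormalBasis.singleton (Fin 1) ℝ).equiv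
    (EuclideanSpace.basisFun (Fin 1) ℝ) (Equiv.refl _)
  have h1 := HasCompactSupport.enorm_le_lintegral_Ici_deriv (f := f ∘ e)
    (hf.comp e.contDiff) (hc.comp_homeomorph e.toHomeomorph) (e.symm x)
  simp only [Function.comp_apply, LinearIsometryEquiv.apply_symm_apply] at h1
  refine h1.trans ((setLIntegral_le_lintegral _ _).trans ?_)
  rw [← e.measurePreserving.lintegral_comp_emb e.toHomeomorph.measurableEmbedding]
  refine lintegral_mono fun t => ?_
  have h2 : HasDerivAt (f ∘ e) (fderiv ℝ f (e t) (e 1)) t :=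
    ((hf.differentiable (by norm_num)).differentiableAt.hasFDerivAt).comp_hasDerivAt t
      (by simpa using e.toContinuousLinearEquiv.toContinuousLinearMap.hasDerivAt)
  rw [h2.deriv]
  refine (ContinuousLinearMap.le_opENorm _ _).trans ?_
  have : ‖e 1‖ₑ = 1 := by rw [← ofReal_norm, e.norm_map]; simp
  rw [this, mul_one]

lemma support_norm_fderiv_subset_closure {n : ℕ} {f : E n → ℝ} {s : Set (E n)}
    (h : Function.support f ⊆ s) : Function.support (fun x => ‖fderiv ℝ f x‖) ⊆ closure s :=
  fun _ hx => closure_mono h (support_fderiv_subset ℝ (fun h0 => hx (by simp [h0])))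

/-- Hölder's inequality on the closure of s, which has finite measure and carries the derivative.
The exponent p = 0 is separate, since the power of the measure may then have a negative exponent. -/
lemma exists_eLpNorm_fderiv_le {n : ℕ} {s : Set (E n)} (hs : Bornology.IsBounded s) {p : ℝ≥0}
    (hp : p ≤ 2) : ∃ C : ℝ≥0, ∀ f : E n → ℝ, ContDiff ℝ 1 f → Function.support f ⊆ s →
      eLpNorm (fderiv ℝ f) p volume ≤ C * eLpNorm (fderiv ℝ f) 2 volume := by
  have hfin : volume (closure s) ^ (1 / (p : ℝ≥0∞).toReal - 1 / (2 : ℝ≥0∞).toReal) ≠ ⊤ ∨ p = 0 := by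
    by_cases h0 : p = 0
    · exact Or.inr h0
    left
    have h2 : (0 : ℝ) < p := by positivity
    have h3 : (p : ℝ) ≤ 2 := by exact_mod_cast hp
    refine ENNReal.rpow_ne_top_of_nonneg ?_ hs.closure.measure_lt_top.ne
    simp only [ENNReal.coe_toReal, ENNReal.toReal_ofNat, sub_nonneg]
    exact one_div_le_one_div_of_le h2 h3
  rcases hfin with hfin | rfl
  · refine ⟨(volume (closure s) ^ (1 / (p : ℝ≥0∞).toReal - 1 / (2 : ℝ≥0∞).toReal)).toNNReal,
      fun f hf hsupp => ?_⟩
    have hres : ∀ q : ℝ≥0∞, eLpNorm (fderiv ℝ f) q (volume.restrict (closure s)) =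
        eLpNorm (fderiv ℝ f) q volume := fun q => by
      rw [← eLpNorm_norm, ← eLpNorm_norm (fderiv ℝ f)]
      exact eLpNorm_restrict_eq_of_support_subset (support_norm_fderiv_subset_closure hsupp)
    rw [ENNReal.coe_toNNReal hfin, ← hres p, ← hres 2, mul_comm]
    have := eLpNorm_le_eLpNorm_mul_rpow_measure_univ (p := (p : ℝ≥0∞)) (q := 2)
      (μ := volume.restrict (closure s)) (f := fderiv ℝ f) (by exact_mod_cast hp)
      (hf.continuous_fderiv (by norm_num)).aestronglyMeasurable
    simpa using this
  · exact ⟨0, fun f _ _ => by simp⟩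

/-- The Sobolev inequality used for the growth exponent `p`. -/
lemma exists_sobolev_const {n : ℕ} (hn : 1 ≤ n) {s : Set (E n)} (hs : Bornology.IsBounded s)
    {p : ℝ} (hp : 0 ≤ p) (hpn : 5 ≤ n → p ≤ 4 / ((n : ℝ) - 4)) :
    ∃ C : ℝ≥0, ∀ f : E n → ℝ, ContDiff ℝ 1 f → Function.support f ⊆ s →
      eLpNorm f (ENNReal.ofReal (4 * (p + 1) / (p + 2))) volume ≤
        C * eLpNorm (fderiv ℝ f) 2 volume := by
  set r : ℝ≥0 := (4 * (p + 1) / (p + 2)).toNNReal with hr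
  have hrr : (r : ℝ) = 4 * (p + 1) / (p + 2) := Real.coe_toNNReal _ (by positivity)
  -- The exponent r stays below 4 for every p, which settles all dimensions n ≤ 4.
  have hrinv : (1 : ℝ) / 4 ≤ (r : ℝ)⁻¹ := by
    rw [hrr, inv_div, div_le_div_iff₀ (by norm_num) (by positivity)]
    linarith
  change ∃ C : ℝ≥0, ∀ f : E n → ℝ, ContDiff ℝ 1 f → Function.support f ⊆ s →
      eLpNorm f r volume ≤ C * eLpNorm (fderiv ℝ f) 2 volume
  rcases (by omega : n = 1 ∨ n = 2 ∨ 3 ≤ n) with rfl | rfl | h3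
  · obtain ⟨C, hC⟩ := exists_eLpNorm_fderiv_le hs (p := 1) (by norm_num)
    have hfin : volume s ^ (r : ℝ)⁻¹ ≠ ⊤ :=
      ENNReal.rpow_ne_top_of_nonneg (by positivity) hs.measure_lt_top.ne
    refine ⟨C * (volume s ^ (r : ℝ)⁻¹).toNNReal, fun f hf hsupp => ?_⟩
    have hc : HasCompactSupport f := HasCompactSupport.of_support_subset_isCompact
      hs.isCompact_closure (hsupp.trans subset_closure)
    rw [← eLpNorm_restrict_eq_of_support_subset hsupp]
    refine (eLpNorm_le_of_ae_enorm_bound (C := C * eLpNorm (fderiv ℝ f) 2 volume)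
      (Eventually.of_forall fun x => ?_)).trans ?_
    · refine (enorm_le_lintegral_fderiv hf hc x).trans ?_
      have := hC f hf hsupp
      rwa [ENNReal.coe_one, eLpNorm_one_eq_lintegral_enorm] at this
    · rw [ENNReal.coe_mul, ENNReal.coe_toNNReal hfin]
      simp only [Measure.restrict_apply_univ, ENNReal.coe_toReal, smul_eq_mul]
      rw [mul_right_comm]
  -- In dimension two the exponent 2 is critical; 4/3 is used because its Sobolev conjugate is 4 ≥
  -- r.
  · obtain ⟨C, hC⟩ := exists_eLpNorm_fderiv_le hs (p := 4 / 3) (by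
      rw [← NNReal.coe_le_coe]; push_cast; norm_num)
    refine ⟨eLpNormLESNormFDerivOfLeConst ℝ volume s (4 / 3) r * C, fun f hf hsupp => ?_⟩
    refine (eLpNorm_le_eLpNorm_fderiv_of_le volume hf hsupp (p := 4 / 3) (q := r) ?_ ?_ ?_ hs).trans
      ?_
    · rw [← NNReal.coe_le_coe]; push_cast; norm_num
    · rw [← NNReal.coe_lt_coe]; push_cast; simp; norm_num
    · simp only [finrank_euclideanSpace, Fintype.card_fin]; push_cast; linarith
    · rw [ENNReal.coe_mul, mul_assoc]
      gcongr
      exact hC f hf hsupp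
  · refine ⟨eLpNormLESNormFDerivOfLeConst ℝ volume s 2 r, fun f hf hsupp => ?_⟩
    refine eLpNorm_le_eLpNorm_fderiv_of_le volume hf hsupp (p := 2) (q := r) ?_ ?_ ?_ hs
    · norm_num
    · rw [← NNReal.coe_lt_coe]; push_cast; simp; omega
    · simp only [finrank_euclideanSpace, Fintype.card_fin]; push_cast
      have hnpos : (0 : ℝ) < n := by positivity
      by_cases h5 : 5 ≤ n
      · have h5' : (5 : ℝ) ≤ n := by exact_mod_cast h5
        have := hpn h5
        -- The required inequality 1/2 - 1/n ≤ 1/r is equivalent to p(n - 4) ≤ 4, the growth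
        -- condition on f.
        rw [le_div_iff₀ (by linarith)] at this
        rw [hrr, inv_div, sub_le_iff_le_add, inv_eq_one_div, inv_eq_one_div,
          div_add_div _ _ (by positivity) (by positivity), div_le_div_iff₀ (by norm_num) (by positivity)]
        nlinarith
      · have h4 : (n : ℝ) ≤ 4 := by exact_mod_cast (by omega : n ≤ 4)
        have : (1 : ℝ) / 4 ≤ (n : ℝ)⁻¹ := by
          rw [inv_eq_one_div]; exact one_div_le_one_div_of_le hnpos h4
        linarith

/-! ### Test functions in L²(Ω): gradient, Laplacian and integration by parts -/

/-- A test function as an element of `L²(Ω)`. -/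
def toH {n : ℕ} {Ω : Opens (E n)} : 𝓓(Ω, ℝ) →ₗ[ℝ] H Ω where
  toFun φ := ((φ.continuous.memLp_of_hasCompactSupport φ.hasCompactSupport).restrict _).toLp φ
  map_add' _ _ := rfl
  map_smul' _ _ := rfl

lemma coeFn_toH {n : ℕ} {Ω : Opens (E n)} (φ : 𝓓(Ω, ℝ)) :
    toH φ =ᵐ[volume.restrict (Ω : Set (E n))] φ :=
  MemLp.coeFn_toLp ((φ.continuous.memLp_of_hasCompactSupport φ.hasCompactSupport).restrict _)

lemma eLpNorm_sub_eq_enorm {n : ℕ} {Ω : Opens (E n)} (φ : 𝓓(Ω, ℝ)) (u : H Ω) :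
    eLpNorm (fun x => φ x - u x) 2 (volume.restrict (Ω : Set (E n))) = ‖toH φ - u‖ₑ := by
  rw [Lp.enorm_def]
  refine eLpNorm_congr_ae ?_
  filter_upwards [coeFn_toH φ, Lp.coeFn_sub (toH φ) u] with x h1 h2
  rw [h2, Pi.sub_apply, h1]

lemma tendsto_toH_iff {n : ℕ} {Ω : Opens (E n)} (φ : ℕ → 𝓓(Ω, ℝ)) (u : H Ω) :
    Tendsto (fun j => eLpNorm (fun x => φ j x - u x) 2 (volume.restrict (Ω : Set (E n))))
      atTop (𝓝 0) ↔ Tendsto (fun j => toH (φ j)) atTop (𝓝 u) := by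
  rw [tendsto_iff_edist_tendsto_0]
  simp only [eLpNorm_sub_eq_enorm, edist_eq_enorm_sub]

lemma memSobolevZero_iff {n : ℕ} {Ω : Opens (E n)} {m : ℕ} {u : H Ω} :
    MemSobolevZero Ω m u ↔ ∃ φ : ℕ → 𝓓(Ω, ℝ), Tendsto (fun j => toH (φ j)) atTop (𝓝 u) ∧
      ∀ k ≤ m, ∀ i : Fin k → Fin n, ∃ g : H Ω,
        Tendsto (fun j => toH (partialDeriv i (φ j))) atTop (𝓝 g) := by
  simp only [MemSobolevZero, tendsto_toH_iff]

/-- The partial derivative of a test function. -/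
def pderiv {n : ℕ} {Ω : Opens (E n)} (i : Fin n) : 𝓓(Ω, ℝ) →ₗ[ℝ] 𝓓(Ω, ℝ) :=
  (TestFunction.lineDerivCLM ℝ (EuclideanSpace.single i 1 : E n)).toLinearMap

lemma pderiv_apply {n : ℕ} {Ω : Opens (E n)} (i : Fin n) (φ : 𝓓(Ω, ℝ)) (x : E n) :
    pderiv i φ x = fderiv ℝ φ x (EuclideanSpace.single i 1) := by
  rw [← (φ.contDiff.differentiable (by simp)).differentiableAt.lineDeriv_eq_fderiv]
  simp [pderiv]

/-- The Laplacian of a test function. -/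
def lap {n : ℕ} {Ω : Opens (E n)} : 𝓓(Ω, ℝ) →ₗ[ℝ] 𝓓(Ω, ℝ) := ∑ i, pderiv i ∘ₗ pderiv i

lemma sum_testFunction_apply {n : ℕ} {Ω : Opens (E n)} {ι : Type*} (s : Finset ι)
    (φ : ι → 𝓓(Ω, ℝ)) (x : E n) : (∑ i ∈ s, φ i) x = ∑ i ∈ s, φ i x := by
  classical
  induction s using Finset.induction_on with
  | empty => simp
  | insert a s ha ih => rw [Finset.sum_insert ha, Finset.sum_insert ha, ← ih]; rfl

lemma lap_apply {n : ℕ} {Ω : Opens (E n)} (φ : 𝓓(Ω, ℝ)) (x : E n) :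
    lap φ x = Δ (φ : E n → ℝ) x := by
  rw [InnerProductSpace.laplacian_eq_iteratedFDeriv_orthonormalBasis _
    (EuclideanSpace.basisFun (Fin n) ℝ)]
  simp only [lap, LinearMap.sum_apply, LinearMap.comp_apply, sum_testFunction_apply]
  refine Finset.sum_congr rfl fun i _ => ?_
  rw [pderiv_apply]
  have h1 : (pderiv i φ : E n → ℝ) = fun y => fderiv ℝ φ y (EuclideanSpace.single i 1) :=
    funext fun y => pderiv_apply i φ y
  have hd : DifferentiableAt ℝ (fderiv ℝ (φ : E n → ℝ)) x :=
    (((contDiff_infty.1 φ.contDiff 2).fderiv_right (m := 1) (by norm_num)).differentiable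
      (by norm_num)).differentiableAt
  rw [h1, fderiv_clm_apply hd (by fun_prop)]
  simp [iteratedFDeriv_two_apply]

lemma inner_eq_integral {n : ℕ} {Ω : Opens (E n)} (u : H Ω) (φ : 𝓓(Ω, ℝ)) :
    ⟪u, toH φ⟫ = ∫ x in (Ω : Set (E n)), u x * φ x := by
  rw [L2.inner_def]
  refine integral_congr_ae ?_
  filter_upwards [coeFn_toH φ] with x hx
  rw [hx, mul_comm]; rfl

lemma inner_toH_toH {n : ℕ} {Ω : Opens (E n)} (φ ψ : 𝓓(Ω, ℝ)) :
    ⟪toH φ, toH ψ⟫ = ∫ x, φ x * ψ x := by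
  rw [inner_eq_integral,
    ← setIntegral_eq_integral_of_forall_compl_eq_zero (s := (Ω : Set (E n))) (f := fun x => φ x * ψ x)]
  · refine integral_congr_ae ?_
    filter_upwards [coeFn_toH φ] with x hx
    rw [hx]
  · intro x hx
    have : φ x = 0 := image_eq_zero_of_notMem_tsupport (fun hx' => hx (φ.tsupport_subset hx'))
    simp [this]

lemma integrable_testFunction_mul {n : ℕ} {Ω : Opens (E n)} (φ ψ : 𝓓(Ω, ℝ)) :
    Integrable (fun x => φ x * ψ x) := 
  (φ.continuous.mul ψ.continuous).integrable_of_hasCompactSupport φ.hasCompactSupport.mul_right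

lemma inner_toH_pderiv {n : ℕ} {Ω : Opens (E n)} (i : Fin n) (φ ψ : 𝓓(Ω, ℝ)) :
    ⟪toH φ, toH (pderiv i ψ)⟫ = -⟪toH (pderiv i φ), toH ψ⟫ := by
  have h1 := integrable_testFunction_mul φ (pderiv i ψ)
  have h2 := integrable_testFunction_mul (pderiv i φ) ψ
  rw [inner_toH_toH, inner_toH_toH]
  simp only [pderiv_apply] at h1 h2 ⊢
  exact integral_mul_fderiv_eq_neg_fderiv_mul_of_integrable h2 h1 (integrable_testFunction_mul φ ψ)
    (fun x _ => (φ.contDiff.differentiable (by simp)).differentiableAt)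
    (fun x _ => (ψ.contDiff.differentiable (by simp)).differentiableAt)

lemma isDirichletLaplacian_iff {n : ℕ} {Ω : Opens (E n)} {u g : H Ω} :
    IsDirichletLaplacian Ω u g ↔
      MemSobolevZero Ω 1 u ∧ ∀ φ : 𝓓(Ω, ℝ), -⟪u, toH (lap φ)⟫ = ⟪g, toH φ⟫ := by
  simp only [IsDirichletLaplacian, inner_eq_integral, lap_apply]

/-- The space `L²(Ω)ⁿ` of square integrable vector fields. -/
abbrev VF {n : ℕ} (Ω : Opens (E n)) := PiLp 2 (fun _ : Fin n => H Ω)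

/-- The gradient of a test function. -/
def grad {n : ℕ} {Ω : Opens (E n)} : 𝓓(Ω, ℝ) →ₗ[ℝ] VF Ω where
  toFun φ := WithLp.toLp 2 fun i => toH (pderiv i φ)
  map_add' φ ψ := by ext1 i; simp
  map_smul' c φ := by ext1 i; simp

lemma grad_apply {n : ℕ} {Ω : Opens (E n)} (φ : 𝓓(Ω, ℝ)) (i : Fin n) :
    grad φ i = toH (pderiv i φ) := rfl

lemma inner_grad_grad {n : ℕ} {Ω : Opens (E n)} (φ ψ : 𝓓(Ω, ℝ)) :
    ⟪grad φ, grad ψ⟫ = -⟪toH φ, toH (lap ψ)⟫ := by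
  simp [PiLp.inner_apply, grad_apply, lap, inner_sum, inner_toH_pderiv]

lemma enorm_toH_sq {n : ℕ} {Ω : Opens (E n)} (φ : 𝓓(Ω, ℝ)) :
    ‖toH φ‖ₑ ^ 2 = ∫⁻ x, ‖φ x‖ₑ ^ 2 := by
  rw [← ofReal_norm, ← ENNReal.ofReal_pow (norm_nonneg _), ← real_inner_self_eq_norm_sq,
    inner_toH_toH, ofReal_integral_eq_lintegral_ofReal (integrable_testFunction_mul φ φ)
    (Eventually.of_forall fun x => mul_self_nonneg _)]
  refine lintegral_congr fun x => ?_
  rw [← ofReal_norm, ← ENNReal.ofReal_pow (norm_nonneg _), Real.norm_eq_abs, sq_abs, sq]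

lemma enorm_grad_sq {n : ℕ} {Ω : Opens (E n)} (φ : 𝓓(Ω, ℝ)) :
    ‖grad φ‖ₑ ^ 2 = ∫⁻ x, ‖fderiv ℝ φ x‖ₑ ^ 2 := by
  have h : ‖grad φ‖ₑ ^ 2 = ∑ i, ‖toH (pderiv i φ)‖ₑ ^ 2 := by
    rw [← ofReal_norm, ← ENNReal.ofReal_pow (norm_nonneg _), PiLp.norm_sq_eq_of_L2,
      ENNReal.ofReal_sum_of_nonneg fun i _ => by positivity]
    refine Finset.sum_congr rfl fun i _ => ?_
    rw [grad_apply, ENNReal.ofReal_pow (norm_nonneg _), ofReal_norm]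
  rw [h]
  simp only [enorm_toH_sq]
  rw [← lintegral_finsetSum _ fun i _ =>
    (by have := (pderiv i φ).continuous; fun_prop : Measurable fun x => ‖pderiv i φ x‖ₑ ^ 2)]
  refine lintegral_congr fun x => ?_
  rw [← ofReal_norm (fderiv ℝ φ x), ← ENNReal.ofReal_pow (norm_nonneg _), norm_sq_dual_eq_sum,
    ENNReal.ofReal_sum_of_nonneg fun i _ => by positivity]
  refine Finset.sum_congr rfl fun i _ => ?_
  rw [pderiv_apply, ← ofReal_norm, ← ENNReal.ofReal_pow (norm_nonneg _), Real.norm_eq_abs, sq_abs]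

lemma support_testFunction_subset {n : ℕ} {Ω : Opens (E n)} (φ : 𝓓(Ω, ℝ)) :
    Function.support φ ⊆ (Ω : Set (E n)) := (subset_tsupport _).trans φ.tsupport_subset

lemma contDiff_one_testFunction {n : ℕ} {Ω : Opens (E n)} (φ : 𝓓(Ω, ℝ)) :
    ContDiff ℝ 1 (φ : E n → ℝ) := φ.contDiff.of_le (by norm_num)

lemma exists_norm_toH_le {n : ℕ} (hn : 1 ≤ n) {Ω : Opens (E n)}
    (hb : Bornology.IsBounded (Ω : Set (E n))) :
    ∃ C : ℝ, ∀ φ : 𝓓(Ω, ℝ), ‖toH φ‖ ≤ C * ‖grad φ‖ := by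
  obtain ⟨C, hC⟩ := exists_poincare_const hn hb
  refine ⟨C, fun φ => ?_⟩
  have := hC φ (contDiff_one_testFunction φ) (support_testFunction_subset φ)
  rw [← enorm_toH_sq, ← enorm_grad_sq, ← mul_pow] at this
  have h2 := (ENNReal.pow_le_pow_left_iff two_ne_zero).1 this
  rw [← enorm_norm (toH φ), ← enorm_norm (grad φ)] at h2
  simp only [enorm_eq_nnnorm, nnnorm_norm] at h2
  exact_mod_cast h2

/-! ### The solution operator of the Dirichlet problem -/

/-- The closure in `L²(Ω)ⁿ` of the gradients of test functions. -/
abbrev gradClosure {n : ℕ} (Ω : Opens (E n)) : Submodule ℝ (VF Ω) :=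
  (LinearMap.range (grad (Ω := Ω))).topologicalClosure

instance {n : ℕ} (Ω : Opens (E n)) : CompleteSpace (gradClosure Ω) :=
  inferInstanceAs (CompleteSpace (LinearMap.range (grad (Ω := Ω))).topologicalClosure)

/-- The gradient as a map with values in the closure of its range. -/
def gradK {n : ℕ} {Ω : Opens (E n)} : 𝓓(Ω, ℝ) →ₗ[ℝ] gradClosure Ω :=
  grad.codRestrict _ fun φ => Submodule.le_topologicalClosure _ (LinearMap.mem_range_self _ φ)

lemma coe_gradK {n : ℕ} {Ω : Opens (E n)} (φ : 𝓓(Ω, ℝ)) : (gradK φ : VF Ω) = grad φ := rfl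

lemma denseRange_gradK {n : ℕ} {Ω : Opens (E n)} : DenseRange (gradK (Ω := Ω)) := by
  intro k
  rw [closure_subtype]
  have h : (Subtype.val '' range (gradK (Ω := Ω)) : Set (VF Ω)) =
      (LinearMap.range (grad (Ω := Ω)) : Set (VF Ω)) := by
    ext x
    simp only [mem_image, mem_range, exists_exists_eq_and, coe_gradK]
    simp
  rw [h]
  exact k.2

/-- The embedding `H¹_0(Ω) → L²(Ω)`, where `H¹_0(Ω)` is identified with the space of gradients. -/
def embJ {n : ℕ} (Ω : Opens (E n)) : gradClosure Ω →L[ℝ] H Ω := toH.extendOfNorm gradK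

lemma embJ_gradK {n : ℕ} (hn : 1 ≤ n) {Ω : Opens (E n)}
    (hb : Bornology.IsBounded (Ω : Set (E n))) (φ : 𝓓(Ω, ℝ)) : embJ Ω (gradK φ) = toH φ :=
  LinearMap.extendOfNorm_eq denseRange_gradK (exists_norm_toH_le hn hb) φ

lemma exists_seq_of_gradClosure {n : ℕ} (hn : 1 ≤ n) {Ω : Opens (E n)}
    (hb : Bornology.IsBounded (Ω : Set (E n))) (k : gradClosure Ω) :
    ∃ φ : ℕ → 𝓓(Ω, ℝ), Tendsto (fun j => gradK (φ j)) atTop (𝓝 k) ∧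
      Tendsto (fun j => toH (φ j)) atTop (𝓝 (embJ Ω k)) := by
  obtain ⟨x, hx, hlim⟩ := mem_closure_iff_seq_limit.1 (denseRange_gradK k)
  choose φ hφ using hx
  refine ⟨φ, by simpa only [hφ] using hlim, ?_⟩
  have := ((embJ Ω).continuous.tendsto k).comp hlim
  refine this.congr fun j => ?_
  rw [Function.comp_apply, ← hφ, embJ_gradK hn hb]

lemma exists_gradClosure_of_tendsto {n : ℕ} (hn : 1 ≤ n) {Ω : Opens (E n)}
    (hb : Bornology.IsBounded (Ω : Set (E n))) {u : H Ω} {φ : ℕ → 𝓓(Ω, ℝ)}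
    (h : Tendsto (fun j => toH (φ j)) atTop (𝓝 u))
    (hd : ∀ i, ∃ g : H Ω, Tendsto (fun j => toH (pderiv i (φ j))) atTop (𝓝 g)) :
    ∃ k, embJ Ω k = u ∧ Tendsto (fun j => gradK (φ j)) atTop (𝓝 k) := by
  choose g hg using hd
  have h1 : Tendsto (fun j => grad (φ j)) atTop (𝓝 (WithLp.toLp 2 g)) :=
    ((PiLp.continuous_toLp 2 _).tendsto g).comp (tendsto_pi_nhds.2 hg)
  have hmem : WithLp.toLp 2 g ∈ gradClosure Ω :=
    mem_closure_of_tendsto h1 (Eventually.of_forall fun j => LinearMap.mem_range_self _ _)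
  have h2 : Tendsto (fun j => gradK (φ j)) atTop (𝓝 ⟨_, hmem⟩) := tendsto_subtype_rng.2 h1
  refine ⟨⟨_, hmem⟩, ?_, h2⟩
  refine tendsto_nhds_unique (((embJ Ω).continuous.tendsto _).comp h2) (h.congr fun j => ?_)
  rw [Function.comp_apply, embJ_gradK hn hb]

/-- By Poincaré's inequality a limit of gradients determines the limit of the functions, so an
element of H¹_0(Ω) can be recorded by its gradient alone. -/
lemma memSobolevZero_one_iff {n : ℕ} (hn : 1 ≤ n) {Ω : Opens (E n)}
    (hb : Bornology.IsBounded (Ω : Set (E n))) {u : H Ω} :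
    MemSobolevZero Ω 1 u ↔ ∃ k, embJ Ω k = u := by
  rw [memSobolevZero_iff]
  constructor
  · rintro ⟨φ, h, hd⟩
    obtain ⟨k, hk, -⟩ := exists_gradClosure_of_tendsto hn hb h fun i => hd 1 le_rfl fun _ => i
    exact ⟨k, hk⟩
  · rintro ⟨k, rfl⟩
    obtain ⟨φ, hφ, h⟩ := exists_seq_of_gradClosure hn hb k
    refine ⟨φ, h, fun m hm i => ?_⟩
    interval_cases m
    · exact ⟨_, h⟩
    · refine ⟨(k : VF Ω) (i 0), ?_⟩
      have h1 := tendsto_subtype_rng.1 hφ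
      exact ((PiLp.continuous_apply 2 _ (i 0)).tendsto _).comp h1

lemma inner_gradK {n : ℕ} (hn : 1 ≤ n) {Ω : Opens (E n)}
    (hb : Bornology.IsBounded (Ω : Set (E n))) (k : gradClosure Ω) (φ : 𝓓(Ω, ℝ)) :
    ⟪k, gradK φ⟫ = -⟪embJ Ω k, toH (lap φ)⟫ := by
  have := denseRange_gradK.induction_on (p := fun k => ⟪k, gradK φ⟫ = -⟪embJ Ω k, toH (lap φ)⟫) k
    (isClosed_eq (by fun_prop) (by fun_prop)) fun ψ => by
      rw [embJ_gradK hn hb, ← inner_grad_grad]; rfl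
  exact this

/-- The solution operator `A⁻¹` of the Dirichlet problem. -/
def solG {n : ℕ} (Ω : Opens (E n)) : H Ω →L[ℝ] H Ω := embJ Ω ∘L (embJ Ω).adjoint

/-- With u = Jk, the distributional equation reads (k, ∇φ) = (g, φ) for all test functions φ. Since
gradients are dense, this is k = J*g, that is, u = JJ*g. From here on A is handled through its
bounded inverse. -/
lemma isDirichletLaplacian_iff_eq_solG {n : ℕ} (hn : 1 ≤ n) {Ω : Opens (E n)}
    (hb : Bornology.IsBounded (Ω : Set (E n))) {u g : H Ω} :
    IsDirichletLaplacian Ω u g ↔ u = solG Ω g := by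
  rw [isDirichletLaplacian_iff, memSobolevZero_one_iff hn hb]
  constructor
  · rintro ⟨⟨k, rfl⟩, h⟩
    have hk : k = (embJ Ω).adjoint g := by
      refine denseRange_gradK.eq_of_inner_right ℝ fun φ => ?_
      rw [ContinuousLinearMap.adjoint_inner_right, embJ_gradK hn hb, real_inner_comm,
        inner_gradK hn hb, h, real_inner_comm]
    rw [hk]; rfl
  · rintro rfl
    refine ⟨⟨_, rfl⟩, fun φ => ?_⟩
    rw [solG, ContinuousLinearMap.comp_apply, ← inner_gradK hn hb,
      ContinuousLinearMap.adjoint_inner_left, embJ_gradK hn hb]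

lemma solG_inner {n : ℕ} {Ω : Opens (E n)} (g h : H Ω) : ⟪solG Ω g, h⟫ = ⟪g, solG Ω h⟫ := by
  have h1 := ContinuousLinearMap.adjoint_inner_right (embJ Ω) ((embJ Ω).adjoint g) h
  have h2 := ContinuousLinearMap.adjoint_inner_left (embJ Ω) ((embJ Ω).adjoint h) g
  exact h1.symm.trans h2

lemma inner_solG_self {n : ℕ} {Ω : Opens (E n)} (g : H Ω) :
    ⟪solG Ω g, g⟫ = ‖(embJ Ω).adjoint g‖ ^ 2 := by
  rw [← real_inner_self_eq_norm_sq]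
  exact (ContinuousLinearMap.adjoint_inner_right (embJ Ω) ((embJ Ω).adjoint g) g).symm

lemma solG_injective {n : ℕ} (hn : 1 ≤ n) {Ω : Opens (E n)}
    (hb : Bornology.IsBounded (Ω : Set (E n))) : Function.Injective (solG Ω) := by
  intro g g' h
  exact ((isDirichletLaplacian_iff_eq_solG hn hb).2 rfl).unique
    ((isDirichletLaplacian_iff_eq_solG hn hb).2 h)

lemma opA_solG {n : ℕ} (hn : 1 ≤ n) {Ω : Opens (E n)}
    (hb : Bornology.IsBounded (Ω : Set (E n))) (g : H Ω) : opA Ω (solG Ω g) = g :=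
  opA_eq ((isDirichletLaplacian_iff_eq_solG hn hb).2 rfl)

lemma mem_domA_iff {n : ℕ} (hn : 1 ≤ n) {Ω : Opens (E n)}
    (hb : Bornology.IsBounded (Ω : Set (E n))) {u : H Ω} : u ∈ domA Ω ↔ ∃ g, solG Ω g = u := by
  simp only [domA, Set.mem_ofPred_eq, isDirichletLaplacian_iff_eq_solG hn hb, eq_comm]

lemma solG_opA {n : ℕ} (hn : 1 ≤ n) {Ω : Opens (E n)}
    (hb : Bornology.IsBounded (Ω : Set (E n))) {u : H Ω} (hu : u ∈ domA Ω) :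
    solG Ω (opA Ω u) = u := by
  obtain ⟨g, rfl⟩ := (mem_domA_iff hn hb).1 hu
  rw [opA_solG hn hb]

/-! ### Compactness -/

/-- Step functions on the cells of the grid of mesh `δ` with indices in a finite set. -/
def stepMap {n : ℕ} (Ω : Opens (E n)) (hb : Bornology.IsBounded (Ω : Set (E n))) (δ : ℝ)
    (F : Finset (Fin n → ℤ)) : (F → ℝ) →ₗ[ℝ] H Ω :=
  Fintype.linearCombination ℝ fun k : F => indicatorConstLp (μ := volume.restrict (Ω : Set (E n))) 2
    (measurableSet_gridCell δ k.1) (by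
      rw [Measure.restrict_apply (measurableSet_gridCell δ k.1)]
      exact ((measure_mono inter_subset_right).trans_lt hb.measure_lt_top).ne) (1 : ℝ)

lemma coeFn_finset_sum_Lp {X : Type*} [MeasurableSpace X] {μ : Measure X} {ι : Type*}
    (s : Finset ι) (f : ι → Lp ℝ 2 μ) : ⇑(∑ i ∈ s, f i) =ᵐ[μ] fun x => ∑ i ∈ s, f i x := by
  classical
  induction s using Finset.induction_on with
  | empty => exact Lp.coeFn_zero ℝ 2 μ
  | insert a s ha ih =>
    rw [Finset.sum_insert ha]
    filter_upwards [ih, Lp.coeFn_add (f a) (∑ i ∈ s, f i)] with x h1 h2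
    rw [h2, Pi.add_apply, h1, Finset.sum_insert ha]

lemma coeFn_stepMap {n : ℕ} {Ω : Opens (E n)} (hb : Bornology.IsBounded (Ω : Set (E n))) (δ : ℝ)
    (F : Finset (Fin n → ℤ)) (c : (Fin n → ℤ) → ℝ) :
    ∀ᵐ x ∂(volume.restrict (Ω : Set (E n))), (fun i => ⌊x i / δ⌋) ∈ F →
      stepMap Ω hb δ F (fun k => c k) x = c fun i => ⌊x i / δ⌋ := by
  rw [stepMap, Fintype.linearCombination_apply]
  have h1 := fun k : F => Lp.coeFn_smul (c k) (indicatorConstLp (μ := volume.restrict (Ω : Set (E n)))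
    2 (measurableSet_gridCell δ k.1) (by
      rw [Measure.restrict_apply (measurableSet_gridCell δ k.1)]
      exact ((measure_mono inter_subset_right).trans_lt hb.measure_lt_top).ne) (1 : ℝ))
  have h2 := fun k : F => indicatorConstLp_coeFn (μ := volume.restrict (Ω : Set (E n)))
    (p := 2) (hs := measurableSet_gridCell δ k.1) (hμs := by
      rw [Measure.restrict_apply (measurableSet_gridCell δ k.1)]
      exact ((measure_mono inter_subset_right).trans_lt hb.measure_lt_top).ne) (c := (1 : ℝ))
  filter_upwards [coeFn_finset_sum_Lp _ _, ae_all_iff.2 h1, ae_all_iff.2 h2] with x hx h1 h2 hF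
  rw [hx]
  simp only [h1, Pi.smul_apply, h2, smul_eq_mul]
  rw [Finset.sum_eq_single ⟨_, hF⟩]
  · rw [indicator_of_mem (by intro i; rfl)]; simp
  · intro k _ hk
    rw [indicator_of_notMem, mul_zero]
    intro hx
    exact hk (Subtype.ext (funext fun i => (hx i).symm))
  · simp

lemma exists_finset_gridCell {n : ℕ} {s : Set (E n)} (hs : Bornology.IsBounded s) (δ : ℝ) :
    ∃ F : Finset (Fin n → ℤ), ∀ x ∈ s, (fun i => ⌊x i / δ⌋) ∈ F := by
  obtain ⟨R, hR⟩ := hs.subset_closedBall 0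
  refine ⟨Fintype.piFinset fun _ => Finset.Icc (⌊-(R / |δ|)⌋) (⌊R / |δ|⌋), fun x hx => ?_⟩
  rw [Fintype.mem_piFinset]
  intro i
  have h1 : |x i| ≤ R := (PiLp.norm_apply_le x i).trans (by simpa using hR hx)
  have h2 : |x i / δ| ≤ R / |δ| := by rw [abs_div]; gcongr
  rw [abs_le] at h2
  rw [Finset.mem_Icc]
  exact ⟨Int.floor_mono h2.1, Int.floor_mono h2.2⟩

/-- Only finitely many cells of a grid meet a bounded set, so the step functions on them form a
finite-dimensional space, and the average of φ over each cell gives the approximation. -/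
lemma exists_finiteDimensional_approx {n : ℕ} {Ω : Opens (E n)}
    (hb : Bornology.IsBounded (Ω : Set (E n))) {ε : ℝ} (hε : 0 < ε) :
    ∃ S : Submodule ℝ (H Ω), FiniteDimensional ℝ S ∧
      ∀ φ : 𝓓(Ω, ℝ), ∃ s ∈ S, ‖toH φ - s‖ ≤ ε * ‖grad φ‖ := by
  obtain ⟨δ, hδ, hδε⟩ : ∃ δ : ℝ, 0 < δ ∧ 2 ^ n * (n * δ ^ 2) ≤ ε ^ 2 := by
    -- The mesh is read off from the constant 2^n · n · δ² of the averaging estimate; n + 1 in place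
    -- of n keeps the denominator positive when n = 0.
    refine ⟨ε / √(2 ^ n * (n + 1)), by positivity, ?_⟩
    rw [div_pow, Real.sq_sqrt (by positivity)]
    have : (0 : ℝ) < 2 ^ n * (n + 1) := by positivity
    rw [← mul_assoc, mul_div_assoc', div_le_iff₀ this]
    nlinarith [sq_nonneg ε, pow_pos (two_pos (α := ℝ)) n, mul_nonneg (sq_nonneg ε) (pow_pos (two_pos (α := ℝ)) n).le]
  obtain ⟨F, hF⟩ := exists_finset_gridCell hb δ
  refine ⟨LinearMap.range (stepMap Ω hb δ F), inferInstance, fun φ => ?_⟩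
  set a : (Fin n → ℤ) → ℝ := fun k => ⨍ y in gridCell δ k, φ y
  refine ⟨_, LinearMap.mem_range_self _ fun k : F => a k, ?_⟩
  have h1 : ‖toH φ - stepMap Ω hb δ F fun k => a k‖ₑ ^ 2 ≤
      ∫⁻ x, ‖φ x - a fun i => ⌊x i / δ⌋‖ₑ ^ 2 := by
    rw [← eLpNorm_sub_eq_enorm, eLpNorm_eq_lintegral_rpow_enorm_toReal (by norm_num) (by norm_num)]
    simp only [ENNReal.toReal_ofNat, ENNReal.rpow_ofNat]
    rw [← ENNReal.rpow_natCast, ← ENNReal.rpow_mul]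
    norm_num
    refine le_trans (le_of_eq (lintegral_congr_ae ?_)) (setLIntegral_le_lintegral (Ω : Set (E n)) _)
    filter_upwards [coeFn_stepMap hb δ F a, ae_restrict_mem Ω.isOpen.measurableSet] with x hx hxΩ
    rw [hx (hF x hxΩ)]
  have hcast : (2 : ℝ≥0∞) ^ n = ENNReal.ofReal (2 ^ n) := by
    rw [ENNReal.ofReal_pow (by norm_num), ENNReal.ofReal_ofNat]
  have h2 := h1.trans (lintegral_sub_average_sq_le hδ (contDiff_one_testFunction φ)
    φ.hasCompactSupport)
  rw [← enorm_grad_sq, ← ofReal_norm, ← ofReal_norm, ← ENNReal.ofReal_pow (norm_nonneg _),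
    ← ENNReal.ofReal_pow (norm_nonneg _), ← ENNReal.ofReal_pow hδ.le,
    ← ENNReal.ofReal_natCast n, ← ENNReal.ofReal_mul (by simp),
    hcast, ← ENNReal.ofReal_mul (by positivity), ← ENNReal.ofReal_mul (by positivity), ENNReal.ofReal_le_ofReal_iff (by positivity)] at h2
  refine le_of_sq_le_sq ?_ (by positivity)
  rw [mul_pow]
  exact h2.trans (by gcongr)

/-- An operator which is approximated by finite-dimensional subspaces, uniformly on the unit ball,
is compact. -/
lemma isCompactOperator_of_approx {X Y ι : Type*} [NormedAddCommGroup X] [NormedSpace ℝ X]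
    [NormedAddCommGroup Y] [InnerProductSpace ℝ Y] [CompleteSpace Y] (J : X →L[ℝ] Y)
    {e : ι → X} (he : DenseRange e)
    (h : ∀ ε > 0, ∃ S : Submodule ℝ Y, FiniteDimensional ℝ S ∧
      ∀ i, ∃ s ∈ S, ‖J (e i) - s‖ ≤ ε * ‖e i‖) : IsCompactOperator J := by
  have key : ∀ ε > 0, ∃ F : X →L[ℝ] Y, IsCompactOperator F ∧ ‖F - J‖ ≤ ε := by
    intro ε hε
    obtain ⟨S, hS, happ⟩ := h ε hε
    -- The orthogonal projection onto S is at least as good as the given approximant, and unlike it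
    -- depends linearly on the argument, so the bound extends from the dense range by continuity.
    refine ⟨S.starProjection ∘L J, ?_, ?_⟩
    · have h1 : IsCompactOperator (ContinuousLinearMap.id ℝ S) :=
        isCompactOperator_id_iff_finiteDimensional.2 hS
      exact (h1.comp_clm (S.orthogonalProjectionOnto ∘L J)).clm_comp S.subtypeL
    · rw [norm_sub_rev]
      refine ContinuousLinearMap.opNorm_le_bound _ hε.le fun k => ?_
      refine he.induction_on (p := fun k => ‖(J - S.starProjection ∘L J) k‖ ≤
        ε * ‖k‖) k (isClosed_le (by fun_prop) (by fun_prop)) fun φ => ?_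
      obtain ⟨s, hs, hle⟩ := happ φ
      simp only [sub_apply, ContinuousLinearMap.comp_apply]
      refine le_trans ?_ hle
      rw [Submodule.starProjection_minimal]
      exact ciInf_le ⟨0, by rintro _ ⟨x, rfl⟩; positivity⟩ (⟨s, hs⟩ : S)
  choose F hF hle using fun m : ℕ => key _ (Nat.one_div_pos_of_nat (α := ℝ) (n := m))
  have hlim : Tendsto F atTop (𝓝 J) := by
    rw [tendsto_iff_norm_sub_tendsto_zero]
    exact squeeze_zero (fun _ => norm_nonneg _) hle tendsto_one_div_add_atTop_nhds_zero_nat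
  exact isCompactOperator_of_tendsto hlim (Eventually.of_forall hF)

/-- Rellich's theorem for `H¹_0(Ω)`. -/
lemma isCompactOperator_embJ {n : ℕ} (hn : 1 ≤ n) {Ω : Opens (E n)}
    (hb : Bornology.IsBounded (Ω : Set (E n))) : IsCompactOperator (embJ Ω) := by
  refine isCompactOperator_of_approx _ denseRange_gradK fun ε hε => ?_
  obtain ⟨S, hS, happ⟩ := exists_finiteDimensional_approx hb hε
  refine ⟨S, hS, fun φ => ?_⟩
  obtain ⟨s, hs, hle⟩ := happ φ
  exact ⟨s, hs, by rw [embJ_gradK hn hb]; exact hle⟩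

lemma isCompactOperator_solG {n : ℕ} (hn : 1 ≤ n) {Ω : Opens (E n)}
    (hb : Bornology.IsBounded (Ω : Set (E n))) : IsCompactOperator (solG Ω) :=
  (isCompactOperator_embJ hn hb).comp_clm _

/-! ### Spectral decomposition -/

/-- Parseval's identity: the space is the Hilbert sum of the subspaces, and the coordinates of a
vector in that sum are its orthogonal projections. -/
lemma hasSum_inner_starProjection {X ι : Type*} [NormedAddCommGroup X] [InnerProductSpace ℝ X]
    [CompleteSpace X] {F : ι → Submodule ℝ X} [∀ i, CompleteSpace (F i)]
    (hF : OrthogonalFamily ℝ (fun i => F i) fun i => (F i).subtypeₗᵢ) (htot : (⨆ i, F i)ᗮ = ⊥)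
    (x y : X) :
    HasSum (fun i => ⟪(F i).starProjection x, (F i).starProjection y⟫) ⟪x, y⟫ := by
  classical
  have hV : IsHilbertSum ℝ (fun i => F i) fun i => (F i).subtypeₗᵢ :=
    IsHilbertSum.mkInternal F hF (by
      rw [(Submodule.topologicalClosure_eq_top_iff).2 htot])
  have hproj : ∀ z i, (F i).starProjection z = (hV.linearIsometryEquiv z i : X) := by
    intro z i
    have h1 := hV.hasSum_linearIsometryEquiv_symm (hV.linearIsometryEquiv z)
    rw [LinearIsometryEquiv.symm_apply_apply] at h1
    have h2 := (F i).starProjection.hasSum h1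
    refine h2.unique ?_
    convert! hasSum_ite_eq i (hV.linearIsometryEquiv z i : X) using 2 with j
    split_ifs with hij
    · subst hij
      exact Submodule.starProjection_eq_self_iff.2 (hV.linearIsometryEquiv z j).2
    · rw [Submodule.starProjection_apply_eq_zero_iff]
      rw [Submodule.mem_orthogonal]
      intro w hw
      exact hF (Ne.symm hij) ⟨w, hw⟩ (hV.linearIsometryEquiv z j)
  have h := lp.hasSum_inner (𝕜 := ℝ) (hV.linearIsometryEquiv x) (hV.linearIsometryEquiv y)
  rw [LinearIsometryEquiv.inner_map_map] at h
  simp only [hproj]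
  exact h

section
variable {n : ℕ} {Ω : Opens (E n)}

lemma solG_isSymmetric : ((solG Ω : H Ω →L[ℝ] H Ω) : H Ω →ₗ[ℝ] H Ω).IsSymmetric :=
  fun g h => solG_inner g h

lemma eigenspaceA_eq (hn : 1 ≤ n) (hb : Bornology.IsBounded (Ω : Set (E n))) (μ : ℝ) :
    eigenspaceA Ω μ = Module.End.eigenspace (solG Ω : H Ω →ₗ[ℝ] H Ω) μ⁻¹ := by
  have h1 : {w | IsDirichletLaplacian Ω w (μ • w)} =
      (Module.End.eigenspace (solG Ω : H Ω →ₗ[ℝ] H Ω) μ⁻¹ : Set (H Ω)) := by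
    ext w
    simp only [Set.mem_ofPred_eq, SetLike.mem_coe, Module.End.mem_eigenspace_iff,
      isDirichletLaplacian_iff_eq_solG hn hb, map_smul, ContinuousLinearMap.coe_coe]
    by_cases hμ : μ = 0
    -- For μ = 0 the convention 0⁻¹ = 0 does no harm: A⁻¹ is injective, so both eigenspaces are
    -- trivial.
    · subst hμ
      simp only [zero_smul, inv_zero]
      exact ⟨fun h => by rw [h, map_zero], fun h => solG_injective hn hb (by rw [h, map_zero])⟩
    · rw [eq_comm, ← eq_inv_smul_iff₀ hμ]
  rw [eigenspaceA, h1, Submodule.span_eq]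
  refine IsClosed.submodule_topologicalClosure_eq ?_
  have : (Module.End.eigenspace (solG Ω : H Ω →ₗ[ℝ] H Ω) μ⁻¹ : Set (H Ω)) =
      {w | solG Ω w = μ⁻¹ • w} := by ext; simp
  rw [this]
  exact isClosed_eq (by fun_prop) (by fun_prop)

lemma mem_eigenspaceA_iff (hn : 1 ≤ n) (hb : Bornology.IsBounded (Ω : Set (E n))) {μ : ℝ}
    {w : H Ω} : w ∈ eigenspaceA Ω μ ↔ solG Ω w = μ⁻¹ • w := by
  rw [eigenspaceA_eq hn hb]; exact Module.End.mem_eigenspace_iff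

lemma orthogonalFamily_eigenspaceA (hn : 1 ≤ n) (hb : Bornology.IsBounded (Ω : Set (E n))) :
    OrthogonalFamily ℝ (fun μ => eigenspaceA Ω μ) fun μ => (eigenspaceA Ω μ).subtypeₗᵢ := by
  intro μ ν hμν v w
  have h := (solG_isSymmetric (Ω := Ω)).orthogonalFamily_eigenspaces
    (inv_injective.ne hμν) ⟨v, eigenspaceA_eq hn hb μ ▸ v.2⟩ ⟨w, eigenspaceA_eq hn hb ν ▸ w.2⟩
  exact h

/-- The spectral theorem for the compact symmetric operator A⁻¹, reindexed by μ ↦ μ⁻¹, which is a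
surjection of ℝ. -/
lemma iSup_eigenspaceA_orthogonal (hn : 1 ≤ n) (hb : Bornology.IsBounded (Ω : Set (E n))) :
    (⨆ μ, eigenspaceA Ω μ)ᗮ = ⊥ := by
  have h := ContinuousLinearMap.orthogonalComplement_iSup_eigenspaces_eq_bot
    (isCompactOperator_solG hn hb) solG_isSymmetric
  rw [← h]
  congr 1
  simp only [eigenspaceA_eq hn hb]
  exact inv_surjective.iSup_comp (g := fun μ => Module.End.eigenspace (solG Ω : H Ω →ₗ[ℝ] H Ω) μ)

/-- The orthogonal projection onto the eigenspace of `μ`. -/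
abbrev projA (Ω : Opens (E n)) (μ : ℝ) : H Ω →L[ℝ] H Ω := (eigenspaceA Ω μ).starProjection

lemma hasSum_inner_projA (hn : 1 ≤ n) (hb : Bornology.IsBounded (Ω : Set (E n))) (x y : H Ω) :
    HasSum (fun μ => ⟪projA Ω μ x, projA Ω μ y⟫) ⟪x, y⟫ :=
  hasSum_inner_starProjection (orthogonalFamily_eigenspaceA hn hb)
    (iSup_eigenspaceA_orthogonal hn hb) x y

lemma hasSum_norm_sq_projA (hn : 1 ≤ n) (hb : Bornology.IsBounded (Ω : Set (E n))) (x : H Ω) :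
    HasSum (fun μ => ‖projA Ω μ x‖ ^ 2) (‖x‖ ^ 2) := by
  simpa only [real_inner_self_eq_norm_sq] using hasSum_inner_projA hn hb x x

/-- A⁻¹ is positive and injective, so A has no eigenvalue μ ≤ 0. The conventional values of `μ ^ (2
* s)` for such μ therefore never enter the series of `fracNormSq`. -/
lemma projA_eq_zero (hn : 1 ≤ n) (hb : Bornology.IsBounded (Ω : Set (E n))) {μ : ℝ} (hμ : μ ≤ 0)
    (x : H Ω) : projA Ω μ x = 0 := by
  set w := projA Ω μ x
  have hw : solG Ω w = μ⁻¹ • w :=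
    (mem_eigenspaceA_iff hn hb).1 (Submodule.starProjection_apply_mem _ _)
  have h1 : ⟪solG Ω w, w⟫ = μ⁻¹ * ‖w‖ ^ 2 := by
    rw [hw, real_inner_smul_left, real_inner_self_eq_norm_sq]
  have h2 : 0 ≤ ⟪solG Ω w, w⟫ := by rw [inner_solG_self]; positivity
  have h3 : μ⁻¹ ≤ 0 := inv_nonpos.2 hμ
  have h4 : μ⁻¹ * ‖w‖ ^ 2 = 0 := le_antisymm (mul_nonpos_of_nonpos_of_nonneg h3 (by positivity))
    (h1 ▸ h2)
  rcases mul_eq_zero.1 h4 with h | h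
  · refine solG_injective hn hb ?_
    rw [hw, h, zero_smul, map_zero]
  · simpa using h

lemma projA_opA (hn : 1 ≤ n) (hb : Bornology.IsBounded (Ω : Set (E n))) (μ : ℝ) {u : H Ω}
    (hu : u ∈ domA Ω) : projA Ω μ (opA Ω u) = μ • projA Ω μ u := by
  rcases le_or_gt μ 0 with hμ | hμ
  · rw [projA_eq_zero hn hb hμ, projA_eq_zero hn hb hμ, smul_zero]
  obtain ⟨g, rfl⟩ := (mem_domA_iff hn hb).1 hu
  rw [opA_solG hn hb]
  refine Submodule.eq_starProjection_of_mem_of_inner_eq_zero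
    (Submodule.smul_mem _ _ (Submodule.starProjection_apply_mem _ _)) fun w hw => ?_
  have hw' : solG Ω w = μ⁻¹ • w := (mem_eigenspaceA_iff hn hb).1 hw
  have h1 : ⟪projA Ω μ (solG Ω g), w⟫ = μ⁻¹ * ⟪g, w⟫ := by
    rw [Submodule.inner_starProjection_left_eq_right, Submodule.starProjection_eq_self_iff.2 hw,
      solG_inner, hw', real_inner_smul_right]
  rw [inner_sub_left, real_inner_smul_left, h1]
  field_simp
  ring

/-- The terms of the series defining `‖A^s u‖²`. -/
lemma fracNormSq_term_le (hn : 1 ≤ n) (hb : Bornology.IsBounded (Ω : Set (E n))) {s : ℝ}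
    (hs : s ∈ Icc (0 : ℝ) 1) {u : H Ω} (hu : u ∈ domA Ω) (μ : ℝ) :
    μ ^ (2 * s) * ‖projA Ω μ u‖ ^ 2 ≤ ‖projA Ω μ u‖ ^ 2 + ‖projA Ω μ (opA Ω u)‖ ^ 2 := by
  rcases le_or_gt μ 0 with hμ | hμ
  · rw [projA_eq_zero hn hb hμ, projA_eq_zero hn hb hμ]; simp
  rw [projA_opA hn hb μ hu, norm_smul, mul_pow, Real.norm_eq_abs, sq_abs]
  -- Since 0 ≤ 2s ≤ 2, the power lies below 1 or below μ², according to whether μ ≤ 1.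
  have h : μ ^ (2 * s) ≤ 1 + μ ^ 2 := by
    rcases le_or_gt μ 1 with h1 | h1
    · have := Real.rpow_le_one hμ.le h1 (by linarith [hs.1] : 0 ≤ 2 * s)
      nlinarith
    · have := Real.rpow_le_rpow_of_exponent_le h1.le (by linarith [hs.2] : 2 * s ≤ 2)
      rw [Real.rpow_two] at this
      linarith
  nlinarith [sq_nonneg ‖projA Ω μ u‖]

lemma fracNormSq_term_nonneg (hn : 1 ≤ n) (hb : Bornology.IsBounded (Ω : Set (E n))) (s : ℝ)
    (u : H Ω) (μ : ℝ) : 0 ≤ μ ^ (2 * s) * ‖projA Ω μ u‖ ^ 2 := by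
  rcases le_or_gt μ 0 with hμ | hμ
  · rw [projA_eq_zero hn hb hμ]; simp
  · positivity

lemma fracNormSq_nonneg (hn : 1 ≤ n) (hb : Bornology.IsBounded (Ω : Set (E n))) (s : ℝ)
    (u : H Ω) : 0 ≤ fracNormSq Ω s u := tsum_nonneg (fracNormSq_term_nonneg hn hb s u)

lemma summable_fracNormSq (hn : 1 ≤ n) (hb : Bornology.IsBounded (Ω : Set (E n))) {s : ℝ}
    (hs : s ∈ Icc (0 : ℝ) 1) {u : H Ω} (hu : u ∈ domA Ω) :
    Summable fun μ : ℝ => μ ^ (2 * s) * ‖projA Ω μ u‖ ^ 2 :=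
  Summable.of_nonneg_of_le (fracNormSq_term_nonneg hn hb s u) (fracNormSq_term_le hn hb hs hu)
    ((hasSum_norm_sq_projA hn hb u).add (hasSum_norm_sq_projA hn hb (opA Ω u))).summable

lemma fracNormSq_le (hn : 1 ≤ n) (hb : Bornology.IsBounded (Ω : Set (E n))) {s : ℝ}
    (hs : s ∈ Icc (0 : ℝ) 1) {u : H Ω} (hu : u ∈ domA Ω) :
    fracNormSq Ω s u ≤ ‖u‖ ^ 2 + ‖opA Ω u‖ ^ 2 :=
  hasSum_le (fracNormSq_term_le hn hb hs hu) (summable_fracNormSq hn hb hs hu).hasSum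
    ((hasSum_norm_sq_projA hn hb u).add (hasSum_norm_sq_projA hn hb (opA Ω u)))

lemma fracNormSq_half (hn : 1 ≤ n) (hb : Bornology.IsBounded (Ω : Set (E n))) {u : H Ω}
    (hu : u ∈ domA Ω) : fracNormSq Ω (1 / 2) u = ⟪opA Ω u, u⟫ := by
  refine HasSum.tsum_eq ?_
  convert! hasSum_inner_projA hn hb (opA Ω u) u using 2 with μ
  rw [projA_opA hn hb μ hu, real_inner_smul_left, real_inner_self_eq_norm_sq]
  norm_num

lemma opA_sub (hn : 1 ≤ n) (hb : Bornology.IsBounded (Ω : Set (E n))) {u w : H Ω}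
    (hu : u ∈ domA Ω) (hw : w ∈ domA Ω) : u - w ∈ domA Ω ∧ opA Ω (u - w) = opA Ω u - opA Ω w := by
  obtain ⟨g, rfl⟩ := (mem_domA_iff hn hb).1 hu
  obtain ⟨h, rfl⟩ := (mem_domA_iff hn hb).1 hw
  rw [← map_sub, opA_solG hn hb, opA_solG hn hb, opA_solG hn hb]
  exact ⟨(mem_domA_iff hn hb).2 ⟨_, rfl⟩, rfl⟩

/-- Minkowski's inequality in ℓ² for the sequences μ^s ‖P_μ ·‖, with the term of u - w bounded by
the graph norm of A. It yields the continuity in time of the damping coefficient. -/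
lemma sqrt_fracNormSq_le_add (hn : 1 ≤ n) (hb : Bornology.IsBounded (Ω : Set (E n))) {s : ℝ}
    (hs : s ∈ Icc (0 : ℝ) 1) {u w : H Ω} (hu : u ∈ domA Ω) (hw : w ∈ domA Ω) :
    √(fracNormSq Ω s u) ≤ √(fracNormSq Ω s w) + √(‖u - w‖ ^ 2 + ‖opA Ω u - opA Ω w‖ ^ 2) := by
  obtain ⟨hd, hd'⟩ := opA_sub hn hb hu hw
  have hterm : ∀ (z : H Ω) (μ : ℝ), (√(μ ^ (2 * s)) * ‖projA Ω μ z‖) ^ (2 : ℝ) =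
      μ ^ (2 * s) * ‖projA Ω μ z‖ ^ 2 := by
    intro z μ
    rcases le_or_gt μ 0 with hμ | hμ
    · rw [projA_eq_zero hn hb hμ]; simp
    · rw [Real.rpow_two, mul_pow, Real.sq_sqrt (by positivity)]
  have hM := (Real.Lp_add_le_tsum_of_nonneg (p := 2) one_le_two
    (f := fun μ : ℝ => √(μ ^ (2 * s)) * ‖projA Ω μ (u - w)‖)
    (g := fun μ : ℝ => √(μ ^ (2 * s)) * ‖projA Ω μ w‖) (fun μ => by positivity)
    (fun μ => by positivity) (by simpa only [hterm] using summable_fracNormSq hn hb hs hd)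
    (by simpa only [hterm] using summable_fracNormSq hn hb hs hw))
  simp only [hterm, ← Real.sqrt_eq_rpow] at hM
  have h1 : fracNormSq Ω s u ≤ ∑' μ : ℝ, (√(μ ^ (2 * s)) * ‖projA Ω μ (u - w)‖ +
      √(μ ^ (2 * s)) * ‖projA Ω μ w‖) ^ (2 : ℝ) := by
    refine Summable.tsum_le_tsum (fun μ => ?_) (summable_fracNormSq hn hb hs hu) hM.1
    rw [← hterm u μ, ← mul_add]
    refine Real.rpow_le_rpow (by positivity) ?_ zero_le_two
    gcongr
    rw [map_sub]
    exact norm_le_norm_sub_add _ _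
  have h2 := fracNormSq_le hn hb hs hd
  rw [hd'] at h2
  calc _ ≤ _ := Real.sqrt_le_sqrt h1
    _ ≤ _ := hM.2
    _ ≤ _ := by rw [add_comm]; exact add_le_add le_rfl (Real.sqrt_le_sqrt h2)

lemma continuousOn_fracNormSq (hn : 1 ≤ n) (hb : Bornology.IsBounded (Ω : Set (E n))) {s : ℝ}
    (hs : s ∈ Icc (0 : ℝ) 1) {S : Set ℝ} {u : ℝ → H Ω} (hu : ∀ t ∈ S, u t ∈ domA Ω)
    (hc : ContinuousOn u S) (hcA : ContinuousOn (fun t => opA Ω (u t)) S) :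
    ContinuousOn (fun t => fracNormSq Ω s (u t)) S := by
  suffices h : ContinuousOn (fun t => √(fracNormSq Ω s (u t))) S by
    refine (h.pow 2).congr fun t _ => ?_
    exact (Real.sq_sqrt (fracNormSq_nonneg hn hb s _)).symm
  intro t ht
  rw [ContinuousWithinAt, tendsto_iff_dist_tendsto_zero]
  have hlim : Tendsto (fun r => √(‖u r - u t‖ ^ 2 + ‖opA Ω (u r) - opA Ω (u t)‖ ^ 2)) (𝓝[S] t)
      (𝓝 0) := by
    have h1 : ContinuousWithinAt (fun r => √(‖u r - u t‖ ^ 2 + ‖opA Ω (u r) - opA Ω (u t)‖ ^ 2)) S t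
        := by
      have a := hc t ht
      have b := hcA t ht
      fun_prop
    simpa [ContinuousWithinAt] using h1
  refine squeeze_zero' (Eventually.of_forall fun _ => dist_nonneg) ?_ hlim
  filter_upwards [self_mem_nhdsWithin] with r hr
  have h1 := sqrt_fracNormSq_le_add hn hb hs (hu r hr) (hu t ht)
  have h2 := sqrt_fracNormSq_le_add hn hb hs (hu t ht) (hu r hr)
  rw [norm_sub_rev (u t), norm_sub_rev (opA Ω (u t))] at h2
  rw [Real.dist_eq, abs_le]
  constructor <;> linarith

end

/-! ### The energy space and the first eigenvalue of the biharmonic operator -/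

section
variable {n : ℕ} {Ω : Opens (E n)}

lemma pderiv_comm (i k : Fin n) (φ : 𝓓(Ω, ℝ)) :
    pderiv i (pderiv k φ) = pderiv k (pderiv i φ) := by
  have hsecond : ∀ (i k : Fin n) (x : E n), pderiv i (pderiv k φ) x =
      fderiv ℝ (fderiv ℝ (φ : E n → ℝ)) x (EuclideanSpace.single i 1)
        (EuclideanSpace.single k 1) := by
    intro i k x
    have hd : DifferentiableAt ℝ (fderiv ℝ (φ : E n → ℝ)) x :=
      ((contDiff_infty.1 φ.contDiff 2).fderiv_right (m := 1) (by norm_num)).differentiable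
        (by norm_num) |>.differentiableAt
    have h1 : (pderiv k φ : E n → ℝ) = fun y => fderiv ℝ φ y (EuclideanSpace.single k 1) :=
      funext fun y => pderiv_apply k φ y
    rw [pderiv_apply, h1, fderiv_clm_apply hd (by fun_prop)]
    simp
  ext x
  rw [hsecond, hsecond]
  have hs : IsSymmSndFDerivAt ℝ (φ : E n → ℝ) x :=
    ((contDiff_infty.1 φ.contDiff 2).contDiffAt).isSymmSndFDerivAt (by simp)
  exact hs _ _

/-- Two integrations by parts turn (∂ᵢ²φ, ∂ₖ²φ) into ‖∂ᵢ∂ₖφ‖², so ‖Δφ‖² is the sum of the squared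
norms of all second derivatives. -/
lemma norm_toH_pderiv_pderiv_le (i k : Fin n) (φ : 𝓓(Ω, ℝ)) :
    ‖toH (pderiv i (pderiv k φ))‖ ≤ ‖toH (lap φ)‖ := by
  have h1 : ∀ i k, ⟪toH (pderiv i (pderiv i φ)), toH (pderiv k (pderiv k φ))⟫ =
      ‖toH (pderiv i (pderiv k φ))‖ ^ 2 := by
    intro i k
    rw [inner_toH_pderiv, pderiv_comm k i (pderiv i φ), ← inner_toH_pderiv, pderiv_comm k i φ,
      real_inner_self_eq_norm_sq]
  have h2 : ‖toH (lap φ)‖ ^ 2 = ∑ i, ∑ k, ‖toH (pderiv i (pderiv k φ))‖ ^ 2 := by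
    rw [← real_inner_self_eq_norm_sq]
    simp only [lap, LinearMap.sum_apply, LinearMap.comp_apply, map_sum, sum_inner, inner_sum, h1]
    exact Finset.sum_comm
  refine le_of_sq_le_sq ?_ (norm_nonneg _)
  rw [h2]
  have hsum : ∀ a : Fin n → Fin n → ℝ, (∀ i k, 0 ≤ a i k) → a i k ≤ ∑ i, ∑ k, a i k := fun a ha =>
    (Finset.single_le_sum (fun k _ => ha i k) (Finset.mem_univ k)).trans
      (Finset.single_le_sum (f := fun i => ∑ k, a i k)
        (fun i _ => Finset.sum_nonneg fun k _ => ha i k) (Finset.mem_univ i))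
  exact hsum (fun i k => ‖toH (pderiv i (pderiv k φ))‖ ^ 2) fun i k => sq_nonneg _

lemma norm_grad_sq_le (φ : 𝓓(Ω, ℝ)) : ‖grad φ‖ ^ 2 ≤ ‖toH φ‖ * ‖toH (lap φ)‖ := by
  rw [← real_inner_self_eq_norm_sq, inner_grad_grad, ← inner_neg_left]
  refine (real_inner_le_norm _ _).trans ?_
  rw [norm_neg]

lemma toH_eq_solG (hn : 1 ≤ n) (hb : Bornology.IsBounded (Ω : Set (E n))) (φ : 𝓓(Ω, ℝ)) :
    toH φ = solG Ω (-toH (lap φ)) := by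
  rw [← isDirichletLaplacian_iff_eq_solG hn hb, isDirichletLaplacian_iff,
    memSobolevZero_one_iff hn hb]
  refine ⟨⟨_, embJ_gradK hn hb φ⟩, fun ψ => ?_⟩
  rw [← inner_grad_grad, real_inner_comm, inner_grad_grad, real_inner_comm, inner_neg_left]

/-- The image of `H²_0(Ω)` under the Laplacian. -/
abbrev lapRange (Ω : Opens (E n)) : Submodule ℝ (H Ω) :=
  (LinearMap.range (toH ∘ₗ lap (Ω := Ω))).topologicalClosure

/-- On test functions the first and second derivatives are controlled by φ and Δφ, so convergence of
the Laplacians already forces convergence in H². Hence H²_0(Ω) is the image under A⁻¹ of a closed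
subspace, just as D(A) is, and the two boundary conditions can be treated together. -/
lemma memSobolevZero_two_iff (hn : 1 ≤ n) (hb : Bornology.IsBounded (Ω : Set (E n))) {u : H Ω} :
    MemSobolevZero Ω 2 u ↔ ∃ g ∈ lapRange Ω, solG Ω g = u := by
  rw [memSobolevZero_iff]
  constructor
  · rintro ⟨φ, h, hd⟩
    choose g hg using fun i : Fin n => hd 2 le_rfl fun _ => i
    have hlim : Tendsto (fun j => toH (lap (φ j))) atTop (𝓝 (∑ i, g i)) := by
      simp only [lap, LinearMap.sum_apply, LinearMap.comp_apply, map_sum]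
      exact tendsto_finsetSum _ fun i _ => hg i
    refine ⟨-∑ i, g i, neg_mem (mem_closure_of_tendsto hlim
      (Eventually.of_forall fun j => ⟨φ j, rfl⟩)), ?_⟩
    have h1 := ((solG Ω).continuous.tendsto _).comp hlim.neg
    refine tendsto_nhds_unique h1 (h.congr fun j => toH_eq_solG hn hb _)
  · rintro ⟨g, hg, rfl⟩
    obtain ⟨x, hx, hlim⟩ := mem_closure_iff_seq_limit.1 (neg_mem hg : -g ∈ lapRange Ω)
    choose φ hφ using hx
    have hlap : Tendsto (fun j => toH (lap (φ j))) atTop (𝓝 (-g)) := hlim.congr fun j => (hφ j).symm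
    have h0 : Tendsto (fun j => toH (φ j)) atTop (𝓝 (solG Ω g)) := by
      have h1 := ((solG Ω).continuous.tendsto _).comp hlap.neg
      rw [neg_neg] at h1
      exact h1.congr fun j => (toH_eq_solG hn hb _).symm
    have hc0 := h0.cauchySeq
    have hcl := hlap.cauchySeq
    have hcauchy : ∀ {T : 𝓓(Ω, ℝ) →ₗ[ℝ] 𝓓(Ω, ℝ)},
        (∀ φ, ‖toH (T φ)‖ ^ 2 ≤ (‖toH φ‖ + ‖toH (lap φ)‖) ^ 2) →
        ∃ g, Tendsto (fun j => toH (T (φ j))) atTop (𝓝 g) := by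
      intro T hT
      refine cauchySeq_tendsto_of_complete ?_
      rw [Metric.cauchySeq_iff'] at hc0 hcl ⊢
      intro ε hε
      obtain ⟨N0, hN0⟩ := (Metric.cauchySeq_iff.1 h0.cauchySeq) (ε / 2) (half_pos hε)
      obtain ⟨N1, hN1⟩ := (Metric.cauchySeq_iff.1 hlap.cauchySeq) (ε / 2) (half_pos hε)
      refine ⟨max N0 N1, fun m hm => ?_⟩
      have a := hN0 m (le_of_max_le_left hm) _ (le_max_left N0 N1)
      have b := hN1 m (le_of_max_le_right hm) _ (le_max_right N0 N1)
      rw [dist_eq_norm, ← map_sub] at a ⊢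
      rw [dist_eq_norm, ← map_sub, ← map_sub] at b
      rw [← map_sub]
      have := le_of_sq_le_sq (hT (φ m - φ (max N0 N1))) (by positivity)
      linarith
    refine ⟨φ, h0, fun m hm i => ?_⟩
    interval_cases m
    · exact ⟨_, h0⟩
    · refine hcauchy (T := pderiv (i 0)) fun ψ => ?_
      have h1 := norm_grad_sq_le ψ
      have h2 : ‖toH (pderiv (i 0) ψ)‖ ≤ ‖grad ψ‖ := PiLp.norm_apply_le (grad ψ) (i 0)
      nlinarith [norm_nonneg (toH (pderiv (i 0) ψ)), norm_nonneg (toH ψ), norm_nonneg (toH (lap ψ)),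
        mul_nonneg (norm_nonneg (toH ψ)) (norm_nonneg (toH (lap ψ)))]
    · refine hcauchy (T := pderiv (i 0) ∘ₗ pderiv (i 1)) fun ψ => ?_
      have h2 := norm_toH_pderiv_pderiv_le (i 0) (i 1) ψ
      exact pow_le_pow_left₀ (norm_nonneg _) (h2.trans (by simp)) 2

/-- The energy space is the image of a closed subspace under the solution operator. -/
lemma exists_energySpace_eq (hn : 1 ≤ n) (hb : Bornology.IsBounded (Ω : Set (E n)))
    (bc : BoundaryCondition) : ∃ R : Submodule ℝ (H Ω), IsClosed (R : Set (H Ω)) ∧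
      ∀ u, u ∈ energySpace bc Ω ↔ ∃ g ∈ R, solG Ω g = u := by
  cases bc with
  | clamped => exact ⟨lapRange Ω, Submodule.isClosed_topologicalClosure _,
      fun u => memSobolevZero_two_iff hn hb⟩
  | hinged => exact ⟨⊤, isClosed_univ, fun u => by simp [energySpace, mem_domA_iff hn hb]⟩

lemma energySpace_subset_domA (hn : 1 ≤ n) (hb : Bornology.IsBounded (Ω : Set (E n)))
    {bc : BoundaryCondition} {u : H Ω} (hu : u ∈ energySpace bc Ω) : u ∈ domA Ω := by
  obtain ⟨R, -, hR⟩ := exists_energySpace_eq hn hb bc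
  obtain ⟨g, -, rfl⟩ := (hR u).1 hu
  exact (mem_domA_iff hn hb).2 ⟨g, rfl⟩

lemma energySpace_smul_sub (hn : 1 ≤ n) (hb : Bornology.IsBounded (Ω : Set (E n)))
    {bc : BoundaryCondition} (c : ℝ) {u w : H Ω} (hu : u ∈ energySpace bc Ω)
    (hw : w ∈ energySpace bc Ω) : c • (u - w) ∈ energySpace bc Ω ∧
      opA Ω (c • (u - w)) = c • (opA Ω u - opA Ω w) := by
  obtain ⟨R, -, hR⟩ := exists_energySpace_eq hn hb bc
  obtain ⟨g, hg, rfl⟩ := (hR u).1 hu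
  obtain ⟨h, hh, rfl⟩ := (hR w).1 hw
  rw [← map_sub, ← map_smul, opA_solG hn hb, opA_solG hn hb, opA_solG hn hb]
  exact ⟨(hR _).2 ⟨_, R.smul_mem c (R.sub_mem hg hh), rfl⟩, rfl⟩

end

/-- For a positive symmetric operator ‖T‖ is the supremum of the Rayleigh quotient. By compactness
‖T‖ is an eigenvalue or a point of the resolvent set, and in the second case the quotient would stay
below ‖T‖ - ε. -/
lemma exists_eigenvector_norm {X : Type*} [NormedAddCommGroup X] [InnerProductSpace ℝ X]
    [CompleteSpace X] {T : X →L[ℝ] X} (hT : IsCompactOperator T)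
    (hs : (T : X →ₗ[ℝ] X).IsSymmetric) (hpos : ∀ x, 0 ≤ ⟪T x, x⟫) (h0 : T ≠ 0) :
    ∃ w, w ≠ 0 ∧ T w = ‖T‖ • w := by
  have hnt : Nontrivial X := by
    by_contra h
    rw [not_nontrivial_iff_subsingleton] at h
    exact h0 (ContinuousLinearMap.ext fun x => Subsingleton.elim _ _)
  have hn0 : ‖T‖ ≠ 0 := norm_ne_zero_iff.2 h0
  rcases hT.hasEigenvalue_or_mem_resolventSet hn0 with h | h
  · obtain ⟨w, hw, hw0⟩ := h.exists_hasEigenvector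
    exact ⟨w, hw0, Module.End.mem_eigenspace_iff.1 hw⟩
  · exfalso
    obtain ⟨ε, hε, hle⟩ := ContinuousLinearMap.rayleighQuotient_le_of_norm_mem_resolventSet
      (𝕜 := ℝ) (T := T) h
    have h1 := ContinuousLinearMap.norm_eq_iSup_rayleighQuotient (T := T) hs
    have h2 : (⨆ x, |T.rayleighQuotient x|) ≤ ‖T‖ - ε := by
      refine ciSup_le fun x => ?_
      rw [abs_of_nonneg]
      · exact hle x
      · exact div_nonneg (hpos x) (by positivity)
    linarith

section
variable {n : ℕ} {Ω : Opens (E n)}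

set_option maxHeartbeats 800000 in
/-- The variational inequality for the first eigenvalue. -/
lemma sigmaOne_mul_norm_sq_le (hn : 1 ≤ n) (hb : Bornology.IsBounded (Ω : Set (E n)))
    {bc : BoundaryCondition} {u : H Ω} (hu : u ∈ energySpace bc Ω) :
    sigmaOne bc Ω * ‖u‖ ^ 2 ≤ ‖opA Ω u‖ ^ 2 := by
  obtain ⟨R, hRc, hR⟩ := exists_energySpace_eq hn hb bc
  have : CompleteSpace R := hRc.completeSpace_coe
  set Q : H Ω →L[ℝ] H Ω := R.starProjection with hQ
  have hQs : ∀ x y, ⟪Q x, y⟫ = ⟪x, Q y⟫ := fun x y => Submodule.inner_starProjection_left_eq_right ..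
  have hQQ : ∀ x, Q (Q x) = Q x := fun x =>
    Submodule.starProjection_eq_self_iff.2 (Submodule.starProjection_apply_mem _ _)
  -- With G = A⁻¹ and Q the projection onto R = A(D(A₁^{1/2})), T = GQG is the inverse of A₁: an
  -- eigenvector of T for τ ≠ 0 is one of A₁ for 1/τ. The inequality thus amounts to ‖u‖² ≤ ‖T‖
  -- ‖Au‖² together with σ₁ ≤ 1/‖T‖.
  set T : H Ω →L[ℝ] H Ω := solG Ω ∘L Q ∘L solG Ω with hT
  have hTapp : ∀ x, T x = solG Ω (Q (solG Ω x)) := fun x => rfl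
  have hTc : IsCompactOperator T := (isCompactOperator_solG hn hb).comp_clm (Q ∘L solG Ω)
  have hTs : (T : H Ω →ₗ[ℝ] H Ω).IsSymmetric := by
    intro x y
    change ⟪T x, y⟫ = ⟪x, T y⟫
    rw [hTapp, hTapp, solG_inner, hQs, solG_inner]
  have hTin : ∀ x, ⟪T x, x⟫ = ‖Q (solG Ω x)‖ ^ 2 := by
    intro x
    rw [hTapp, solG_inner, ← real_inner_self_eq_norm_sq, ← hQs, hQQ]
  have hmain : ‖u‖ ^ 2 ≤ ‖T‖ * ‖opA Ω u‖ ^ 2 := by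
    obtain ⟨g, hg, rfl⟩ := (hR u).1 hu
    rw [opA_solG hn hb]
    -- Here u = Gg with g = Qg, so ‖u‖² = (g, QGu), while ‖QGu‖² = (Tu, u) ≤ ‖T‖ ‖u‖².
    have h1 : ‖solG Ω g‖ ^ 2 ≤ ‖g‖ * ‖Q (solG Ω (solG Ω g))‖ := by
      rw [← real_inner_self_eq_norm_sq, solG_inner,
        ← Submodule.starProjection_eq_self_iff.2 hg, hQs,
        Submodule.starProjection_eq_self_iff.2 hg]
      exact real_inner_le_norm _ _
    have h2 : ‖Q (solG Ω (solG Ω g))‖ ^ 2 ≤ ‖T‖ * ‖solG Ω g‖ ^ 2 := by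
      rw [← hTin]
      refine (real_inner_le_norm _ _).trans ?_
      rw [sq, ← mul_assoc]
      gcongr
      exact T.le_opNorm _
    by_cases h0 : ‖solG Ω g‖ = 0
    · rw [h0, zero_pow two_ne_zero]; positivity
    have h3 : 0 < ‖solG Ω g‖ ^ 2 := by positivity
    have h4 : (‖solG Ω g‖ ^ 2) ^ 2 ≤ ‖g‖ ^ 2 * (‖T‖ * ‖solG Ω g‖ ^ 2) := by
      calc _ ≤ (‖g‖ * ‖Q (solG Ω (solG Ω g))‖) ^ 2 := by gcongr
        _ ≤ _ := by rw [mul_pow]; gcongr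
    nlinarith
  -- If T = 0, the energy space is trivial and the value of σ₁ does not matter.
  by_cases hT0 : T = 0
  · have : ‖u‖ ^ 2 = 0 := by
      rw [hT0, norm_zero, zero_mul] at hmain
      exact le_antisymm hmain (by positivity)
    rw [this, mul_zero]; positivity
  have hTp : 0 < ‖T‖ := norm_pos_iff.2 hT0
  obtain ⟨w, hw0, hw⟩ := exists_eigenvector_norm hTc hTs (fun x => by rw [hTin]; positivity) hT0
  have hwA : w = solG Ω (‖T‖⁻¹ • Q (solG Ω w)) := by
    rw [map_smul, ← hTapp, hw, inv_smul_smul₀ hTp.ne']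
  have hbih : IsBiharmonic bc Ω w (‖T‖⁻¹ • w) := by
    refine ⟨(hR w).2 ⟨_, R.smul_mem _ (Submodule.starProjection_apply_mem _ _), hwA.symm⟩, ?_⟩
    intro z hz
    have hz' := (hR z).1 hz
    obtain ⟨g, hg, hgz⟩ := hz'
    have h1 : opA Ω w = ‖T‖⁻¹ • Q (solG Ω w) := by
      conv_lhs => rw [hwA]
      rw [opA_solG hn hb]
    rw [← hgz, h1, opA_solG hn hb, real_inner_smul_left, real_inner_smul_left, hQs, hQ,
      Submodule.starProjection_eq_self_iff.2 hg, solG_inner]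
  have hσ : sigmaOne bc Ω ≤ ‖T‖⁻¹ := by
    -- The infimum bounds its members from below only for a set bounded below, so nonnegativity of
    -- all eigenvalues of A₁ is needed as well.
    refine csInf_le ⟨0, ?_⟩ ⟨w, hw0, hbih⟩
    rintro σ ⟨z, hz0, hz, hzz⟩
    have h1 := hzz z hz
    rw [real_inner_smul_left, real_inner_self_eq_norm_sq, real_inner_self_eq_norm_sq] at h1
    have h2 : 0 < ‖z‖ ^ 2 := by positivity
    by_contra hneg
    push Not at hneg
    nlinarith [sq_nonneg ‖opA Ω z‖]
  calc sigmaOne bc Ω * ‖u‖ ^ 2 ≤ ‖T‖⁻¹ * ‖u‖ ^ 2 := by gcongr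
    _ ≤ ‖T‖⁻¹ * (‖T‖ * ‖opA Ω u‖ ^ 2) := by gcongr
    _ = _ := by rw [inv_mul_cancel_left₀ hTp.ne']

end

/-! ### Truncated powers -/

/-- A bounded smooth approximation of `1 + t²`. -/
def truncSq (ε t : ℝ) : ℝ := (1 + t ^ 2) / (1 + ε * t ^ 2)

/-- A smooth approximation, with bounded derivative, of `t (1 + t²)^b`. -/
def truncPow (ε b t : ℝ) : ℝ := t * truncSq ε t ^ b

lemma truncSq_pos {ε : ℝ} (hε : 0 ≤ ε) (t : ℝ) : 0 < truncSq ε t := by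
  unfold truncSq; positivity

lemma truncSq_le {ε : ℝ} (hε : 0 ≤ ε) (t : ℝ) : truncSq ε t ≤ 1 + t ^ 2 := by
  unfold truncSq
  exact div_le_self (by positivity) (by nlinarith [sq_nonneg t, mul_nonneg hε (sq_nonneg t)])

lemma truncSq_le_inv {ε : ℝ} (hε : 0 < ε) (hε1 : ε ≤ 1) (t : ℝ) : truncSq ε t ≤ ε⁻¹ := by
  unfold truncSq
  rw [div_le_iff₀ (by positivity), mul_add, inv_mul_cancel_left₀ hε.ne', mul_one]
  have := one_le_inv_iff₀.2 ⟨hε, hε1⟩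
  linarith

lemma contDiff_truncPow {ε : ℝ} (hε : 0 ≤ ε) (b : ℝ) : ContDiff ℝ ∞ (truncPow ε b) := by
  have h : ContDiff ℝ ∞ (truncSq ε) := by
    unfold truncSq
    exact ContDiff.div (by fun_prop) (by fun_prop) fun t => by positivity
  exact contDiff_id.mul (h.rpow_const_of_ne fun t => (truncSq_pos hε t).ne')

/-- The logarithmic derivative of `truncSq`, multiplied by `t`. -/
def truncLog (ε t : ℝ) : ℝ := 2 * t ^ 2 * (1 - ε) / ((1 + ε * t ^ 2) * (1 + t ^ 2))

lemma truncLog_nonneg {ε : ℝ} (hε : 0 ≤ ε) (hε1 : ε ≤ 1) (t : ℝ) : 0 ≤ truncLog ε t := by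
  unfold truncLog
  have : 0 ≤ 1 - ε := by linarith
  positivity

lemma truncLog_le {ε : ℝ} (hε : 0 ≤ ε) (t : ℝ) : truncLog ε t ≤ 2 := by
  unfold truncLog
  rw [div_le_iff₀ (by positivity)]
  nlinarith [sq_nonneg t, mul_nonneg hε (sq_nonneg t), mul_nonneg hε (mul_nonneg (sq_nonneg t) (sq_nonneg t))]

lemma deriv_truncPow {ε : ℝ} (hε : 0 ≤ ε) (b t : ℝ) :
    deriv (truncPow ε b) t = truncSq ε t ^ b * (1 + b * truncLog ε t) := by
  have hd : (1 + ε * t ^ 2) ≠ 0 := by positivity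
  have hm : HasDerivAt (truncSq ε) ((2 * t * (1 + ε * t ^ 2) - (1 + t ^ 2) * (ε * (2 * t))) /
      (1 + ε * t ^ 2) ^ 2) t := by
    have h1 : HasDerivAt (fun t : ℝ => 1 + t ^ 2) (2 * t) t := by
      simpa using (hasDerivAt_pow 2 t).const_add 1
    have h2 : HasDerivAt (fun t : ℝ => 1 + ε * t ^ 2) (ε * (2 * t)) t := by
      simpa using ((hasDerivAt_pow 2 t).const_mul ε).const_add 1
    exact h1.div h2 hd
  have h := (hasDerivAt_id t).mul (hm.rpow_const (p := b) (Or.inl (truncSq_pos hε t).ne'))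
  have h' := h.deriv
  change deriv (truncPow ε b) t = _ at h'
  rw [h', Real.rpow_sub_one (truncSq_pos hε t).ne']
  simp only [id, one_mul]
  have hpos := (truncSq_pos hε t).ne'
  have : truncSq ε t = (1 + t ^ 2) / (1 + ε * t ^ 2) := rfl
  generalize truncSq ε t ^ b = z
  rw [this, truncLog]
  have h1 : (1 + t ^ 2) ≠ 0 := by positivity
  field_simp
  ring

/-- Both sides carry the factor `truncSq ε t ^ b`, and the logarithmic term lies in [0, 2]. This is
the comparison behind Moser's argument: testing with the power b controls the gradient of the power
b/2, uniformly in ε. -/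
lemma sq_deriv_truncPow_le {ε : ℝ} (hε : 0 ≤ ε) (hε1 : ε ≤ 1) {b : ℝ} (hb : 0 ≤ b) (t : ℝ) :
    deriv (truncPow ε (b / 2)) t ^ 2 ≤ (1 + b) ^ 2 * deriv (truncPow ε b) t := by
  rw [deriv_truncPow hε, deriv_truncPow hε, mul_pow, ← Real.rpow_natCast, ← Real.rpow_mul
    (truncSq_pos hε t).le]
  have h0 := truncLog_nonneg hε hε1 t
  have h2 := truncLog_le hε t
  have hz : 0 ≤ truncSq ε t ^ b := (Real.rpow_pos_of_pos (truncSq_pos hε t) b).le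
  have e : b / 2 * ((2 : ℕ) : ℝ) = b := by push_cast; ring
  rw [e]
  have h3 : (1 + b / 2 * truncLog ε t) ^ 2 ≤ (1 + b) ^ 2 := by
    apply pow_le_pow_left₀ <;> nlinarith
  have h4 : 0 ≤ b * truncLog ε t := by positivity
  have h5 : (1 + b) ^ 2 ≤ (1 + b) ^ 2 * (1 + b * truncLog ε t) := by nlinarith [sq_nonneg (1 + b)]
  nlinarith

lemma abs_deriv_truncPow_le {ε : ℝ} (hε : 0 < ε) (hε1 : ε ≤ 1) {b : ℝ} (hb : 0 ≤ b) (t : ℝ) :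
    |deriv (truncPow ε b) t| ≤ ε⁻¹ ^ b * (1 + 2 * b) := by
  rw [deriv_truncPow hε.le]
  have h0 := truncLog_nonneg hε.le hε1 t
  have h2 := truncLog_le hε.le t
  have hz := (Real.rpow_pos_of_pos (truncSq_pos hε.le t) b).le
  have h1 : truncSq ε t ^ b ≤ ε⁻¹ ^ b :=
    Real.rpow_le_rpow (truncSq_pos hε.le t).le (truncSq_le_inv hε hε1 t) hb
  rw [abs_of_nonneg (by positivity)]
  have h5 : b * truncLog ε t ≤ 2 * b := by nlinarith
  gcongr

/-- With m = `truncSq ε t`, the left side is t² m^p. For t² > 1 one has m ≤ 2t², so the factor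
m^{p/(p+2)} can be traded for the power of t that is missing; for t² ≤ 1 everything is at most 2^p.
The constant does not involve ε. -/
lemma sq_truncPow_le {ε : ℝ} (hε : 0 ≤ ε) {p : ℝ} (hp : 0 ≤ p) (t : ℝ) :
    truncPow ε (p / 2) t ^ 2 ≤
      (2 ^ p + 2) * (1 + |truncPow ε (p / 2 / 2) t| ^ (4 * (p + 1) / (p + 2))) := by
  have hm := truncSq_pos hε t
  have hle := truncSq_le hε t
  set m := truncSq ε t with hmdef
  have hF : truncPow ε (p / 2) t ^ 2 = t ^ 2 * m ^ p := by
    rw [truncPow, mul_pow, ← Real.rpow_natCast (truncSq ε t ^ (p / 2)), ← Real.rpow_mul hm.le]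
    push_cast; congr 2; ring
  have hG : |truncPow ε (p / 2 / 2) t| ^ (4 * (p + 1) / (p + 2)) =
      (t ^ 2) ^ (2 * (p + 1) / (p + 2)) * m ^ (p * (p + 1) / (p + 2)) := by
    rw [truncPow, abs_mul, Real.mul_rpow (abs_nonneg _) (abs_nonneg _),
      abs_of_nonneg (Real.rpow_nonneg hm.le _), ← Real.rpow_mul hm.le, ← sq_abs t,
      ← Real.rpow_natCast |t|, ← Real.rpow_mul (abs_nonneg t)]
    congr 2
    · push_cast; ring
    · field_simp; ring
  have hGn : 0 ≤ |truncPow ε (p / 2 / 2) t| ^ (4 * (p + 1) / (p + 2)) := by positivity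
  have h2p : (0 : ℝ) < 2 ^ p := by positivity
  rw [hF]
  by_cases ht : t ^ 2 ≤ 1
  · have h1 : m ^ p ≤ 2 ^ p := Real.rpow_le_rpow hm.le (by linarith) hp
    have h3 : t ^ 2 * m ^ p ≤ 1 * 2 ^ p := by gcongr
    nlinarith
  · push Not at ht
    have hm2 : m ≤ 2 * t ^ 2 := by linarith
    have ht0 : 0 < t ^ 2 := by linarith
    have e1 : m ^ p = m ^ (p * (p + 1) / (p + 2)) * m ^ (p / (p + 2)) := by
      rw [← Real.rpow_add hm]; congr 1; field_simp; ring
    have e2 : (t ^ 2) ^ (2 * (p + 1) / (p + 2)) = t ^ 2 * (t ^ 2) ^ (p / (p + 2)) := by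
      nth_rewrite 2 [← Real.rpow_one (t ^ 2)]
      rw [← Real.rpow_add ht0]; congr 1; field_simp; ring
    have e3 : m ^ (p / (p + 2)) ≤ 2 * (t ^ 2) ^ (p / (p + 2)) := by
      calc m ^ (p / (p + 2)) ≤ (2 * t ^ 2) ^ (p / (p + 2)) :=
            Real.rpow_le_rpow hm.le hm2 (by positivity)
        _ = 2 ^ (p / (p + 2)) * (t ^ 2) ^ (p / (p + 2)) := Real.mul_rpow (by norm_num) ht0.le
        _ ≤ 2 ^ (1 : ℝ) * (t ^ 2) ^ (p / (p + 2)) := by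
            gcongr
            · norm_num
            · rw [div_le_one (by positivity)]; linarith
        _ = _ := by rw [Real.rpow_one]
    have e4 : t ^ 2 * m ^ p ≤ 2 * |truncPow ε (p / 2 / 2) t| ^ (4 * (p + 1) / (p + 2)) := by
      rw [hG, e1, e2]
      have : 0 ≤ m ^ (p * (p + 1) / (p + 2)) := by positivity
      calc t ^ 2 * (m ^ (p * (p + 1) / (p + 2)) * m ^ (p / (p + 2))) ≤
          t ^ 2 * (m ^ (p * (p + 1) / (p + 2)) * (2 * (t ^ 2) ^ (p / (p + 2)))) := by gcongr
        _ = _ := by ring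
    nlinarith [mul_nonneg h2p.le hGn]

lemma abs_rpow_le_truncPow_zero {p : ℝ} (hp : 0 ≤ p) (t : ℝ) :
    |t| ^ ((p + 2) / 2) ≤ |truncPow 0 (p / 2 / 2) t| := by
  have e : truncSq 0 t = 1 + t ^ 2 := by simp [truncSq]
  rw [truncPow, e, abs_mul, abs_of_nonneg (Real.rpow_nonneg (by positivity) _)]
  rcases eq_or_ne t 0 with rfl | ht
  · rw [abs_zero, Real.zero_rpow (by positivity)]; simp
  have h0 : 0 < |t| := abs_pos.2 ht
  have h1 : |t| ^ ((p + 2) / 2) = |t| * (t ^ 2) ^ (p / 2 / 2) := by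
    rw [← sq_abs t, ← Real.rpow_natCast |t|, ← Real.rpow_mul h0.le]
    nth_rewrite 2 [← Real.rpow_one |t|]
    rw [← Real.rpow_add h0]; congr 1; push_cast; ring
  rw [h1]
  gcongr
  linarith

lemma tendsto_truncPow {b : ℝ} {e x : ℕ → ℝ} {t : ℝ} (he : Tendsto e atTop (𝓝 0))
    (hx : Tendsto x atTop (𝓝 t)) :
    Tendsto (fun k => truncPow (e k) b (x k)) atTop (𝓝 (truncPow 0 b t)) := by
  unfold truncPow truncSq
  refine hx.mul (Tendsto.rpow_const (Tendsto.div ((hx.pow 2).const_add 1)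
    ((he.mul (hx.pow 2)).const_add 1) (by simp)) (Or.inl ?_))
  simp only [zero_mul, add_zero, div_one]
  positivity

/-- The right side grows like Y^{χ/2} with χ/2 < 1. This closes the Moser estimate, in which the
quantity to be bounded reappears on the right. -/
lemma exists_bound_of_sublinear {χ : ℝ} (hχ0 : 0 ≤ χ) (hχ : χ < 2) {a b c d : ℝ} (ha : 0 ≤ a)
    (hb : 0 ≤ b) (hc : 0 ≤ c) (hd : 0 ≤ d) :
    ∃ Y₀ : ℝ, 0 ≤ Y₀ ∧ ∀ Y, 0 ≤ Y → Y ≤ a * √(b + c * Y ^ χ) + d → Y ≤ Y₀ := by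
  set K := a * √(b + c) + d with hK
  have hK0 : 0 ≤ K := by positivity
  refine ⟨max 1 (K ^ (1 - χ / 2)⁻¹), by positivity, fun Y hY h => ?_⟩
  rcases le_or_gt Y 1 with h1 | h1
  · exact h1.trans (le_max_left _ _)
  refine le_trans ?_ (le_max_right _ _)
  have hpos : 0 < 1 - χ / 2 := by linarith
  have hYp : 0 < Y ^ (χ / 2) := by positivity
  have h1χ : 1 ≤ Y ^ χ := Real.one_le_rpow h1.le hχ0
  have h1χ' : 1 ≤ Y ^ (χ / 2) := Real.one_le_rpow h1.le (by positivity)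
  have h2 : √(b + c * Y ^ χ) ≤ √(b + c) * Y ^ (χ / 2) := by
    rw [Real.sqrt_le_left (by positivity), mul_pow, Real.sq_sqrt (by positivity),
      ← Real.rpow_natCast, ← Real.rpow_mul hY]
    have e : χ / 2 * ((2 : ℕ) : ℝ) = χ := by push_cast; ring
    rw [e, add_mul]
    nlinarith
  have h3 : Y ≤ K * Y ^ (χ / 2) := by
    have : a * √(b + c * Y ^ χ) ≤ a * (√(b + c) * Y ^ (χ / 2)) := by gcongr
    nlinarith
  have h4 : Y ^ (1 - χ / 2) ≤ K := by
    rw [Real.rpow_sub (by linarith), Real.rpow_one, div_le_iff₀ hYp]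
    exact h3
  calc Y = (Y ^ (1 - χ / 2)) ^ (1 - χ / 2)⁻¹ := by
        rw [← Real.rpow_mul hY, mul_inv_cancel₀ hpos.ne', Real.rpow_one]
    _ ≤ _ := Real.rpow_le_rpow (by positivity) h4 (by positivity)

/-! ### The embedding of the domain of the Laplacian into `L^{2(p+1)}` -/

section
variable {n : ℕ} {Ω : Opens (E n)}

/-- The composition of a test function with a smooth function vanishing at the origin. -/
def compTest (F : ℝ → ℝ) (hF : ContDiff ℝ ∞ F) (hF0 : F 0 = 0) (φ : 𝓓(Ω, ℝ)) : 𝓓(Ω, ℝ) :=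
  ⟨F ∘ φ, hF.comp φ.contDiff, φ.hasCompactSupport.comp_left hF0,
    (tsupport_comp_subset hF0 φ).trans φ.tsupport_subset⟩

lemma pderiv_compTest (F : ℝ → ℝ) (hF : ContDiff ℝ ∞ F) (hF0 : F 0 = 0) (φ : 𝓓(Ω, ℝ)) (i : Fin n)
    (x : E n) : pderiv i (compTest F hF hF0 φ) x = deriv F (φ x) * pderiv i φ x := by
  have h1 : HasFDerivAt (F ∘ φ) (deriv F (φ x) • fderiv ℝ φ x) x :=
    ((hF.differentiable (by simp)).differentiableAt.hasDerivAt (x := φ x)).comp_hasFDerivAt x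
      (φ.contDiff.differentiable (by simp)).differentiableAt.hasFDerivAt
  rw [pderiv_apply, pderiv_apply]
  change fderiv ℝ (F ∘ φ) x _ = _
  rw [h1.fderiv]; simp

lemma inner_grad_eq_integral (φ ψ : 𝓓(Ω, ℝ)) :
    ⟪grad φ, grad ψ⟫ = ∑ i, ∫ x, pderiv i φ x * pderiv i ψ x := by
  rw [PiLp.inner_apply]
  simp only [grad_apply, inner_toH_toH]

/-- By the chain rule the two sides are integrals of G'(φ)² |∇φ|² and B F'(φ) |∇φ|². -/
lemma norm_grad_compTest_sq_le {F G : ℝ → ℝ} (hF : ContDiff ℝ ∞ F) (hF0 : F 0 = 0)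
    (hG : ContDiff ℝ ∞ G) (hG0 : G 0 = 0) {B : ℝ}
    (h : ∀ t, deriv G t ^ 2 ≤ B * deriv F t) (φ : 𝓓(Ω, ℝ)) :
    ‖grad (compTest G hG hG0 φ)‖ ^ 2 ≤ B * ⟪grad φ, grad (compTest F hF hF0 φ)⟫ := by
  rw [← real_inner_self_eq_norm_sq, inner_grad_eq_integral, inner_grad_eq_integral, Finset.mul_sum]
  refine Finset.sum_le_sum fun i _ => ?_
  rw [← integral_const_mul]
  refine integral_mono (integrable_testFunction_mul _ _)
    ((integrable_testFunction_mul _ _).const_mul _) fun x => ?_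
  simp only [pderiv_compTest]
  nlinarith [mul_le_mul_of_nonneg_right (h (φ x)) (sq_nonneg (pderiv i φ x))]

lemma norm_grad_compTest_le {F : ℝ → ℝ} (hF : ContDiff ℝ ∞ F) (hF0 : F 0 = 0) {L : ℝ}
    (hL : ∀ t, |deriv F t| ≤ L) (φ : 𝓓(Ω, ℝ)) :
    ‖grad (compTest F hF hF0 φ)‖ ≤ L * ‖grad φ‖ := by
  have hL0 : 0 ≤ L := (abs_nonneg _).trans (hL 0)
  refine le_of_sq_le_sq ?_ (by positivity)
  rw [mul_pow, ← real_inner_self_eq_norm_sq, ← real_inner_self_eq_norm_sq, inner_grad_eq_integral,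
    inner_grad_eq_integral, Finset.mul_sum]
  refine Finset.sum_le_sum fun i _ => ?_
  rw [← integral_const_mul]
  refine integral_mono (integrable_testFunction_mul _ _)
    ((integrable_testFunction_mul _ _).const_mul _) fun x => ?_
  simp only [pderiv_compTest]
  have h1 : deriv F (φ x) ^ 2 ≤ L ^ 2 := sq_le_sq' (abs_le.1 (hL _)).1 (abs_le.1 (hL _)).2
  nlinarith [mul_le_mul_of_nonneg_right h1 (sq_nonneg (pderiv i φ x))]

lemma exists_eLpNorm_le_norm_grad (hn : 1 ≤ n) (hb : Bornology.IsBounded (Ω : Set (E n)))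
    {p : ℝ} (hp : 0 ≤ p) (hpn : 5 ≤ n → p ≤ 4 / ((n : ℝ) - 4)) :
    ∃ C : ℝ≥0, ∀ φ : 𝓓(Ω, ℝ),
      eLpNorm φ (ENNReal.ofReal (4 * (p + 1) / (p + 2))) (volume.restrict (Ω : Set (E n))) ≤
        C * ‖grad φ‖ₑ := by
  obtain ⟨C, hC⟩ := exists_sobolev_const hn hb hp hpn
  refine ⟨C, fun φ => ?_⟩
  have h := hC φ (contDiff_one_testFunction φ) (support_testFunction_subset φ)
  have h2 : eLpNorm (fderiv ℝ φ) 2 volume = ‖grad φ‖ₑ := by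
    rw [eLpNorm_eq_lintegral_rpow_enorm_toReal (by norm_num) (by norm_num)]
    simp only [ENNReal.toReal_ofNat, ENNReal.rpow_ofNat, ← enorm_grad_sq]
    rw [← ENNReal.rpow_natCast, ← ENNReal.rpow_mul]
    norm_num
  rw [h2] at h
  exact (eLpNorm_mono_measure _ Measure.restrict_le_self).trans h

end

/-! ### Moser-type estimate for the Dirichlet problem -/

section
variable {n : ℕ} {Ω : Opens (E n)}

lemma isFiniteMeasure_restrict (hb : Bornology.IsBounded (Ω : Set (E n))) :
    IsFiniteMeasure (volume.restrict (Ω : Set (E n))) :=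
  ⟨by rw [Measure.restrict_apply_univ]; exact hb.measure_lt_top⟩

lemma memLp_testFunction (φ : 𝓓(Ω, ℝ)) (r : ℝ≥0∞) :
    MemLp φ r (volume.restrict (Ω : Set (E n))) :=
  (φ.continuous.memLp_of_hasCompactSupport φ.hasCompactSupport).restrict _

lemma toReal_eLpNorm_rpow (φ : 𝓓(Ω, ℝ)) {r : ℝ} (hr : 0 < r) :
    (eLpNorm φ (ENNReal.ofReal r) (volume.restrict (Ω : Set (E n)))).toReal ^ r =
      ∫ x in (Ω : Set (E n)), |φ x| ^ r := by
  rw [(memLp_testFunction φ _).eLpNorm_eq_integral_rpow_norm (by simpa using hr) (by simp),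
    ENNReal.toReal_ofReal hr.le, ENNReal.toReal_ofReal (by positivity), ← Real.rpow_mul (by positivity),
    inv_mul_cancel₀ hr.ne', Real.rpow_one]
  rfl

lemma norm_toH_sq (φ : 𝓓(Ω, ℝ)) : ‖toH φ‖ ^ 2 = ∫ x in (Ω : Set (E n)), φ x ^ 2 := by
  rw [← real_inner_self_eq_norm_sq, inner_eq_integral]
  refine integral_congr_ae ?_
  filter_upwards [coeFn_toH φ] with x hx
  rw [hx, sq]

lemma norm_toH_truncPow_sq_le (hb : Bornology.IsBounded (Ω : Set (E n))) {p : ℝ} (hp : 0 ≤ p)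
    {φ F G : 𝓓(Ω, ℝ)} {ε : ℝ} (hε : 0 ≤ ε) (hF : ∀ x, F x = truncPow ε (p / 2) (φ x))
    (hG : ∀ x, G x = truncPow ε (p / 2 / 2) (φ x)) :
    ‖toH F‖ ^ 2 ≤ (2 ^ p + 2) * ((volume (Ω : Set (E n))).toReal +
      (eLpNorm G (ENNReal.ofReal (4 * (p + 1) / (p + 2)))
        (volume.restrict (Ω : Set (E n)))).toReal ^ (4 * (p + 1) / (p + 2))) := by
  have := isFiniteMeasure_restrict hb
  have hr : 0 < 4 * (p + 1) / (p + 2) := by positivity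
  have hint : Integrable (fun x => |G x| ^ (4 * (p + 1) / (p + 2)))
      (volume.restrict (Ω : Set (E n))) := by
    have := (memLp_testFunction G (ENNReal.ofReal (4 * (p + 1) / (p + 2)))).integrable_norm_rpow
      (by simpa using hr) (by simp)
    simpa [ENNReal.toReal_ofReal hr.le] using this
  rw [norm_toH_sq, toReal_eLpNorm_rpow G hr]
  calc _ ≤ ∫ x in (Ω : Set (E n)), (2 ^ p + 2) * (1 + |G x| ^ (4 * (p + 1) / (p + 2))) := by
        refine integral_mono ?_ (((integrable_const 1).add hint).const_mul _) fun x => ?_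
        · have := (integrable_testFunction_mul F F).restrict (s := (Ω : Set (E n)))
          simpa only [sq] using this
        · simp only [hF, hG]
          exact sq_truncPow_le hε hp _
    _ = _ := by
        rw [integral_const_mul, integral_add (integrable_const 1) hint]
        simp [measureReal_def]

/-- An exact solution a = J*g would give (a, f) = (g, Jf) ≤ ‖Jf‖. The summand 1 pays for a being
only an approximate solution, tested with an f whose norm may be L times that of a. -/
lemma inner_le_of_norm_sub_mul_le {K X : Type*} [NormedAddCommGroup K] [InnerProductSpace ℝ K]
    [CompleteSpace K] [NormedAddCommGroup X] [InnerProductSpace ℝ X] [CompleteSpace X]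
    (J : K →L[ℝ] X) {g : X} (hg : ‖g‖ ≤ 1) {a f : K} {L : ℝ} (hf : ‖f‖ ≤ L * ‖a‖)
    (ha : ‖a - J.adjoint g‖ * (L * ‖a‖) ≤ 1) : ⟪a, f⟫ ≤ ‖J f‖ + 1 := by
  have e1 : ⟪a, f⟫ = ⟪J.adjoint g, f⟫ + ⟪a - J.adjoint g, f⟫ := by
    rw [← inner_add_left, add_sub_cancel]
  rw [e1, ContinuousLinearMap.adjoint_inner_left]
  have e3 := real_inner_le_norm g (J f)
  have e4 := real_inner_le_norm (a - J.adjoint g) f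
  have e5 : ‖a - J.adjoint g‖ * ‖f‖ ≤ 1 :=
    le_trans (mul_le_mul_of_nonneg_left hf (norm_nonneg _)) ha
  have e6 : ‖g‖ * ‖J f‖ ≤ 1 * ‖J f‖ := mul_le_mul_of_nonneg_right hg (norm_nonneg _)
  linarith

lemma eventually_norm_sub_mul_le {K : Type*} [NormedAddCommGroup K] {x : ℕ → K} {k : K}
    (hx : Tendsto x atTop (𝓝 k)) (L : ℝ) : ∀ᶠ j in atTop, ‖x j - k‖ * (L * ‖x j‖) ≤ 1 := by
  have h1 := (hx.sub_const k).norm.mul (hx.norm.const_mul L)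
  rw [sub_self, norm_zero, zero_mul] at h1
  exact h1.eventually_le_const one_pos

set_option maxHeartbeats 1000000 in
lemma inner_grad_le_of_almost_solution (hn : 1 ≤ n) (hb : Bornology.IsBounded (Ω : Set (E n)))
    {g : H Ω} (hg : ‖g‖ ≤ 1) {φ F : 𝓓(Ω, ℝ)} {L : ℝ} (hFL : ‖grad F‖ ≤ L * ‖grad φ‖)
    (hφ : ‖gradK φ - (embJ Ω).adjoint g‖ * (L * ‖gradK φ‖) ≤ 1) :
    ⟪grad φ, grad F⟫ ≤ ‖toH F‖ + 1 := by
  have h := inner_le_of_norm_sub_mul_le (embJ Ω) hg (a := gradK φ) (f := gradK F) hFL hφ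
  rw [embJ_gradK hn hb] at h
  exact h

/-- In the application F and G are the truncated powers with exponents p/2 and p/4, N is the L^r
norm of G, a = ‖∇G‖, b = (∇φ, ∇F), c = ‖F‖, S is the Sobolev constant and V = |Ω|. The conclusion
has the form required by `exists_bound_of_sublinear` for N². -/
lemma sq_le_of_almost_solution {S p V r N a b c : ℝ} (hN0 : 0 ≤ N) (h1 : N ≤ S * a)
    (h2 : a ^ 2 ≤ (1 + p / 2) ^ 2 * b) (h3 : b ≤ c + 1)
    (h4 : c ^ 2 ≤ (2 ^ p + 2) * (V + N ^ r)) :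
    N ^ 2 ≤ S ^ 2 * (1 + p / 2) ^ 2 * √((2 ^ p + 2) * V + (2 ^ p + 2) * (N ^ 2) ^ (r / 2)) +
      S ^ 2 * (1 + p / 2) ^ 2 := by
  have e1 : (N ^ 2) ^ (r / 2) = N ^ r := by
    rw [← Real.rpow_natCast, ← Real.rpow_mul hN0]; congr 1; push_cast; ring
  have e2 : c ≤ √((2 ^ p + 2) * V + (2 ^ p + 2) * (N ^ 2) ^ (r / 2)) := by
    rw [e1, ← mul_add]
    exact Real.le_sqrt_of_sq_le h4
  calc N ^ 2 ≤ (S * a) ^ 2 := by gcongr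
    _ = S ^ 2 * a ^ 2 := by ring
    _ ≤ S ^ 2 * ((1 + p / 2) ^ 2 * (c + 1)) := by
        gcongr; exact h2.trans (by gcongr)
    _ = S ^ 2 * (1 + p / 2) ^ 2 * c + S ^ 2 * (1 + p / 2) ^ 2 := by ring
    _ ≤ _ := by gcongr

set_option maxHeartbeats 1000000 in
/-- A uniform bound for the truncated powers of functions which almost solve the Dirichlet
problem. -/
lemma exists_bound_truncPow (hn : 1 ≤ n) (hb : Bornology.IsBounded (Ω : Set (E n)))
    {p : ℝ} (hp : 0 ≤ p) (hpn : 5 ≤ n → p ≤ 4 / ((n : ℝ) - 4)) :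
    ∃ Y : ℝ, 0 ≤ Y ∧ ∀ g : H Ω, ‖g‖ ≤ 1 → ∀ φ : ℕ → 𝓓(Ω, ℝ),
      Tendsto (fun j => gradK (φ j)) atTop (𝓝 ((embJ Ω).adjoint g)) →
      ∀ ε : ℝ, 0 < ε → ε ≤ 1 → ∀ᶠ j in atTop,
        eLpNorm (fun x => truncPow ε (p / 2 / 2) (φ j x)) (ENNReal.ofReal (4 * (p + 1) / (p + 2)))
          (volume.restrict (Ω : Set (E n))) ≤ ENNReal.ofReal Y := by
  obtain ⟨S, hS⟩ := exists_eLpNorm_le_norm_grad hn hb hp hpn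
  obtain ⟨Y₀, hY₀, hbound⟩ := exists_bound_of_sublinear (χ := 4 * (p + 1) / (p + 2) / 2)
    (by positivity) (by rw [div_div, div_lt_iff₀ (by positivity)]; linarith)
    (a := S ^ 2 * (1 + p / 2) ^ 2) (b := (2 ^ p + 2) * (volume (Ω : Set (E n))).toReal)
    (c := 2 ^ p + 2) (d := S ^ 2 * (1 + p / 2) ^ 2) (by positivity) (by positivity) (by positivity)
    (by positivity)
  refine ⟨√Y₀, by positivity, fun g hg φ hφ ε hε hε1 => ?_⟩
  -- The factor bounds the derivative of the truncated power and blows up as ε → 0. The index from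
  -- which the estimate holds thus depends on ε, whereas the bound does not.
  have hsmall := eventually_norm_sub_mul_le hφ (ε⁻¹ ^ (p / 2) * (1 + 2 * (p / 2)))
  filter_upwards [hsmall] with j hj
  have hF0 : truncPow ε (p / 2) 0 = 0 := by simp [truncPow]
  have hG0 : truncPow ε (p / 2 / 2) 0 = 0 := by simp [truncPow]
  obtain ⟨F, hF⟩ : ∃ F, F = compTest _ (contDiff_truncPow hε.le _) hF0 (φ j) := ⟨_, rfl⟩
  obtain ⟨G, hG⟩ : ∃ G, G = compTest _ (contDiff_truncPow hε.le _) hG0 (φ j) := ⟨_, rfl⟩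
  have hFx : ∀ x, F x = truncPow ε (p / 2) (φ j x) := fun x => by rw [hF]; rfl
  have hGx : ∀ x, G x = truncPow ε (p / 2 / 2) (φ j x) := fun x => by rw [hG]; rfl
  have h2 : ‖grad G‖ ^ 2 ≤ (1 + p / 2) ^ 2 * ⟪grad (φ j), grad F⟫ := by
    rw [hF, hG]
    exact norm_grad_compTest_sq_le _ _ _ _
      (fun t => sq_deriv_truncPow_le hε.le hε1 (by positivity) t) _
  have hFL : ‖grad F‖ ≤ ε⁻¹ ^ (p / 2) * (1 + 2 * (p / 2)) * ‖grad (φ j)‖ := by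
    rw [hF]
    exact norm_grad_compTest_le _ _ (fun t => abs_deriv_truncPow_le hε hε1 (by positivity) t) _
  have h3 := inner_grad_le_of_almost_solution hn hb hg hFL hj
  have h4 := norm_toH_truncPow_sq_le hb hp hε.le hFx hGx
  have hNtop : eLpNorm G (ENNReal.ofReal (4 * (p + 1) / (p + 2)))
      (volume.restrict (Ω : Set (E n))) ≠ ⊤ := (memLp_testFunction G _).eLpNorm_ne_top
  have h1 := ENNReal.toReal_mono (by finiteness) (hS G)
  rw [ENNReal.toReal_mul, toReal_enorm, ENNReal.coe_toReal] at h1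
  have h6 := hbound _ (by positivity) (sq_le_of_almost_solution ENNReal.toReal_nonneg h1 h2 h3 h4)
  have h7 := Real.le_sqrt_of_sq_le h6
  simp only [← hGx]
  exact (ENNReal.ofReal_toReal hNtop).symm.trans_le (ENNReal.ofReal_le_ofReal h7)

set_option maxHeartbeats 1000000 in
/-- The embedding of the domain of the Laplacian into `L^{2(p+1)}(Ω)`. -/
lemma exists_eLpNorm_solG_le (hn : 1 ≤ n) (hb : Bornology.IsBounded (Ω : Set (E n)))
    {p : ℝ} (hp : 0 ≤ p) (hpn : 5 ≤ n → p ≤ 4 / ((n : ℝ) - 4)) :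
    ∃ C : ℝ≥0, ∀ g : H Ω, eLpNorm (solG Ω g) (ENNReal.ofReal (2 * (p + 1)))
      (volume.restrict (Ω : Set (E n))) ≤ C * ‖g‖ₑ := by
  obtain ⟨Y, hY, hbound⟩ := exists_bound_truncPow hn hb hp hpn
  set r := 4 * (p + 1) / (p + 2) with hr
  set μ := volume.restrict (Ω : Set (E n)) with hμ
  have hunit : ∀ g : H Ω, ‖g‖ ≤ 1 → eLpNorm (solG Ω g) (ENNReal.ofReal (2 * (p + 1))) μ ≤
      ENNReal.ofReal (Y ^ (2 / (p + 2))) := by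
    intro g hg
    obtain ⟨φ, hφ, hφu⟩ := exists_seq_of_gradClosure hn hb ((embJ Ω).adjoint g)
    change Tendsto (fun j => toH (φ j)) atTop (𝓝 (solG Ω g)) at hφu
    have hmeas : TendstoInMeasure μ (fun j => (toH (φ j) : E n → ℝ)) atTop (solG Ω g) :=
      tendstoInMeasure_of_tendsto_Lp hφu
    obtain ⟨ns, hns, hae⟩ := hmeas.exists_seq_tendsto_ae
    -- Diagonal choice: for ε = 1/(k+1) an index J k ≥ k is taken beyond the threshold for that ε;
    -- Fatou's lemma then removes truncation and approximation together.
    have hev := fun k : ℕ => (hbound g hg (φ ∘ ns) (hφ.comp hns.tendsto_atTop)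
      (1 / ((k : ℝ) + 1)) (by positivity) (by
        rw [div_le_one (by positivity)]; linarith [(Nat.cast_nonneg k : (0 : ℝ) ≤ k)])).and
      (eventually_ge_atTop k)
    choose J hJ hJk using fun k => (hev k).exists
    have hJt : Tendsto J atTop atTop := tendsto_atTop_mono hJk tendsto_id
    have hlim : ∀ᵐ x ∂μ, Tendsto (fun k : ℕ => truncPow (1 / ((k : ℝ) + 1)) (p / 2 / 2)
        (φ (ns (J k)) x)) atTop (𝓝 (truncPow 0 (p / 2 / 2) (solG Ω g x))) := by
      filter_upwards [hae, ae_all_iff.2 fun j => coeFn_toH (φ j)] with x hx hx2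
      refine tendsto_truncPow tendsto_one_div_add_atTop_nhds_zero_nat ?_
      simp only [hx2] at hx
      exact hx.comp hJt
    have hfatou := Lp.eLpNorm_lim_le_liminf_eLpNorm (p := ENNReal.ofReal r) (μ := μ)
      (f := fun (k : ℕ) x => truncPow (1 / ((k : ℝ) + 1)) (p / 2 / 2) (φ (ns (J k)) x))
      (fun k => ((contDiff_truncPow (by positivity) _).continuous.comp
        (φ (ns (J k))).continuous).aestronglyMeasurable) _ hlim
    have hG : eLpNorm (fun x => truncPow 0 (p / 2 / 2) (solG Ω g x)) (ENNReal.ofReal r) μ ≤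
        ENNReal.ofReal Y := by
      refine hfatou.trans ?_
      refine (liminf_le_liminf (v := fun _ => ENNReal.ofReal Y) (Eventually.of_forall hJ)).trans ?_
      simp
    have hpow : eLpNorm (fun x => ‖solG Ω g x‖ ^ ((p + 2) / 2)) (ENNReal.ofReal r) μ ≤
        ENNReal.ofReal Y := by
      refine (eLpNorm_mono fun x => ?_).trans hG
      rw [Real.norm_eq_abs, abs_of_nonneg (by positivity)]
      exact abs_rpow_le_truncPow_zero hp _
    rw [eLpNorm_norm_rpow _ (by positivity)] at hpow
    -- This identity is the reason for the choice r = 4(p+1)/(p+2).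
    have e1 : ENNReal.ofReal r * ENNReal.ofReal ((p + 2) / 2) = ENNReal.ofReal (2 * (p + 1)) := by
      rw [← ENNReal.ofReal_mul (by positivity), hr]; congr 1; field_simp; ring
    rw [e1] at hpow
    have h2 := ENNReal.rpow_le_rpow hpow (by positivity : 0 ≤ 2 / (p + 2))
    rw [← ENNReal.rpow_mul, ENNReal.ofReal_rpow_of_nonneg hY (by positivity)] at h2
    have e2 : (p + 2) / 2 * (2 / (p + 2)) = 1 := by field_simp
    rwa [e2, ENNReal.rpow_one] at h2
  refine ⟨(Y ^ (2 / (p + 2))).toNNReal, fun g => ?_⟩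
  by_cases hg : g = 0
  · subst hg
    rw [map_zero]
    have : eLpNorm ((0 : H Ω) : E n → ℝ) (ENNReal.ofReal (2 * (p + 1))) μ = 0 := by
      rw [eLpNorm_congr_ae (Lp.coeFn_zero ℝ 2 μ)]; simp
    rw [this]; exact zero_le
  have hg0 : ‖g‖ ≠ 0 := norm_ne_zero_iff.2 hg
  have h1 := hunit (‖g‖⁻¹ • g) (by rw [norm_smul, norm_inv, norm_norm, inv_mul_cancel₀ hg0])
  have e1 : solG Ω g = ‖g‖ • solG Ω (‖g‖⁻¹ • g) := by rw [map_smul, smul_inv_smul₀ hg0]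
  rw [e1, eLpNorm_congr_ae (Lp.coeFn_smul _ _), eLpNorm_const_smul, mul_comm, enorm_norm]
  gcongr
  exact h1

lemma exists_eLpNorm_le_norm_opA (hn : 1 ≤ n) (hb : Bornology.IsBounded (Ω : Set (E n)))
    {p : ℝ} (hp : 0 ≤ p) (hpn : 5 ≤ n → p ≤ 4 / ((n : ℝ) - 4)) :
    ∃ C : ℝ≥0, ∀ u ∈ domA Ω, eLpNorm u (ENNReal.ofReal (2 * (p + 1)))
      (volume.restrict (Ω : Set (E n))) ≤ C * ‖opA Ω u‖ₑ := by
  obtain ⟨C, hC⟩ := exists_eLpNorm_solG_le hn hb hp hpn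
  refine ⟨C, fun u hu => ?_⟩
  have := hC (opA Ω u)
  rwa [solG_opA hn hb hu] at this

end

/-! ### The superposition operator of the source -/

lemma abs_rpow_le_of_mem_uIcc {p a b x : ℝ} (hp : 0 ≤ p) (hx : x ∈ uIcc a b) :
    |x| ^ p ≤ |a| ^ p + |b| ^ p := by
  have ha : 0 ≤ |a| ^ p := by positivity
  have hb : 0 ≤ |b| ^ p := by positivity
  have hx' : |x| ≤ max |a| |b| := by
    rcases mem_uIcc.1 hx with h | h
    · exact abs_le_max_abs_abs h.1 h.2
    · exact (abs_le_max_abs_abs h.1 h.2).trans_eq (max_comm _ _)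
  rcases le_max_iff.1 hx' with h | h
  · exact (Real.rpow_le_rpow (abs_nonneg _) h hp).trans (by linarith)
  · exact (Real.rpow_le_rpow (abs_nonneg _) h hp).trans (by linarith)

lemma abs_sub_le_of_abs_deriv_le {f : ℝ → ℝ} (hf : ContDiff ℝ 1 f) {C p : ℝ} (hC : 0 ≤ C)
    (hp : 0 ≤ p) (hd : ∀ s, |deriv f s| ≤ C * (1 + |s| ^ p)) (a b : ℝ) :
    |f a - f b| ≤ C * ((1 + |a| ^ p + |b| ^ p) * |a - b|) := by
  have h := Convex.norm_image_sub_le_of_norm_deriv_le (𝕜 := ℝ) (f := f) (s := uIcc a b)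
    (C := C * (1 + |a| ^ p + |b| ^ p)) (x := b) (y := a)
    (fun x _ => (hf.differentiable one_ne_zero).differentiableAt) (fun x hx => ?_)
    (convex_uIcc a b) right_mem_uIcc left_mem_uIcc
  · simpa [mul_assoc] using h
  · refine (hd x).trans ?_
    exact mul_le_mul_of_nonneg_left (by linarith [abs_rpow_le_of_mem_uIcc hp hx]) hC

lemma hasDerivAt_primitive {f : ℝ → ℝ} (hf : Continuous f) (s : ℝ) :
    HasDerivAt (primitive f) (f s) s :=
  intervalIntegral.integral_hasDerivAt_right (hf.intervalIntegrable _ _)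
    (hf.stronglyMeasurableAtFilter _ _) hf.continuousAt

/-- The mean value inequality for y ↦ f̂(y) - f(b)y, whose derivative f(y) - f(b) is controlled by
the growth of f'. One factor |a - b| is kept with the weight, so that their product is small in L².
-/
lemma abs_primitive_sub_le {f : ℝ → ℝ} (hf : ContDiff ℝ 1 f) {C p : ℝ} (hC : 0 ≤ C)
    (hp : 0 ≤ p) (hd : ∀ s, |deriv f s| ≤ C * (1 + |s| ^ p)) (a b : ℝ) :
    |primitive f a - primitive f b - f b * (a - b)| ≤
      C * ((1 + |a| ^ p + 2 * |b| ^ p) * |a - b|) * |a - b| := by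
  have hder : ∀ x, HasDerivAt (fun y => primitive f y - f b * y) (f x - f b) x := fun x => by
    have := (hasDerivAt_primitive hf.continuous x).sub ((hasDerivAt_id x).const_mul (f b))
    rw [mul_one] at this
    exact this
  have h := Convex.norm_image_sub_le_of_norm_hasDerivWithin_le (𝕜 := ℝ)
    (f := fun y => primitive f y - f b * y) (f' := fun x => f x - f b) (s := uIcc a b)
    (C := C * ((1 + |a| ^ p + 2 * |b| ^ p) * |a - b|)) (x := b) (y := a)
    (fun x _ => (hder x).hasDerivWithinAt) (fun x hx => ?_)
    (convex_uIcc a b) right_mem_uIcc left_mem_uIcc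
  · rw [Real.norm_eq_abs, Real.norm_eq_abs] at h
    convert h using 2
    ring
  · refine (abs_sub_le_of_abs_deriv_le hf hC hp hd x b).trans ?_
    have h2 : |x - b| ≤ |a - b| := abs_sub_left_of_mem_uIcc (uIcc_comm a b ▸ hx)
    have h3 := abs_rpow_le_of_mem_uIcc hp hx
    exact mul_le_mul_of_nonneg_left (mul_le_mul (by linarith) h2 (abs_nonneg _) (by positivity)) hC

/-- A form of Young's inequality, by cases: for w ≤ δa the first term suffices, otherwise a ≤ w/δ
and the second one does. -/
lemma rpow_mul_le_add {p δ a w : ℝ} (hp : 0 ≤ p) (hδ : 0 < δ) (ha : 0 ≤ a) (hw : 0 ≤ w) :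
    a ^ p * w ≤ δ * a ^ (p + 1) + δ⁻¹ ^ p * w ^ (p + 1) := by
  have e : ∀ x : ℝ, 0 ≤ x → x ^ (p + 1) = x ^ p * x := fun x hx => by
    rw [Real.rpow_add_of_nonneg hx hp zero_le_one, Real.rpow_one]
  rcases le_total w (δ * a) with h | h
  · have : a ^ p * w ≤ δ * a ^ (p + 1) := by
      rw [e a ha]; nlinarith [Real.rpow_nonneg ha p]
    have h2 : 0 ≤ δ⁻¹ ^ p * w ^ (p + 1) := by positivity
    linarith
  · have : a ^ p ≤ δ⁻¹ ^ p * w ^ p := by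
      rw [← Real.mul_rpow (by positivity) hw]
      exact Real.rpow_le_rpow ha (by rw [inv_mul_eq_div, le_div_iff₀ hδ]; linarith) hp
    have h2 : 0 ≤ δ * a ^ (p + 1) := by positivity
    rw [e w hw]
    nlinarith

lemma weight_mul_le {p δ : ℝ} (hp : 0 ≤ p) (hδ : 0 < δ) (a b : ℝ) :
    (1 + |a| ^ p + 2 * |b| ^ p) * |a - b| ≤ |a - b| + (2 ^ p + 2) * δ * |b| ^ (p + 1) +
      ((2 ^ p + 2) * δ⁻¹ ^ p + 2 ^ p) * |a - b| ^ (p + 1) := by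
  have h1 : |a| ^ p ≤ 2 ^ p * (|b| ^ p + |a - b| ^ p) := by
    have : |a| ≤ 2 * max |b| |a - b| := by
      have := abs_add_le b (a - b)
      rw [add_sub_cancel] at this
      linarith [le_max_left |b| |a - b|, le_max_right |b| |a - b|]
    refine (Real.rpow_le_rpow (abs_nonneg _) this hp).trans ?_
    rw [Real.mul_rpow zero_le_two (by positivity)]
    gcongr
    rcases max_choice |b| |a - b| with h | h <;> rw [h]
    · linarith [Real.rpow_nonneg (abs_nonneg (a - b)) p]
    · linarith [Real.rpow_nonneg (abs_nonneg b) p]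
  have h2 := rpow_mul_le_add hp hδ (abs_nonneg b) (abs_nonneg (a - b))
  have e : |a - b| ^ (p + 1) = |a - b| ^ p * |a - b| := by
    rw [Real.rpow_add_of_nonneg (abs_nonneg _) hp zero_le_one, Real.rpow_one]
  calc _ ≤ (1 + 2 ^ p * (|b| ^ p + |a - b| ^ p) + 2 * |b| ^ p) * |a - b| := by gcongr
    _ = |a - b| + (2 ^ p + 2) * (|b| ^ p * |a - b|) + 2 ^ p * |a - b| ^ (p + 1) := by
        rw [e]; ring
    _ ≤ |a - b| + (2 ^ p + 2) * (δ * |b| ^ (p + 1) + δ⁻¹ ^ p * |a - b| ^ (p + 1)) +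
        2 ^ p * |a - b| ^ (p + 1) := by gcongr
    _ = _ := by ring

section
variable {X : Type*} [MeasurableSpace X] {μ : Measure X}

/-- The weighted distance which controls the superposition operator. -/
def weightedDist (μ : Measure X) (p : ℝ) (a b : X → ℝ) : ℝ≥0∞ :=
  eLpNorm (fun x => (1 + |a x| ^ p + 2 * |b x| ^ p) * |a x - b x|) 2 μ

lemma eLpNorm_abs_rpow {p : ℝ} (hp : 0 ≤ p) (a : X → ℝ) :
    eLpNorm (fun x => |a x| ^ (p + 1)) 2 μ = eLpNorm a (ENNReal.ofReal (2 * (p + 1))) μ ^ (p + 1) := by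
  have := eLpNorm_norm_rpow (μ := μ) (p := 2) a (q := p + 1) (by positivity)
  simp only [Real.norm_eq_abs] at this
  rw [this, ENNReal.ofReal_mul zero_le_two]
  norm_num

lemma weightedDist_le {p δ : ℝ} (hp : 0 ≤ p) (hδ : 0 < δ) {a b : X → ℝ}
    (ha : AEStronglyMeasurable a μ) (hb : AEStronglyMeasurable b μ) :
    weightedDist μ p a b ≤ eLpNorm (a - b) 2 μ +
      ENNReal.ofReal ((2 ^ p + 2) * δ) * eLpNorm b (ENNReal.ofReal (2 * (p + 1))) μ ^ (p + 1) +
      ENNReal.ofReal ((2 ^ p + 2) * δ⁻¹ ^ p + 2 ^ p) *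
        eLpNorm (a - b) (ENNReal.ofReal (2 * (p + 1))) μ ^ (p + 1) := by
  have hpow : ∀ {w : X → ℝ}, AEStronglyMeasurable w μ →
      AEStronglyMeasurable (fun x => |w x| ^ (p + 1)) μ := fun hw =>
    (Real.continuous_rpow_const (by positivity)).comp_aestronglyMeasurable hw.norm
  have hconst : ∀ {c : ℝ} (w : X → ℝ), 0 ≤ c → eLpNorm (fun x => c * |w x| ^ (p + 1)) 2 μ =
      ENNReal.ofReal c * eLpNorm w (ENNReal.ofReal (2 * (p + 1))) μ ^ (p + 1) := by
    intro c w hc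
    rw [← eLpNorm_abs_rpow hp]
    have := eLpNorm_const_smul c (fun x => |w x| ^ (p + 1)) 2 μ
    rwa [Real.enorm_of_nonneg hc] at this
  rw [← hconst b (by positivity), ← hconst (a - b) (by positivity)]
  refine le_trans (eLpNorm_mono_real (g := fun x => |a x - b x| + (2 ^ p + 2) * δ * |b x| ^ (p + 1) +
    ((2 ^ p + 2) * δ⁻¹ ^ p + 2 ^ p) * |a x - b x| ^ (p + 1)) fun x => ?_) ?_
  · rw [Real.norm_of_nonneg (by positivity)]
    exact weight_mul_le hp hδ _ _
  · have hab := ha.sub hb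
    refine (eLpNorm_add_le (hab.norm.add ((hpow hb).const_mul _)) ((hpow hab).const_mul _)
      one_le_two).trans ?_
    gcongr
    · refine (eLpNorm_add_le hab.norm ((hpow hb).const_mul _) one_le_two).trans ?_
      gcongr
      exact (eLpNorm_norm (a - b)).le

/-- First δ is chosen to make the term with b, which does not tend to zero, at most ε/2; with δ
fixed the remaining terms vanish in the limit. -/
lemma tendsto_weightedDist {ι : Type*} {l : Filter ι} {p : ℝ} (hp : 0 ≤ p) {a : ι → X → ℝ}
    {b : X → ℝ} (ha : ∀ i, AEStronglyMeasurable (a i) μ)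
    (hb : MemLp b (ENNReal.ofReal (2 * (p + 1))) μ)
    (h2 : Tendsto (fun i => eLpNorm (a i - b) 2 μ) l (𝓝 0))
    (hr : Tendsto (fun i => eLpNorm (a i - b) (ENNReal.ofReal (2 * (p + 1))) μ) l (𝓝 0)) :
    Tendsto (fun i => weightedDist μ p (a i) b) l (𝓝 0) := by
  rw [ENNReal.tendsto_nhds_zero]
  intro ε hε
  have hε2 : 0 < ε / 2 := ENNReal.half_pos hε.ne'
  have hM : eLpNorm b (ENNReal.ofReal (2 * (p + 1))) μ ^ (p + 1) ≠ ⊤ :=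
    ENNReal.rpow_ne_top_of_nonneg (by positivity) hb.eLpNorm_ne_top
  obtain ⟨δ, hδ, hδ0⟩ : ∃ δ : ℝ, ENNReal.ofReal ((2 ^ p + 2) * δ) *
      eLpNorm b (ENNReal.ofReal (2 * (p + 1))) μ ^ (p + 1) ≤ ε / 2 ∧ 0 < δ := by
    have h0 : Tendsto (fun δ : ℝ => ENNReal.ofReal ((2 ^ p + 2) * δ) *
        eLpNorm b (ENNReal.ofReal (2 * (p + 1))) μ ^ (p + 1)) (𝓝[>] 0) (𝓝 0) := by
      have h1 : Tendsto (fun δ : ℝ => ENNReal.ofReal ((2 ^ p + 2) * δ)) (𝓝[>] 0) (𝓝 0) := by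
        have : Continuous (fun δ : ℝ => ENNReal.ofReal ((2 ^ p + 2) * δ)) :=
          ENNReal.continuous_ofReal.comp (continuous_const.mul continuous_id)
        have := this.tendsto 0
        simp only [mul_zero, ENNReal.ofReal_zero] at this
        exact this.mono_left nhdsWithin_le_nhds
      simpa using ENNReal.Tendsto.mul_const h1 (Or.inr hM)
    exact ((ENNReal.tendsto_nhds_zero.1 h0 _ hε2).and self_mem_nhdsWithin).exists
  have h3 : Tendsto (fun i => eLpNorm (a i - b) 2 μ +
      ENNReal.ofReal ((2 ^ p + 2) * δ⁻¹ ^ p + 2 ^ p) *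
        eLpNorm (a i - b) (ENNReal.ofReal (2 * (p + 1))) μ ^ (p + 1)) l (𝓝 0) := by
    have h4 := (ENNReal.continuous_rpow_const (y := p + 1)).tendsto 0 |>.comp hr
    rw [ENNReal.zero_rpow_of_pos (by positivity)] at h4
    simpa using h2.add (ENNReal.Tendsto.const_mul h4 (Or.inr ENNReal.ofReal_ne_top))
  filter_upwards [ENNReal.tendsto_nhds_zero.1 h3 _ hε2] with i hi
  refine (weightedDist_le hp hδ0 (ha i) hb.1).trans ?_
  rw [add_right_comm]
  exact (add_le_add hi hδ).trans (ENNReal.add_halves ε).le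

end

section
variable {n : ℕ} {Ω : Opens (E n)}

open Classical in
/-- The superposition operator `u ↦ f(u)` on `L²(Ω)`. -/
def superpose (Ω : Opens (E n)) (f : ℝ → ℝ) (u : H Ω) : H Ω :=
  if h : MemLp (fun x => f (u x)) 2 (volume.restrict (Ω : Set (E n))) then h.toLp else 0

/-- The functions of `L²(Ω)` which belong to `L^{2(p+1)}(Ω)`. -/
def lpSpace (Ω : Opens (E n)) (p : ℝ) : Set (H Ω) :=
  {u | MemLp u (ENNReal.ofReal (2 * (p + 1))) (volume.restrict (Ω : Set (E n)))}

variable {σ p Cf' Cf cf : ℝ} {f : ℝ → ℝ}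

lemma IsSource.abs_le (hf : IsSource n σ f p Cf' Cf cf) (s : ℝ) :
    |f s| ≤ Cf' * (3 * |s| + |s| ^ (p + 1)) := by
  have h := abs_sub_le_of_abs_deriv_le hf.contDiff hf.Cf'_pos.le hf.p_nonneg hf.abs_deriv_le s 0
  rw [hf.map_zero, sub_zero, sub_zero, abs_zero] at h
  refine h.trans (mul_le_mul_of_nonneg_left ?_ hf.Cf'_pos.le)
  rw [Real.rpow_add_of_nonneg (abs_nonneg _) hf.p_nonneg zero_le_one, Real.rpow_one]
  nlinarith [abs_nonneg s, Real.rpow_le_one le_rfl zero_le_one hf.p_nonneg]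

lemma memLp_growth {p : ℝ} (hp : 0 ≤ p) {u : H Ω} (hu : u ∈ lpSpace Ω p) (c d : ℝ) :
    MemLp (fun x => c * (d * |u x| + |u x| ^ (p + 1))) 2 (volume.restrict (Ω : Set (E n))) := by
  refine (((Lp.memLp u).norm.const_mul d).add ⟨?_, ?_⟩).const_mul c
  · exact (Real.continuous_rpow_const (by positivity)).comp_aestronglyMeasurable
      (Lp.aestronglyMeasurable u).norm
  · change eLpNorm (fun x => |u x| ^ (p + 1)) 2 _ < ⊤
    rw [eLpNorm_abs_rpow hp]
    exact ENNReal.rpow_lt_top_of_nonneg (by positivity) (MemLp.eLpNorm_ne_top hu)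

lemma IsSource.memLp (hf : IsSource n σ f p Cf' Cf cf) {u : H Ω} (hu : u ∈ lpSpace Ω p) :
    MemLp (fun x => f (u x)) 2 (volume.restrict (Ω : Set (E n))) := by
  refine (memLp_growth hf.p_nonneg hu Cf' 3).mono
    (hf.contDiff.continuous.comp_aestronglyMeasurable (Lp.aestronglyMeasurable u)) ?_
  refine Eventually.of_forall fun x => ?_
  rw [Real.norm_eq_abs]
  exact (hf.abs_le _).trans (le_abs_self _)

lemma IsSource.coeFn_superpose (hf : IsSource n σ f p Cf' Cf cf) {u : H Ω} (hu : u ∈ lpSpace Ω p) :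
    superpose Ω f u =ᵐ[volume.restrict (Ω : Set (E n))] fun x => f (u x) := by
  rw [superpose, dif_pos (hf.memLp hu)]
  exact MemLp.coeFn_toLp _

lemma IsSource.inner_superpose (hf : IsSource n σ f p Cf' Cf cf) {u : H Ω} (hu : u ∈ lpSpace Ω p)
    (w : H Ω) : ⟪superpose Ω f u, w⟫ = ∫ x in (Ω : Set (E n)), f (u x) * w x := by
  rw [L2.inner_def]
  refine integral_congr_ae ?_
  filter_upwards [hf.coeFn_superpose hu] with x hx
  simp [hx, mul_comm]

lemma IsSource.abs_primitive_le (hf : IsSource n σ f p Cf' Cf cf) (s : ℝ) :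
    |primitive f s| ≤ Cf' * (3 * |s| + |s| ^ (p + 1)) * |s| := by
  have h := abs_primitive_sub_le hf.contDiff hf.Cf'_pos.le hf.p_nonneg hf.abs_deriv_le s 0
  have h0 : primitive f 0 = 0 := by simp [primitive]
  rw [hf.map_zero, h0, sub_zero, sub_zero, zero_mul, sub_zero, abs_zero] at h
  refine h.trans (mul_le_mul_of_nonneg_right (mul_le_mul_of_nonneg_left ?_ hf.Cf'_pos.le)
    (abs_nonneg _))
  rw [Real.rpow_add_of_nonneg (abs_nonneg _) hf.p_nonneg zero_le_one, Real.rpow_one]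
  nlinarith [abs_nonneg s, Real.rpow_le_one le_rfl zero_le_one hf.p_nonneg]

lemma IsSource.continuous_primitive (hf : IsSource n σ f p Cf' Cf cf) :
    Continuous (primitive f) :=
  continuous_iff_continuousAt.2 fun s => (hasDerivAt_primitive hf.contDiff.continuous s).continuousAt

lemma IsSource.integrable_primitive (hf : IsSource n σ f p Cf' Cf cf) {u : H Ω}
    (hu : u ∈ lpSpace Ω p) :
    Integrable (fun x => primitive f (u x)) (volume.restrict (Ω : Set (E n))) := by
  refine ((memLp_growth hf.p_nonneg hu Cf' 3).integrable_mul (Lp.memLp u).norm).mono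
    (hf.continuous_primitive.comp_aestronglyMeasurable (Lp.aestronglyMeasurable u)) ?_
  refine Eventually.of_forall fun x => ?_
  rw [Real.norm_eq_abs]
  exact (hf.abs_primitive_le _).trans (le_abs_self _)

lemma IsSource.memLp_weight (hf : IsSource n σ f p Cf' Cf cf) {a b : H Ω}
    (ha : a ∈ lpSpace Ω p) (hb : b ∈ lpSpace Ω p) :
    MemLp (fun x => (1 + |a x| ^ p + 2 * |b x| ^ p) * |a x - b x|) 2
      (volume.restrict (Ω : Set (E n))) := by
  have hp := hf.p_nonneg
  have hpow : ∀ w : H Ω, AEStronglyMeasurable (fun x => |w x| ^ p)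
      (volume.restrict (Ω : Set (E n))) := fun w =>
    (Real.continuous_rpow_const hp).comp_aestronglyMeasurable (Lp.aestronglyMeasurable w).norm
  refine ⟨((aestronglyMeasurable_const.add (hpow a)).add ((hpow b).const_mul 2)).mul
    ((Lp.aestronglyMeasurable a).sub (Lp.aestronglyMeasurable b)).norm, ?_⟩
  refine (weightedDist_le hp one_pos (Lp.aestronglyMeasurable a)
    (Lp.aestronglyMeasurable b)).trans_lt ?_
  have h1 : eLpNorm (a - b : E n → ℝ) 2 (volume.restrict (Ω : Set (E n))) ≠ ⊤ :=
    ((Lp.memLp a).sub (Lp.memLp b)).eLpNorm_ne_top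
  have h2 := MemLp.eLpNorm_ne_top hb
  have h3 := (MemLp.sub ha hb).eLpNorm_ne_top
  have hq : 0 ≤ p + 1 := by positivity
  finiteness

lemma IsSource.norm_superpose_sub_le (hf : IsSource n σ f p Cf' Cf cf) {a b : H Ω}
    (ha : a ∈ lpSpace Ω p) (hb : b ∈ lpSpace Ω p) : ‖superpose Ω f a - superpose Ω f b‖ ≤
      Cf' * (weightedDist (volume.restrict (Ω : Set (E n))) p a b).toReal := by
  rw [Lp.norm_def, ← ENNReal.toReal_ofReal hf.Cf'_pos.le, ← ENNReal.toReal_mul]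
  refine ENNReal.toReal_mono
    (ENNReal.mul_ne_top ENNReal.ofReal_ne_top (hf.memLp_weight ha hb).eLpNorm_ne_top) ?_
  have := eLpNorm_const_smul Cf' (fun x => (1 + |a x| ^ p + 2 * |b x| ^ p) * |a x - b x|) 2
    (volume.restrict (Ω : Set (E n)))
  rw [Real.enorm_of_nonneg hf.Cf'_pos.le] at this
  rw [weightedDist, ← this]
  refine eLpNorm_mono_ae_real ?_
  filter_upwards [hf.coeFn_superpose ha, hf.coeFn_superpose hb,
    Lp.coeFn_sub (superpose Ω f a) (superpose Ω f b)] with x h1 h2 h3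
  rw [h3, Pi.sub_apply, h1, h2, Real.norm_eq_abs]
  refine (abs_sub_le_of_abs_deriv_le hf.contDiff hf.Cf'_pos.le hf.p_nonneg hf.abs_deriv_le
    _ _).trans ?_
  simp only [Pi.smul_apply, smul_eq_mul]
  have := hf.Cf'_pos.le
  gcongr
  linarith [Real.rpow_nonneg (abs_nonneg (b x)) p]

/-- Cauchy–Schwarz applied to the pointwise Taylor remainder, with one factor |a - b| absorbed into
the weight. -/
lemma IsSource.abs_integral_primitive_sub_le (hf : IsSource n σ f p Cf' Cf cf) {a b : H Ω}
    (ha : a ∈ lpSpace Ω p) (hb : b ∈ lpSpace Ω p) :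
    |(∫ x in (Ω : Set (E n)), primitive f (a x)) - (∫ x in (Ω : Set (E n)), primitive f (b x))
      - ⟪superpose Ω f b, a - b⟫| ≤
      Cf' * (weightedDist (volume.restrict (Ω : Set (E n))) p a b).toReal * ‖a - b‖ := by
  have hw := hf.memLp_weight ha hb
  set W : H Ω := hw.toLp with hW
  have hWn : ‖W‖ = (weightedDist (volume.restrict (Ω : Set (E n))) p a b).toReal :=
    Lp.norm_toLp _ hw
  have hi1 : Integrable (fun x => f (b x) * (a x - b x)) (volume.restrict (Ω : Set (E n))) :=
    (hf.memLp hb).integrable_mul ((Lp.memLp a).sub (Lp.memLp b))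
  have hi2 : Integrable (fun x => (1 + |a x| ^ p + 2 * |b x| ^ p) * |a x - b x| * |a x - b x|)
      (volume.restrict (Ω : Set (E n))) :=
    hw.integrable_mul ((Lp.memLp a).sub (Lp.memLp b)).norm
  have hab : ((a - b : H Ω) : E n → ℝ) =ᵐ[volume.restrict (Ω : Set (E n))] fun x => a x - b x :=
    Lp.coeFn_sub a b
  have e1 : ⟪superpose Ω f b, a - b⟫ = ∫ x in (Ω : Set (E n)), f (b x) * (a x - b x) := by
    rw [hf.inner_superpose hb]
    exact integral_congr_ae (by filter_upwards [hab] with x hx; rw [hx])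
  have e2 : ∫ x in (Ω : Set (E n)), (1 + |a x| ^ p + 2 * |b x| ^ p) * |a x - b x| * |a x - b x|
      ≤ ‖W‖ * ‖a - b‖ := by
    have habs : ‖|a - b|‖ = ‖a - b‖ := norm_abs_eq_norm _
    rw [← habs]
    refine le_trans (le_of_eq ?_) (real_inner_le_norm W |a - b|)
    rw [L2.inner_def]
    refine integral_congr_ae ?_
    filter_upwards [hw.coeFn_toLp, hab, Lp.coeFn_abs (a - b)] with x h1 h2 h3
    rw [h3, h2, hW, h1]
    simp [mul_comm]
  rw [e1, ← integral_sub (hf.integrable_primitive ha) (hf.integrable_primitive hb),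
    ← integral_sub (Integrable.sub' (hf.integrable_primitive ha) (hf.integrable_primitive hb)) hi1,
    ← Real.norm_eq_abs, ← hWn, mul_assoc]
  refine (norm_integral_le_of_norm_le (hi2.const_mul Cf') (Eventually.of_forall fun x => ?_)).trans
    (by rw [integral_const_mul]; exact mul_le_mul_of_nonneg_left e2 hf.Cf'_pos.le)
  rw [Real.norm_eq_abs, ← mul_assoc]
  exact abs_primitive_sub_le hf.contDiff hf.Cf'_pos.le hf.p_nonneg hf.abs_deriv_le _ _

/-- The Taylor remainder is a quantity tending to zero times ‖u(s) - u(t)‖ = O(|s - t|).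
Differentiability of u is thus needed in L² only, although f grows superlinearly. -/
lemma IsSource.hasDerivAt_integral_primitive (hf : IsSource n σ f p Cf' Cf cf) {u : ℝ → H Ω}
    {v : H Ω} {t : ℝ} (hmem : ∀ᶠ s in 𝓝 t, u s ∈ lpSpace Ω p) (hu : HasDerivAt u v t)
    (hw : Tendsto (fun s => weightedDist (volume.restrict (Ω : Set (E n))) p (u s) (u t)) (𝓝 t)
      (𝓝 0)) :
    HasDerivAt (fun s => ∫ x in (Ω : Set (E n)), primitive f (u s x)) ⟪superpose Ω f (u t), v⟫
      t := by
  have h1 : HasDerivAt (fun s => ⟪superpose Ω f (u t), u s⟫) ⟪superpose Ω f (u t), v⟫ t := by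
    simpa using (hasDerivAt_const t (superpose Ω f (u t))).inner ℝ hu
  have h0 : HasDerivAt (fun s => (∫ x in (Ω : Set (E n)), primitive f (u s x)) -
      ⟪superpose Ω f (u t), u s⟫) 0 t := by
    rw [hasDerivAt_iff_isLittleO]
    simp only [smul_zero, sub_zero]
    have hO := hu.isBigO_sub
    have ho : (fun s => Cf' * (weightedDist (volume.restrict (Ω : Set (E n))) p (u s)
        (u t)).toReal * ‖u s - u t‖) =o[𝓝 t] fun s => s - t := by
      have hto : Tendsto (fun s => Cf' * (weightedDist (volume.restrict (Ω : Set (E n))) p (u s)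
          (u t)).toReal) (𝓝 t) (𝓝 0) := by
        simpa using ((ENNReal.tendsto_toReal ENNReal.zero_ne_top).comp hw).const_mul Cf'
      have := ((Asymptotics.isLittleO_one_iff ℝ).2 hto).mul_isBigO hO.norm_left
      simpa using this
    refine Asymptotics.IsBigO.trans_isLittleO (Asymptotics.IsBigO.of_bound 1 ?_) ho
    filter_upwards [hmem] with s hs
    rw [one_mul]
    refine le_trans (le_of_eq ?_) ((hf.abs_integral_primitive_sub_le hs hmem.self_of_nhds).trans
      (le_abs_self _))
    rw [Real.norm_eq_abs, inner_sub_right]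
    congr 1
    ring
  have := h0.add h1
  rw [zero_add] at this
  exact this.congr_of_eventuallyEq (Eventually.of_forall fun s => by simp)

lemma IsSource.continuousWithinAt_superpose (hf : IsSource n σ f p Cf' Cf cf) {u : ℝ → H Ω}
    {S : Set ℝ} {t : ℝ} (hmem : ∀ s ∈ S, u s ∈ lpSpace Ω p) (ht : t ∈ S)
    (hw : Tendsto (fun s => weightedDist (volume.restrict (Ω : Set (E n))) p (u s) (u t))
      (𝓝[S] t) (𝓝 0)) :
    ContinuousWithinAt (fun s => superpose Ω f (u s)) S t := by
  rw [ContinuousWithinAt, tendsto_iff_norm_sub_tendsto_zero]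
  have hto : Tendsto (fun s => Cf' * (weightedDist (volume.restrict (Ω : Set (E n))) p (u s)
      (u t)).toReal) (𝓝[S] t) (𝓝 0) := by
    simpa using ((ENNReal.tendsto_toReal ENNReal.zero_ne_top).comp hw).const_mul Cf'
  refine squeeze_zero' (Eventually.of_forall fun _ => norm_nonneg _) ?_ hto
  filter_upwards [self_mem_nhdsWithin] with s hs
  exact hf.norm_superpose_sub_le (hmem s hs) (hmem t ht)

lemma IsSource.continuousWithinAt_integral_primitive (hf : IsSource n σ f p Cf' Cf cf)
    {u : ℝ → H Ω} {S : Set ℝ} {t : ℝ} (hmem : ∀ s ∈ S, u s ∈ lpSpace Ω p) (ht : t ∈ S)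
    (hu : ContinuousWithinAt u S t)
    (hw : Tendsto (fun s => weightedDist (volume.restrict (Ω : Set (E n))) p (u s) (u t))
      (𝓝[S] t) (𝓝 0)) :
    ContinuousWithinAt (fun s => ∫ x in (Ω : Set (E n)), primitive f (u s x)) S t := by
  have hsub : Tendsto (fun s => u s - u t) (𝓝[S] t) (𝓝 0) := by
    simpa using Tendsto.sub_const hu (u t)
  have h1 : Tendsto (fun s => Cf' * (weightedDist (volume.restrict (Ω : Set (E n))) p (u s)
      (u t)).toReal * ‖u s - u t‖) (𝓝[S] t) (𝓝 0) := by
    simpa using (((ENNReal.tendsto_toReal ENNReal.zero_ne_top).comp hw).const_mul Cf').mul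
      hsub.norm
  have h2 : Tendsto (fun s => (∫ x in (Ω : Set (E n)), primitive f (u s x)) -
      (∫ x in (Ω : Set (E n)), primitive f (u t x)) - ⟪superpose Ω f (u t), u s - u t⟫)
      (𝓝[S] t) (𝓝 0) := by
    refine squeeze_zero_norm' ?_ h1
    filter_upwards [self_mem_nhdsWithin] with s hs
    exact hf.abs_integral_primitive_sub_le (hmem s hs) (hmem t ht)
  have h3 : Tendsto (fun s => ⟪superpose Ω f (u t), u s - u t⟫) (𝓝[S] t) (𝓝 0) := by
    simpa using (tendsto_const_nhds (x := superpose Ω f (u t))).inner (𝕜 := ℝ) hsub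
  have h4 := (h2.add h3).add_const (∫ x in (Ω : Set (E n)), primitive f (u t x))
  simp only [add_zero, zero_add, sub_add_cancel] at h4
  exact h4

end

/-! ### The energy identity for second order equations -/

section
variable {X : Type*} [NormedAddCommGroup X] [InnerProductSpace ℝ X]

/-- A product rule for v that is merely continuous and differentiable against the single vector
d(t): in (v(s), d(s)) = (v(s), d(t)) + (v(s), d(s) - d(t)) the second term needs only continuity of
v. -/
lemma HasDerivAt.inner_of_inner_const {v d : ℝ → X} {d' : X} {m t : ℝ} (hv : ContinuousAt v t)
    (hd : HasDerivAt d d' t) (hm : HasDerivAt (fun s => ⟪v s, d t⟫) m t) :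
    HasDerivAt (fun s => ⟪v s, d s⟫) (m + ⟪v t, d'⟫) t := by
  have h1 : HasDerivAt (fun s => ⟪v s, d s - d t⟫) ⟪v t, d'⟫ t := by
    rw [hasDerivAt_iff_tendsto_slope]
    have h2 := (hv.mono_left nhdsWithin_le_nhds).inner (𝕜 := ℝ) (hasDerivAt_iff_tendsto_slope.1 hd)
    refine h2.congr fun s => ?_
    simp [slope_def_module, inner_smul_right]
  refine (hm.add h1).congr_of_eventuallyEq (Eventually.of_forall fun s => ?_)
  simp [inner_sub_right]

lemma tendsto_average_left {F : ℝ → ℝ → ℝ} (hF : Continuous fun z : ℝ × ℝ => F z.1 z.2) (b : ℝ) :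
    Tendsto (fun h => h⁻¹ * ∫ t in (b - h)..b, F h t) (𝓝[>] 0) (𝓝 (F 0 b)) := by
  rw [Metric.tendsto_nhds]
  intro ε hε
  have hc := Metric.continuousAt_iff.1 (hF.continuousAt (x := (0, b))) (ε / 2) (half_pos hε)
  obtain ⟨δ, hδ, hd⟩ := hc
  filter_upwards [Ioo_mem_nhdsGT hδ] with h hh
  have hh0 : 0 < h := hh.1
  have hFh : Continuous (F h) := hF.comp (by fun_prop : Continuous fun t : ℝ => (h, t))
  have hbound : ‖∫ t in (b - h)..b, (F h t - F 0 b)‖ ≤ ε / 2 * |b - (b - h)| := by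
    refine intervalIntegral.norm_integral_le_of_norm_le_const fun t ht => ?_
    rw [uIoc_of_le (by linarith)] at ht
    refine (hd (x := (h, t)) ?_).le
    rw [Prod.dist_eq, Real.dist_eq, Real.dist_eq, max_lt_iff, abs_lt, abs_lt]
    exact ⟨⟨by linarith, by linarith [hh.2]⟩, by linarith [hh.2, ht.1], by linarith [ht.2]⟩
  rw [intervalIntegral.integral_sub (hFh.intervalIntegrable _ _) (by simp),
    intervalIntegral.integral_const, sub_sub_cancel, abs_of_pos hh0, Real.norm_eq_abs,
    smul_eq_mul] at hbound
  have e : h⁻¹ * (∫ t in (b - h)..b, F h t) - F 0 b =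
      h⁻¹ * ((∫ t in (b - h)..b, F h t) - h * F 0 b) := by field_simp
  rw [Real.dist_eq, e, abs_mul, abs_of_pos (inv_pos.2 hh0)]
  calc _ ≤ h⁻¹ * (ε / 2 * h) := by gcongr
    _ = ε / 2 := by field_simp
    _ < ε := half_lt_self hε

lemma integral_sub_comp_sub {m : ℝ → ℝ} (hm : Continuous m) (a b h : ℝ) :
    ∫ t in a..b, (m t - m (t - h)) = (∫ t in (b - h)..b, m t) - ∫ t in (a - h)..a, m t := by
  have hi : ∀ x y, IntervalIntegrable m volume x y := fun x y => hm.intervalIntegrable x y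
  rw [intervalIntegral.integral_sub (hi _ _)
    ((by fun_prop : Continuous fun t => m (t - h)).intervalIntegrable _ _),
    intervalIntegral.integral_comp_sub_right,
    ← intervalIntegral.integral_add_adjacent_intervals (hi a (b - h)) (hi (b - h) b),
    ← intervalIntegral.integral_add_adjacent_intervals (hi (a - h) a) (hi a (b - h))]
  ring

/-- The symmetric difference quotient. -/
def symmQuot (u : ℝ → X) (h t : ℝ) : X := (2 * h)⁻¹ • (u (t + h) - u (t - h))

lemma hasDerivAt_symmQuot {u v : ℝ → X} (hu : ∀ t, 0 < t → HasDerivAt u (v t) t) {h t : ℝ}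
    (hh : 0 < h) (ht : h < t) : HasDerivAt (symmQuot u h) (symmQuot v h t) t := by
  have h1 := (hu (t + h) (by linarith)).comp_add_const t h
  have h2 := (hu (t - h) (by linarith)).comp_sub_const t h
  exact (h1.sub h2).const_smul _

lemma tendsto_symmQuot {u : ℝ → X} {v : X} {t : ℝ} (hu : HasDerivAt u v t) :
    Tendsto (fun h => symmQuot u h t) (𝓝[>] 0) (𝓝 v) := by
  have h1 : HasDerivAt (fun h => u (t + h)) v 0 := by
    have : HasDerivAt u v (t + 0) := by simpa using hu
    simpa using this.comp_const_add t 0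
  have h2 : HasDerivAt (fun h => u (t - h)) (-v) 0 := by
    have : HasDerivAt u v (t - 0) := by simpa using hu
    simpa using this.comp_const_sub t 0
  have h3 := (hasDerivAt_iff_tendsto_slope.1 (h1.sub h2)).mono_left
    (nhdsWithin_mono 0 (fun x (hx : 0 < x) => hx.ne' : Ioi (0 : ℝ) ⊆ {0}ᶜ))
  have h4 := h3.const_smul (2⁻¹ : ℝ)
  rw [sub_neg_eq_add, ← two_smul ℝ v, inv_smul_smul₀ two_ne_zero] at h4
  refine h4.congr fun h => ?_
  simp [slope_def_module, symmQuot, smul_smul, mul_comm]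

lemma norm_symmQuot_le {u v : ℝ → X} (hu : ∀ t, 0 < t → HasDerivAt u (v t) t) {h t M b : ℝ}
    (hM : ∀ s ∈ Icc 0 b, ‖v s‖ ≤ M) (hh : 0 < h) (ht : h < t) (htb : t + h ≤ b) :
    ‖symmQuot u h t‖ ≤ M := by
  have h1 := Convex.norm_image_sub_le_of_norm_hasDerivWithin_le (𝕜 := ℝ) (f := u) (f' := v)
    (s := Icc (t - h) (t + h)) (C := M) (x := t - h) (y := t + h)
    (fun x hx => (hu x (by linarith [hx.1])).hasDerivWithinAt)
    (fun x hx => hM x ⟨by linarith [hx.1], by linarith [hx.2]⟩) (convex_Icc _ _)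
    ⟨le_rfl, by linarith⟩ ⟨by linarith, le_rfl⟩
  rw [symmQuot, norm_smul, Real.norm_of_nonneg (by positivity)]
  have e : t + h - (t - h) = 2 * h := by ring
  rw [e, Real.norm_of_nonneg (by positivity)] at h1
  calc _ ≤ (2 * h)⁻¹ * (M * (2 * h)) := by gcongr
    _ = M := by field_simp

/-- With m(t) = (v(t), v(t+h)) the integrand is (m(t) - m(t-h))/2h, so the integral telescopes to
averages near the end points. The symmetry of the quotient is essential, and no derivative of v is
used. -/
lemma integral_inner_symmQuot {v : ℝ → X} (hv : Continuous v) (a b h : ℝ) :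
    ∫ t in a..b, ⟪v t, symmQuot v h t⟫ = 2⁻¹ * (h⁻¹ * ∫ t in (b - h)..b, ⟪v t, v (t + h)⟫) -
      2⁻¹ * (h⁻¹ * ∫ t in (a - h)..a, ⟪v t, v (t + h)⟫) := by
  have hm : Continuous fun t => ⟪v t, v (t + h)⟫ := by fun_prop
  have e := integral_sub_comp_sub hm a b h
  rw [← mul_sub, ← mul_sub, ← e, ← mul_assoc, ← mul_inv, ← intervalIntegral.integral_const_mul]
  refine intervalIntegral.integral_congr fun t _ => ?_
  simp only [symmQuot, inner_smul_right, inner_sub_right, sub_add_cancel]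
  rw [real_inner_comm (v t) (v (t - h))]

lemma tendsto_integral_inner_symmQuot {v : ℝ → X} (hv : Continuous v) (a b : ℝ) :
    Tendsto (fun h => ∫ t in a..b, ⟪v t, symmQuot v h t⟫) (𝓝[>] 0)
      (𝓝 (2⁻¹ * ‖v b‖ ^ 2 - 2⁻¹ * ‖v a‖ ^ 2)) := by
  simp only [integral_inner_symmQuot hv]
  have hF : Continuous fun z : ℝ × ℝ => ⟪v z.2, v (z.2 + z.1)⟫ := by fun_prop
  have h1 := tendsto_average_left (F := fun h t => ⟪v t, v (t + h)⟫) hF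
  simp only [add_zero, real_inner_self_eq_norm_sq] at h1
  exact ((h1 b).const_mul _).sub ((h1 a).const_mul _)

/-- Integrated energy identity for `u'' + A*A u = g`, where `u` takes values in `W`. -/
lemma energy_sub_eq_integral {W : Set X} {A : X → X}
    (hW : ∀ (c : ℝ) {x y : X}, x ∈ W → y ∈ W → c • (x - y) ∈ W ∧ A (c • (x - y)) = c • (A x - A y))
    {u v g : ℝ → X} (huW : ∀ t, u t ∈ W) (hA : Continuous fun t => A (u t)) (huc : Continuous u)
    (hv : Continuous v) (hg : Continuous g) (hu : ∀ t, 0 < t → HasDerivAt u (v t) t)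
    (heq : ∀ w ∈ W, ∀ t, 0 < t →
      HasDerivAt (fun s => ⟪v s, w⟫) (-⟪A (u t), A w⟫ + ⟪g t, w⟫) t)
    {a b : ℝ} (ha : 0 < a) (hab : a ≤ b) :
    (2⁻¹ * ‖v b‖ ^ 2 + 2⁻¹ * ‖A (u b)‖ ^ 2) - (2⁻¹ * ‖v a‖ ^ 2 + 2⁻¹ * ‖A (u a)‖ ^ 2) =
      ∫ t in a..b, ⟪g t, v t⟫ := by
  have hsW : ∀ h t, symmQuot u h t ∈ W := fun h t => (hW _ (huW _) (huW _)).1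
  have hsA : ∀ h t, A (symmQuot u h t) = symmQuot (fun t => A (u t)) h t :=
    fun h t => (hW _ (huW _) (huW _)).2
  have hcs : ∀ {w : ℝ → X}, Continuous w → ∀ h, Continuous (symmQuot w h) := by
    intro w hw h; unfold symmQuot; fun_prop
  -- The equation is tested with the symmetric quotient of u in place of v, which need not lie in W;
  -- the restriction h < t keeps u differentiable at t - h.
  have hder : ∀ h t, 0 < h → h < t → HasDerivAt (fun s => ⟪v s, symmQuot u h s⟫)
      (-⟪A (u t), symmQuot (fun t => A (u t)) h t⟫ + ⟪g t, symmQuot u h t⟫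
        + ⟪v t, symmQuot v h t⟫) t := by
    intro h t hh ht
    have h1 := heq _ (hsW h t) t (hh.trans ht)
    rw [hsA] at h1
    exact HasDerivAt.inner_of_inner_const hv.continuousAt (hasDerivAt_symmQuot hu hh ht) h1
  have hint : ∀ h, 0 < h → h < a → ⟪v b, symmQuot u h b⟫ - ⟪v a, symmQuot u h a⟫ =
      -(∫ t in a..b, ⟪A (u t), symmQuot (fun t => A (u t)) h t⟫) +
      (∫ t in a..b, ⟪g t, symmQuot u h t⟫) + ∫ t in a..b, ⟪v t, symmQuot v h t⟫ := by
    intro h hh hha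
    have hsv := hcs hv h
    have hsu := hcs huc h
    have hsAu := hcs hA h
    have i1 : Continuous fun t => ⟪A (u t), symmQuot (fun t => A (u t)) h t⟫ := hA.inner hsAu
    have i2 : Continuous fun t => ⟪g t, symmQuot u h t⟫ := hg.inner hsu
    have i3 : Continuous fun t => ⟪v t, symmQuot v h t⟫ := hv.inner hsv
    have i4 : Continuous fun t => -⟪A (u t), symmQuot (fun t => A (u t)) h t⟫ := i1.neg
    have i12 : Continuous fun t => -⟪A (u t), symmQuot (fun t => A (u t)) h t⟫ +
      ⟪g t, symmQuot u h t⟫ := i4.add i2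
    rw [← intervalIntegral.integral_eq_sub_of_hasDerivAt (fun t ht => hder h t hh ?_)
      ((i12.add i3).intervalIntegrable _ _),
      intervalIntegral.integral_add (i12.intervalIntegrable _ _) (i3.intervalIntegrable _ _),
      intervalIntegral.integral_add (i4.intervalIntegrable _ _) (i2.intervalIntegrable _ _),
      intervalIntegral.integral_neg]
    rw [uIcc_of_le hab] at ht
    exact hha.trans_le ht.1
  obtain ⟨M, hM⟩ := (isCompact_Icc (a := (0 : ℝ)) (b := b + 1)).exists_bound_of_continuousOn
    hv.continuousOn
  have hlim : Tendsto (fun h => ∫ t in a..b, ⟪g t, symmQuot u h t⟫) (𝓝[>] 0)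
      (𝓝 (∫ t in a..b, ⟪g t, v t⟫)) := by
    refine intervalIntegral.tendsto_integral_filter_of_dominated_convergence
      (fun t => ‖g t‖ * M) ?_ ?_ ?_ ?_
    · exact Eventually.of_forall fun h => (hg.inner (hcs huc h)).aestronglyMeasurable
    · filter_upwards [Ioo_mem_nhdsGT (lt_min ha one_pos)] with h hh
      refine Eventually.of_forall fun t ht => ?_
      rw [uIoc_of_le hab] at ht
      refine (norm_inner_le_norm _ _).trans (mul_le_mul_of_nonneg_left ?_ (norm_nonneg _))
      have h1 := lt_min_iff.1 hh.2
      exact norm_symmQuot_le hu hM hh.1 (h1.1.trans ht.1) (by linarith [ht.2, h1.2])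
    · exact (hg.norm.mul continuous_const).intervalIntegrable _ _
    · refine Eventually.of_forall fun t ht => ?_
      rw [uIoc_of_le hab] at ht
      exact tendsto_const_nhds.inner (𝕜 := ℝ) (tendsto_symmQuot (hu t (ha.trans ht.1)))
  have hleft : Tendsto (fun h => ⟪v b, symmQuot u h b⟫ - ⟪v a, symmQuot u h a⟫) (𝓝[>] 0)
      (𝓝 (⟪v b, v b⟫ - ⟪v a, v a⟫)) :=
    (tendsto_const_nhds.inner (𝕜 := ℝ) (tendsto_symmQuot (hu b (ha.trans_le hab)))).sub
      (tendsto_const_nhds.inner (𝕜 := ℝ) (tendsto_symmQuot (hu a ha)))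
  have hright := ((tendsto_integral_inner_symmQuot hA a b).neg.add hlim).add
    (tendsto_integral_inner_symmQuot hv a b)
  have hev : ∀ᶠ h in 𝓝[>] (0 : ℝ), ⟪v b, symmQuot u h b⟫ - ⟪v a, symmQuot u h a⟫ =
      -(∫ t in a..b, ⟪A (u t), symmQuot (fun t => A (u t)) h t⟫) +
      (∫ t in a..b, ⟪g t, symmQuot u h t⟫) + ∫ t in a..b, ⟪v t, symmQuot v h t⟫ := by
    filter_upwards [Ioo_mem_nhdsGT ha] with h hh
    exact hint h hh.1 hh.2
  have := tendsto_nhds_unique (hleft.congr' hev) hright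
  simp only [real_inner_self_eq_norm_sq] at this
  linarith

/-- The integrated identity is differentiated in its upper limit, the integrand being continuous. -/
lemma hasDerivAt_energy {W : Set X} {A : X → X}
    (hW : ∀ (c : ℝ) {x y : X}, x ∈ W → y ∈ W → c • (x - y) ∈ W ∧ A (c • (x - y)) = c • (A x - A y))
    {u v g : ℝ → X} (huW : ∀ t, 0 ≤ t → u t ∈ W) (hA : ContinuousOn (fun t => A (u t)) (Ici 0))
    (huc : ContinuousOn u (Ici 0)) (hv : ContinuousOn v (Ici 0)) (hg : ContinuousOn g (Ici 0))
    (hu : ∀ t, 0 < t → HasDerivAt u (v t) t)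
    (heq : ∀ w ∈ W, ∀ t, 0 < t →
      HasDerivAt (fun s => ⟪v s, w⟫) (-⟪A (u t), A w⟫ + ⟪g t, w⟫) t) {t : ℝ} (ht : 0 < t) :
    HasDerivAt (fun s => 2⁻¹ * ‖v s‖ ^ 2 + 2⁻¹ * ‖A (u s)‖ ^ 2) ⟪g t, v t⟫ t := by
  -- All functions are continued to negative times by their value at 0, because the integrated
  -- identity is stated for functions continuous on the whole line.
  have hext : ∀ {w : ℝ → X}, ContinuousOn w (Ici 0) → Continuous fun s => w (max s 0) :=
    fun hw => hw.comp_continuous (by fun_prop) fun s => mem_Ici.2 (le_max_right _ _)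
  have hmax : ∀ {s : ℝ}, 0 < s → max s 0 = s := fun hs => max_eq_left hs.le
  have hevm : ∀ {s : ℝ}, 0 < s → ∀ᶠ r in 𝓝 s, max r 0 = r := fun hs =>
    (lt_mem_nhds hs).mono fun r hr => hmax hr
  have key := fun {b : ℝ} (hab : t / 2 ≤ b) => energy_sub_eq_integral hW
    (u := fun s => u (max s 0)) (v := fun s => v (max s 0)) (g := fun s => g (max s 0))
    (fun s => huW _ (le_max_right _ _)) (hext hA) (hext huc) (hext hv) (hext hg)
    (fun s hs => by
      simp only [hmax hs]
      exact (hu s hs).congr_of_eventuallyEq ((hevm hs).mono fun r hr => by simp only [hr]))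
    (fun w hw s hs => by
      simp only [hmax hs]
      exact (heq w hw s hs).congr_of_eventuallyEq ((hevm hs).mono fun r hr => by simp only [hr]))
    (half_pos ht) hab
  have hc : Continuous fun s => ⟪g (max s 0), v (max s 0)⟫ := (hext hg).inner (hext hv)
  have hd : HasDerivAt (fun b => ∫ s in (t / 2)..b, ⟪g (max s 0), v (max s 0)⟫)
      ⟪g (max t 0), v (max t 0)⟫ t := by
    exact intervalIntegral.integral_hasDerivAt_right (hc.intervalIntegrable _ _)
      (hc.stronglyMeasurableAtFilter _ _) hc.continuousAt
  rw [hmax ht] at hd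
  refine (hd.add_const (2⁻¹ * ‖v (t / 2)‖ ^ 2 + 2⁻¹ * ‖A (u (t / 2))‖ ^ 2)).congr_of_eventuallyEq ?_
  filter_upwards [lt_mem_nhds (half_lt_self ht)] with b hb
  have := key hb.le
  rw [hmax (half_pos ht), hmax ((half_pos ht).trans hb)] at this
  rw [← this]
  ring

/-- Symmetry moves A onto the fixed vector u(t), so A(u) need only be continuous in time. -/
lemma hasDerivAt_inner_symm {A : X → X} {u : ℝ → X} {v : X} {t : ℝ}
    (hsymm : ∀ᶠ s in 𝓝 t, ⟪A (u s), u t⟫ = ⟪u s, A (u t)⟫)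
    (hA : ContinuousAt (fun s => A (u s)) t) (hu : HasDerivAt u v t) :
    HasDerivAt (fun s => ⟪A (u s), u s⟫) (2 * ⟪A (u t), v⟫) t := by
  have h1 : HasDerivAt (fun s => ⟪A (u s), u t⟫) ⟪A (u t), v⟫ t := by
    have : HasDerivAt (fun s => ⟪u s, A (u t)⟫) ⟪v, A (u t)⟫ t := by
      simpa using hu.inner ℝ (hasDerivAt_const t (A (u t)))
    rw [real_inner_comm]
    exact this.congr_of_eventuallyEq hsymm
  rw [two_mul]
  exact HasDerivAt.inner_of_inner_const hA hu h1

end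

/-! ### A priori bounds for the energy -/

section
variable {n : ℕ} {Ω : Opens (E n)} {bc : BoundaryCondition} {α q γ κ p Cf' Cf cf : ℝ} {f : ℝ → ℝ}

lemma domA_subset_lpSpace (hn : 1 ≤ n) (hb : Bornology.IsBounded (Ω : Set (E n)))
    {p : ℝ} (hp : 0 ≤ p) (hpn : 5 ≤ n → p ≤ 4 / ((n : ℝ) - 4)) {u : H Ω} (hu : u ∈ domA Ω) :
    u ∈ lpSpace Ω p := by
  obtain ⟨C, hC⟩ := exists_eLpNorm_le_norm_opA hn hb hp hpn
  exact ⟨Lp.aestronglyMeasurable u, (hC u hu).trans_lt (by finiteness)⟩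

lemma tendsto_weightedDist_of_continuousWithinAt (hn : 1 ≤ n)
    (hb : Bornology.IsBounded (Ω : Set (E n)))
    {p : ℝ} (hp : 0 ≤ p) (hpn : 5 ≤ n → p ≤ 4 / ((n : ℝ) - 4)) {S : Set ℝ} {u : ℝ → H Ω} {t : ℝ}
    (hmem : ∀ s, u s ∈ domA Ω) (hu : ContinuousWithinAt u S t)
    (hA : ContinuousWithinAt (fun s => opA Ω (u s)) S t) :
    Tendsto (fun s => weightedDist (volume.restrict (Ω : Set (E n))) p (u s) (u t)) (𝓝[S] t)
      (𝓝 0) := by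
  obtain ⟨C, hC⟩ := exists_eLpNorm_le_norm_opA hn hb hp hpn
  have hsub : ∀ s (r : ℝ≥0∞), eLpNorm (u s - u t : E n → ℝ) r (volume.restrict (Ω : Set (E n))) =
      eLpNorm (u s - u t : H Ω) r (volume.restrict (Ω : Set (E n))) := fun s r =>
    eLpNorm_congr_ae (Lp.coeFn_sub (u s) (u t)).symm
  refine tendsto_weightedDist hp (fun s => Lp.aestronglyMeasurable _)
    (domA_subset_lpSpace hn hb hp hpn (hmem t)) ?_ ?_
  · have h1 : Tendsto (fun s => ‖u s - u t‖ₑ) (𝓝[S] t) (𝓝 0) := by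
      simpa using (Tendsto.sub_const hu (u t)).enorm
    refine h1.congr fun s => ?_
    rw [hsub, Lp.enorm_def]
  · have h1 : Tendsto (fun s => C * ‖opA Ω (u s) - opA Ω (u t)‖ₑ) (𝓝[S] t) (𝓝 0) := by
      have h2 : Tendsto (fun s => ‖opA Ω (u s) - opA Ω (u t)‖ₑ) (𝓝[S] t) (𝓝 0) := by
        simpa using (Tendsto.sub_const hA (opA Ω (u t))).enorm
      simpa using ENNReal.Tendsto.const_mul h2 (Or.inr ENNReal.coe_ne_top)
    refine tendsto_of_tendsto_of_tendsto_of_le_of_le tendsto_const_nhds h1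
      (fun _ => zero_le) fun s => ?_
    obtain ⟨h3, h4⟩ := opA_sub hn hb (hmem s) (hmem t)
    change eLpNorm (u s - u t : E n → ℝ) _ _ ≤ _
    rw [hsub, ← h4]
    exact hC _ h3

lemma inner_opA_symm (hn : 1 ≤ n) (hb : Bornology.IsBounded (Ω : Set (E n))) {u w : H Ω}
    (hu : u ∈ domA Ω) (hw : w ∈ domA Ω) : ⟪opA Ω u, w⟫ = ⟪u, opA Ω w⟫ := by
  obtain ⟨g, rfl⟩ := (mem_domA_iff hn hb).1 hu
  obtain ⟨h, rfl⟩ := (mem_domA_iff hn hb).1 hw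
  rw [opA_solG hn hb, opA_solG hn hb, solG_inner]

lemma norm_sq_eq_integral (u : H Ω) : ‖u‖ ^ 2 = ∫ x in (Ω : Set (E n)), u x ^ 2 := by
  rw [← real_inner_self_eq_norm_sq, L2.inner_def]
  exact integral_congr_ae (Eventually.of_forall fun x => by simp [sq])

lemma integrable_sq (u : H Ω) : Integrable (fun x => u x ^ 2) (volume.restrict (Ω : Set (E n))) :=
  (Lp.memLp u).integrable_sq

lemma IsSource.le_integral_primitive {σ : ℝ} (hf : IsSource n σ f p Cf' Cf cf)
    (hb : Bornology.IsBounded (Ω : Set (E n))) {u : H Ω} (hu : u ∈ lpSpace Ω p) :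
    -(Cf * (volume (Ω : Set (E n))).toReal) - cf / 2 * ‖u‖ ^ 2 ≤
      ∫ x in (Ω : Set (E n)), primitive f (u x) := by
  have := isFiniteMeasure_restrict hb
  have h1 : ∫ x in (Ω : Set (E n)), (-Cf - cf / 2 * u x ^ 2) =
      -(Cf * (volume (Ω : Set (E n))).toReal) - cf / 2 * ‖u‖ ^ 2 := by
    rw [integral_sub (integrable_const _) ((integrable_sq u).const_mul _), integral_const_mul,
      ← norm_sq_eq_integral]
    simp [measureReal_def, mul_comm]
  rw [← h1]
  exact integral_mono ((integrable_const _).sub ((integrable_sq u).const_mul _))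
    (hf.integrable_primitive hu) fun x => hf.le_primitive _

lemma IsSource.integral_primitive_le {σ : ℝ} (hf : IsSource n σ f p Cf' Cf cf)
    {u : H Ω} (hu : u ∈ lpSpace Ω p) :
    ∫ x in (Ω : Set (E n)), primitive f (u x) ≤ ⟪superpose Ω f u, u⟫ + cf / 2 * ‖u‖ ^ 2 := by
  have hi : Integrable (fun x => f (u x) * u x) (volume.restrict (Ω : Set (E n))) :=
    (hf.memLp hu).integrable_mul (Lp.memLp u)
  rw [hf.inner_superpose hu, norm_sq_eq_integral, ← integral_const_mul,
    ← integral_add hi ((integrable_sq u).const_mul _)]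
  exact integral_mono (hf.integrable_primitive hu) (hi.add ((integrable_sq u).const_mul _))
    fun x => hf.primitive_le _

/-- The source costs C_f|Ω| and (c_f/2)‖u‖² ≤ ((1 - ω)/2)‖Au‖²; Young's inequality bounds (h_λ, u)
by ‖h_λ‖²/(σ₁ω) plus (ω/4)‖Au‖². The constant K_λ compensates exactly for the terms without u, and
ω/4 of ‖Au‖² is left. -/
lemma le_modEnergy (hn : 1 ≤ n) (hb : Bornology.IsBounded (Ω : Set (E n)))
    (hf : IsSource n (sigmaOne bc Ω) f p Cf' Cf cf) (hκ : 0 ≤ κ) {hl u v : H Ω}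
    (hu : u ∈ energySpace bc Ω) :
    1 / 2 * ‖v‖ ^ 2 + omega bc Ω cf / 4 * ‖opA Ω u‖ ^ 2 ≤ modEnergy bc Ω κ f Cf cf hl u v := by
  have hd := energySpace_subset_domA hn hb hu
  have h1 := hf.le_integral_primitive hb
    (domA_subset_lpSpace hn hb hf.p_nonneg hf.p_le hd)
  have h2 := sigmaOne_mul_norm_sq_le hn hb hu
  have h3 := mul_nonneg hκ (fracNormSq_nonneg hn hb (1 / 2) u)
  have hσ : 0 < sigmaOne bc Ω := hf.cf_nonneg.trans_lt hf.cf_lt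
  have hω : sigmaOne bc Ω * omega bc Ω cf = sigmaOne bc Ω - cf := by
    rw [omega]; field_simp
  have hω0 : 0 < sigmaOne bc Ω * omega bc Ω cf := by rw [hω]; linarith [hf.cf_lt]
  have hω1 : 0 < omega bc Ω cf := pos_of_mul_pos_right hω0 hσ.le
  have h4 := real_inner_le_norm hl u
  have h5 : ‖hl‖ * ‖u‖ ≤ 1 / (sigmaOne bc Ω * omega bc Ω cf) * ‖hl‖ ^ 2 +
      sigmaOne bc Ω * omega bc Ω cf / 4 * ‖u‖ ^ 2 := by
    have h6 := sq_nonneg (‖hl‖ - sigmaOne bc Ω * omega bc Ω cf / 2 * ‖u‖)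
    have h7 := div_nonneg h6 hω0.le
    have e : (‖hl‖ - sigmaOne bc Ω * omega bc Ω cf / 2 * ‖u‖) ^ 2 /
        (sigmaOne bc Ω * omega bc Ω cf) = 1 / (sigmaOne bc Ω * omega bc Ω cf) * ‖hl‖ ^ 2 +
        sigmaOne bc Ω * omega bc Ω cf / 4 * ‖u‖ ^ 2 - ‖hl‖ * ‖u‖ := by
      field_simp; ring
    linarith
  have h8 := mul_le_mul_of_nonneg_left h2 hω1.le
  have h9 : cf * ‖u‖ ^ 2 = sigmaOne bc Ω * ‖u‖ ^ 2 -
      omega bc Ω cf * (sigmaOne bc Ω * ‖u‖ ^ 2) := by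
    have : cf = sigmaOne bc Ω - sigmaOne bc Ω * omega bc Ω cf := by rw [hω]; ring
    nth_rewrite 1 [this]; ring
  have h10 : cf * ‖u‖ ^ 2 ≤ (1 - omega bc Ω cf) * ‖opA Ω u‖ ^ 2 := by
    have h11 : 1 - omega bc Ω cf = cf / sigmaOne bc Ω := by rw [omega]; ring
    rw [h11]
    calc cf * ‖u‖ ^ 2 = cf / sigmaOne bc Ω * (sigmaOne bc Ω * ‖u‖ ^ 2) := by field_simp
      _ ≤ _ := mul_le_mul_of_nonneg_left h2 (div_nonneg hf.cf_nonneg hσ.le)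
  rw [modEnergy, energy, Kconst]
  nlinarith

lemma Kconst_nonneg {σ : ℝ} (hσ : σ = sigmaOne bc Ω) (hf : IsSource n σ f p Cf' Cf cf) (hl : H Ω) :
    0 ≤ Kconst bc Ω Cf cf hl := by
  subst hσ
  have hσ : 0 < sigmaOne bc Ω := hf.cf_nonneg.trans_lt hf.cf_lt
  have hω : sigmaOne bc Ω * omega bc Ω cf = sigmaOne bc Ω - cf := by
    rw [omega]; field_simp
  have hω0 : 0 < sigmaOne bc Ω * omega bc Ω cf := by rw [hω]; linarith [hf.cf_lt]
  have := hf.Cf_nonneg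
  rw [Kconst]
  positivity

lemma modEnergy_zero (hn : 1 ≤ n)
    (hb : Bornology.IsBounded (Ω : Set (E n))) (hl : H Ω) :
    modEnergy bc Ω κ f Cf cf hl 0 0 = Kconst bc Ω Cf cf hl := by
  have hA : opA Ω (0 : H Ω) = 0 := by
    have := opA_solG hn hb (0 : H Ω)
    rwa [map_zero] at this
  have hd : (0 : H Ω) ∈ domA Ω := (mem_domA_iff hn hb).2 ⟨0, map_zero _⟩
  have hP : ∫ x in (Ω : Set (E n)), primitive f ((0 : H Ω) x) = 0 := by
    rw [← integral_zero (E n) ℝ (μ := volume.restrict (Ω : Set (E n)))]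
    refine integral_congr_ae ?_
    filter_upwards [Lp.coeFn_zero ℝ 2 (volume.restrict (Ω : Set (E n)))] with x hx
    rw [hx]
    simp [primitive]
  rw [modEnergy, energy, fracNormSq_half hn hb hd, hA, hP]
  simp

/-- The lower-order terms `hl - κ A u - γ (‖A^α u‖² + ‖v‖²)^q v - f(u)`. -/
def forcing (Ω : Opens (E n)) (α q γ κ : ℝ) (f : ℝ → ℝ) (hl u v : H Ω) : H Ω :=
  hl - κ • opA Ω u - (γ * (fracNormSq Ω α u + ‖v‖ ^ 2) ^ q) • v - superpose Ω f u

/-! ### Weak solutions: continuity, energy identity and the multiplier u -/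

section
variable {hl u₀ u₁ : H Ω} {u v : ℝ → H Ω}

lemma IsWeakSolution.mem_domA (hs : IsWeakSolution bc Ω α q γ κ f hl u₀ u₁ u v) (hn : 1 ≤ n)
    (hb : Bornology.IsBounded (Ω : Set (E n))) {t : ℝ} (ht : 0 ≤ t) : u t ∈ domA Ω :=
  energySpace_subset_domA hn hb (hs.mem_energySpace t ht)

lemma IsWeakSolution.tendsto_weightedDist (hs : IsWeakSolution bc Ω α q γ κ f hl u₀ u₁ u v)
    (hn : 1 ≤ n) (hb : Bornology.IsBounded (Ω : Set (E n))) {σ : ℝ}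
    (hf : IsSource n σ f p Cf' Cf cf) {t : ℝ} (ht : 0 ≤ t) :
    Tendsto (fun s => weightedDist (volume.restrict (Ω : Set (E n))) p (u s) (u t)) (𝓝[Ici 0] t)
      (𝓝 0) := by
  have h := tendsto_weightedDist_of_continuousWithinAt hn hb hf.p_nonneg hf.p_le
    (u := fun s => u (max s 0)) (S := Ici 0) (t := t)
    (fun s => hs.mem_domA hn hb (le_max_right _ _))
    ((hs.continuousOn_left_H t ht).congr (fun s hs' => by simp only [max_eq_left hs'.out])
      (by simp only [max_eq_left ht]))
    ((hs.continuousOn_left t ht).congr (fun s hs' => by simp only [max_eq_left hs'.out])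
      (by simp only [max_eq_left ht]))
  rw [max_eq_left ht] at h
  refine h.congr' ?_
  filter_upwards [self_mem_nhdsWithin] with s hs'
  rw [max_eq_left hs'.out]

lemma IsWeakSolution.continuousOn_damping (hs : IsWeakSolution bc Ω α q γ κ f hl u₀ u₁ u v)
    (hn : 1 ≤ n) (hb : Bornology.IsBounded (Ω : Set (E n))) (hα : α ∈ Icc (0 : ℝ) 1) :
    ContinuousOn (fun t => fracNormSq Ω α (u t) + ‖v t‖ ^ 2) (Ici 0) :=
  (continuousOn_fracNormSq hn hb hα (fun _ ht => hs.mem_domA hn hb ht) hs.continuousOn_left_H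
    hs.continuousOn_left).add (hs.continuousOn_right.norm.pow 2)

lemma IsWeakSolution.continuousOn_superpose (hs : IsWeakSolution bc Ω α q γ κ f hl u₀ u₁ u v)
    (hn : 1 ≤ n) (hb : Bornology.IsBounded (Ω : Set (E n))) {σ : ℝ}
    (hf : IsSource n σ f p Cf' Cf cf) : ContinuousOn (fun t => superpose Ω f (u t)) (Ici 0) :=
  fun _ ht => hf.continuousWithinAt_superpose (fun _ hs' =>
    domA_subset_lpSpace hn hb hf.p_nonneg hf.p_le (hs.mem_domA hn hb hs')) ht
    (hs.tendsto_weightedDist hn hb hf ht)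

lemma IsWeakSolution.continuousOn_forcing (hs : IsWeakSolution bc Ω α q γ κ f hl u₀ u₁ u v)
    (hn : 1 ≤ n) (hb : Bornology.IsBounded (Ω : Set (E n))) (hα : α ∈ Icc (0 : ℝ) 1) (hq : 0 ≤ q)
    {σ : ℝ} (hf : IsSource n σ f p Cf' Cf cf) :
    ContinuousOn (fun t => forcing Ω α q γ κ f hl (u t) (v t)) (Ici 0) :=
  ((continuousOn_const.sub (hs.continuousOn_left.const_smul κ)).sub
    ((continuousOn_const.mul ((hs.continuousOn_damping hn hb hα).rpow_const
      fun _ _ => Or.inr hq)).smul hs.continuousOn_right)).sub (hs.continuousOn_superpose hn hb hf)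

lemma IsWeakSolution.hasDerivAt_inner (hs : IsWeakSolution bc Ω α q γ κ f hl u₀ u₁ u v)
    (hn : 1 ≤ n) (hb : Bornology.IsBounded (Ω : Set (E n)))
    {σ : ℝ} (hf : IsSource n σ f p Cf' Cf cf) {w : H Ω} (hw : w ∈ energySpace bc Ω) {t : ℝ}
    (ht : 0 < t) : HasDerivAt (fun s => ⟪v s, w⟫)
      (-⟪opA Ω (u t), opA Ω w⟫ + ⟪forcing Ω α q γ κ f hl (u t) (v t), w⟫) t := by
  convert! hs.equation w hw t ht using 1
  have hm := domA_subset_lpSpace hn hb hf.p_nonneg hf.p_le (hs.mem_domA hn hb ht.le)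
  rw [forcing, inner_sub_left, inner_sub_left, inner_sub_left, real_inner_smul_left,
    real_inner_smul_left, hf.inner_superpose hm]
  ring

/-- The kinetic and bending energies change at the rate (g, u_t), where g collects all lower-order
terms; the remaining parts of the energy cancel the conservative forces in g, and the damping
survives. -/
lemma IsWeakSolution.hasDerivAt_energy (hs : IsWeakSolution bc Ω α q γ κ f hl u₀ u₁ u v)
    (hn : 1 ≤ n) (hb : Bornology.IsBounded (Ω : Set (E n))) (hα : α ∈ Icc (0 : ℝ) 1) (hq : 0 ≤ q)
    {σ : ℝ} (hf : IsSource n σ f p Cf' Cf cf) {t : ℝ} (ht : 0 < t) :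
    HasDerivAt (fun s => energy Ω κ f hl (u s) (v s))
      (-(γ * (fracNormSq Ω α (u t) + ‖v t‖ ^ 2) ^ q * ‖v t‖ ^ 2)) t := by
  have h1 := EnergyDampedBeam.hasDerivAt_energy (fun c _ _ => energySpace_smul_sub hn hb c)
    hs.mem_energySpace hs.continuousOn_left hs.continuousOn_left_H hs.continuousOn_right
    (hs.continuousOn_forcing hn hb hα hq hf) hs.hasDerivAt
    (fun w hw t ht => hs.hasDerivAt_inner hn hb hf hw ht) ht
  have hev : ∀ᶠ s in 𝓝 t, 0 ≤ s := (lt_mem_nhds ht).mono fun s hs => hs.le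
  have hnhds : Ici (0 : ℝ) ∈ 𝓝 t := Ici_mem_nhds ht
  have h2 := hasDerivAt_inner_symm (A := opA Ω) (u := u)
    (hev.mono fun s hs' => inner_opA_symm hn hb (hs.mem_domA hn hb hs') (hs.mem_domA hn hb ht.le))
    (hs.continuousOn_left.continuousAt hnhds) (hs.hasDerivAt t ht)
  have hmem : ∀ {s}, 0 ≤ s → u s ∈ lpSpace Ω p := fun hs' =>
    domA_subset_lpSpace hn hb hf.p_nonneg hf.p_le (hs.mem_domA hn hb hs')
  have h3 := hf.hasDerivAt_integral_primitive (hev.mono fun s hs' => hmem hs') (hs.hasDerivAt t ht)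
    (by have := hs.tendsto_weightedDist hn hb hf ht.le; rwa [nhdsWithin_eq_nhds.2 hnhds] at this)
  have h4 : HasDerivAt (fun s => ⟪hl, u s⟫) ⟪hl, v t⟫ t := by
    simpa using (hasDerivAt_const t hl).inner ℝ (hs.hasDerivAt t ht)
  have h5 := ((h1.add (h2.const_mul (κ / 2))).add h3).sub h4
  have e : ⟪forcing Ω α q γ κ f hl (u t) (v t), v t⟫ + κ / 2 * (2 * ⟪opA Ω (u t), v t⟫) +
      ⟪superpose Ω f (u t), v t⟫ - ⟪hl, v t⟫ =
      -(γ * (fracNormSq Ω α (u t) + ‖v t‖ ^ 2) ^ q * ‖v t‖ ^ 2) := by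
    rw [forcing, inner_sub_left, inner_sub_left, inner_sub_left, real_inner_smul_left,
      real_inner_smul_left, real_inner_self_eq_norm_sq]
    ring
  rw [e] at h5
  refine h5.congr_of_eventuallyEq ?_
  filter_upwards [hev] with s hs'
  simp only [energy, fracNormSq_half hn hb (hs.mem_domA hn hb hs'), Pi.add_apply, Pi.sub_apply]
  ring

lemma IsWeakSolution.continuousOn_energy (hs : IsWeakSolution bc Ω α q γ κ f hl u₀ u₁ u v)
    (hn : 1 ≤ n) (hb : Bornology.IsBounded (Ω : Set (E n)))
    {σ : ℝ} (hf : IsSource n σ f p Cf' Cf cf) :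
    ContinuousOn (fun s => energy Ω κ f hl (u s) (v s)) (Ici 0) := by
  have h1 := continuousOn_fracNormSq hn hb (s := 1 / 2) (by norm_num)
    (fun _ ht => hs.mem_domA hn hb ht) hs.continuousOn_left_H hs.continuousOn_left
  have h2 : ContinuousOn (fun s => ∫ x in (Ω : Set (E n)), primitive f (u s x)) (Ici 0) :=
    fun _ ht => hf.continuousWithinAt_integral_primitive (fun _ hs' =>
      domA_subset_lpSpace hn hb hf.p_nonneg hf.p_le (hs.mem_domA hn hb hs')) ht
      (hs.continuousOn_left_H _ ht) (hs.tendsto_weightedDist hn hb hf ht)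
  exact (continuousOn_const.mul (((hs.continuousOn_right.norm.pow 2).add
    (hs.continuousOn_left.norm.pow 2)).add (continuousOn_const.mul h1))).add h2 |>.sub
    (continuousOn_const.inner hs.continuousOn_left_H)

/-- The inequality obtained with the multiplier `u`. -/
lemma IsWeakSolution.exists_hasDerivAt_inner_self
    (hs : IsWeakSolution bc Ω α q γ κ f hl u₀ u₁ u v)
    (hn : 1 ≤ n) (hb : Bornology.IsBounded (Ω : Set (E n))) (hκ : 0 ≤ κ)
    (hf : IsSource n (sigmaOne bc Ω) f p Cf' Cf cf) {t : ℝ} (ht : 0 < t) :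
    ∃ m', HasDerivAt (fun s => ⟪v s, u s⟫) m' t ∧
      energy Ω κ f hl (u t) (v t) ≤ 3 / 2 * ‖v t‖ ^ 2 - m' -
        γ * (fracNormSq Ω α (u t) + ‖v t‖ ^ 2) ^ q * ⟪v t, u t⟫ := by
  have hu := hs.mem_energySpace t ht.le
  have hd := hs.mem_domA hn hb ht.le
  have hm := domA_subset_lpSpace hn hb hf.p_nonneg hf.p_le hd
  refine ⟨_, HasDerivAt.inner_of_inner_const
    (hs.continuousOn_right.continuousAt (Ici_mem_nhds ht)) (hs.hasDerivAt t ht)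
    (hs.hasDerivAt_inner hn hb hf hu ht), ?_⟩
  -- The multiplier yields the full ‖Au‖², of which the energy uses one half; the other half pays
  -- for (c_f/2)‖u‖² through c_f < σ₁.
  have h1 := hf.integral_primitive_le hm
  have h2 := sigmaOne_mul_norm_sq_le hn hb hu
  have h3 := mul_nonneg hκ (fracNormSq_nonneg hn hb (1 / 2) (u t))
  have h4 : cf * ‖u t‖ ^ 2 ≤ sigmaOne bc Ω * ‖u t‖ ^ 2 :=
    mul_le_mul_of_nonneg_right hf.cf_lt.le (sq_nonneg _)
  rw [forcing, inner_sub_left, inner_sub_left, inner_sub_left, real_inner_smul_left,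
      real_inner_smul_left, real_inner_self_eq_norm_sq, real_inner_self_eq_norm_sq, energy,
      ← fracNormSq_half hn hb hd]
  linarith

end

end

/-! ### Decay rates for scalar energy inequalities -/

/-- The scalar quantities of a damped second order equation: the energy `Y`, the kinetic part `V`,
the base `N` of the damping coefficient, and the pairing `m` of the velocity with the position. -/
structure IsDissipative (q γ c₀ c₁ K : ℝ) (Y V N m : ℝ → ℝ) : Prop where
  continuousOn_energy : ContinuousOn Y (Ici 0)
  continuousOn_kinetic : ContinuousOn V (Ici 0)
  continuousOn_base : ContinuousOn N (Ici 0)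
  continuousOn_pairing : ContinuousOn m (Ici 0)
  kinetic_nonneg : ∀ t, 0 ≤ t → 0 ≤ V t
  kinetic_le : ∀ t, 0 ≤ t → V t ≤ 2 * Y t
  kinetic_le_base : ∀ t, 0 ≤ t → V t ≤ N t
  base_le : ∀ t, 0 ≤ t → N t ≤ c₀ * Y t
  pairing_sq_le : ∀ t, 0 ≤ t → m t ^ 2 ≤ V t * (c₁ * Y t)
  hasDerivAt_energy : ∀ t, 0 < t → HasDerivAt Y (-(γ * N t ^ q * V t)) t
  hasDerivAt_pairing : ∀ t, 0 < t → ∃ m', HasDerivAt m m' t ∧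
    Y t ≤ K + 3 / 2 * V t - m' + γ * N t ^ q * |m t|

lemma exists_le_of_integral_le {V : ℝ → ℝ} {a b c : ℝ} (hab : a < b)
    (hV : ContinuousOn V (Icc a b)) (h : ∫ s in a..b, V s < (b - a) * c) :
    ∃ x ∈ Icc a b, V x ≤ c := by
  by_contra! hcon
  have h1 : ∫ _ in a..b, c ≤ ∫ s in a..b, V s :=
    intervalIntegral.integral_mono_on hab.le (by simp) (hV.intervalIntegrable_of_Icc hab.le)
      fun x hx => (hcon x hx).le
  rw [intervalIntegral.integral_const, smul_eq_mul] at h1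
  linarith

/-- The constant in the difference inequality for the energy. -/
def decayConst (q γ c₀ c₁ e : ℝ) : ℝ :=
  (12 + 2 * (γ * ((max e 0 / γ) ^ (1 / (q + 1)) + 1) ^ q) +
    (16 + 4 * (γ * (c₀ * max e 0) ^ q)) ^ 2 * c₁) ^ (q + 1) / γ

lemma decayConst_pos {q γ c₀ c₁ : ℝ} (hγ : 0 < γ) (hc₀ : 0 ≤ c₀) (hc₁ : 0 ≤ c₁)
    (e : ℝ) : 0 < decayConst q γ c₀ c₁ e := by
  unfold decayConst; positivity

lemma decayConst_mono {q γ c₀ c₁ : ℝ} (hq : 0 ≤ q) (hγ : 0 < γ) (hc₀ : 0 ≤ c₀)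
    (hc₁ : 0 ≤ c₁) : Monotone (decayConst q γ c₀ c₁) := by
  intro a b hab
  unfold decayConst
  gcongr

/-- A discrete version of (y^{-q})' ≥ q/C for -y' ≥ y^{q+1}/C. It rests on (b/a)^{-q} ≥ 1 + q(1 -
b/a), which comes from log x ≤ x - 1 and e^x ≥ 1 + x. -/
lemma rpow_neg_add_le {q a b C : ℝ} (hq : 0 < q) (hC : 0 < C) (hb : 0 < b)
    (hab : b ≤ a) (h : a ^ (q + 1) ≤ C * (a - b)) : a ^ (-q) + q / C ≤ b ^ (-q) := by
  have ha : 0 < a := hb.trans_le hab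
  have h1 : 1 + q * (1 - b / a) ≤ (b / a) ^ (-q) := by
    have h2 := Real.log_le_sub_one_of_pos (div_pos hb ha)
    have h3 := Real.add_one_le_exp (Real.log (b / a) * -q)
    rw [Real.rpow_def_of_pos (div_pos hb ha)]
    nlinarith
  have h4 : a ^ (-q) * (b / a) ^ (-q) = b ^ (-q) := by
    rw [← Real.mul_rpow ha.le (div_pos hb ha).le]; congr 1; field_simp
  have h5 : 0 < a ^ (-q) := Real.rpow_pos_of_pos ha _
  have h6 : 1 ≤ a ^ (-q) * (1 - b / a) * C := by
    have e1 : a ^ (-q) * (1 - b / a) * C = a ^ (-q) * (C * (a - b)) / a := by field_simp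
    rw [e1, le_div_iff₀ ha, one_mul]
    calc a = a ^ (-q) * a ^ (q + 1) := by
          rw [← Real.rpow_add ha]; simp
      _ ≤ _ := by gcongr
  rw [← h4]
  have h7 : q / C ≤ q * (a ^ (-q) * (1 - b / a)) := by
    rw [div_le_iff₀ hC]
    nlinarith
  nlinarith

lemma profile_nonneg {q C e s : ℝ} (hq : 0 ≤ q) (hC : 0 ≤ C) (he : 0 ≤ e)
    (hs : 0 ≤ s) : 0 ≤ profile q C e s := by
  unfold profile; positivity

namespace IsDissipative

variable {q γ c₀ c₁ K : ℝ} {Y V N m : ℝ → ℝ}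

lemma energy_nonneg (h : IsDissipative q γ c₀ c₁ K Y V N m) {t : ℝ} (ht : 0 ≤ t) : 0 ≤ Y t := by
  linarith [h.kinetic_nonneg t ht, h.kinetic_le t ht]

lemma base_nonneg (h : IsDissipative q γ c₀ c₁ K Y V N m) {t : ℝ} (ht : 0 ≤ t) : 0 ≤ N t :=
  (h.kinetic_nonneg t ht).trans (h.kinetic_le_base t ht)

lemma antitoneOn (h : IsDissipative q γ c₀ c₁ K Y V N m) (hγ : 0 ≤ γ) : AntitoneOn Y (Ici 0) := by
  refine antitoneOn_of_deriv_nonpos (convex_Ici 0) h.continuousOn_energy ?_ ?_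
  · rw [interior_Ici]
    exact fun t ht => (h.hasDerivAt_energy t ht).differentiableAt.differentiableWithinAt
  · rw [interior_Ici]
    intro t ht
    rw [(h.hasDerivAt_energy t ht).deriv]
    have h1 := h.kinetic_nonneg t (le_of_lt ht)
    have h2 := h.base_nonneg (le_of_lt ht)
    have : 0 ≤ γ * N t ^ q * V t := by positivity
    linarith

lemma sub_eq_integral (h : IsDissipative q γ c₀ c₁ K Y V N m) (hq : 0 ≤ q) {a b : ℝ} (ha : 0 ≤ a)
    (hab : a ≤ b) : Y a - Y b = γ * ∫ s in a..b, N s ^ q * V s := by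
  have hsub : Icc a b ⊆ Ici 0 := fun s hs => ha.trans hs.1
  have hc : ContinuousOn (fun s => -(γ * N s ^ q * V s)) (Icc a b) :=
    (((continuousOn_const.mul ((h.continuousOn_base.mono hsub).rpow_const
      fun _ _ => Or.inr hq)).mul (h.continuousOn_kinetic.mono hsub))).neg
  have := intervalIntegral.integral_eq_sub_of_hasDerivAt_of_le hab
    (h.continuousOn_energy.mono hsub) (fun s hs => h.hasDerivAt_energy s (ha.trans_lt hs.1))
    (hc.intervalIntegrable_of_Icc hab)
  rw [intervalIntegral.integral_neg] at this
  simp only [mul_assoc, intervalIntegral.integral_const_mul] at this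
  linarith

/-- Where V ≥ δ, also N ≥ δ, so V ≤ δ^{-q}N^qV, and the integral of N^qV is the energy loss divided
by γ; elsewhere V ≤ δ. -/
lemma integral_kinetic_le (h : IsDissipative q γ c₀ c₁ K Y V N m) (hq : 0 ≤ q) (hγ : 0 < γ) {t δ : ℝ}
    (ht : 0 ≤ t) (hδ : 0 < δ) (hD : Y t - Y (t + 1) ≤ γ * δ ^ (q + 1)) :
    ∫ s in t..(t + 1), V s ≤ 2 * δ := by
  have ht1 : t ≤ t + 1 := by linarith
  have hsub : Icc t (t + 1) ⊆ Ici 0 := fun s hs => ht.trans hs.1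
  have hc : ContinuousOn (fun s => N s ^ q * V s) (Icc t (t + 1)) :=
    (((h.continuousOn_base.mono hsub).rpow_const
      fun _ _ => Or.inr hq)).mul (h.continuousOn_kinetic.mono hsub)
  have hi := hc.intervalIntegrable_of_Icc (μ := volume) ht1
  have hint : ∫ s in t..(t + 1), N s ^ q * V s ≤ δ ^ (q + 1) := by
    rw [h.sub_eq_integral hq ht ht1] at hD
    exact le_of_mul_le_mul_left hD hγ
  have hδq : 0 < δ ^ q := Real.rpow_pos_of_pos hδ q
  calc ∫ s in t..(t + 1), V s ≤ ∫ s in t..(t + 1), (δ + (δ ^ q)⁻¹ * (N s ^ q * V s)) := by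
        refine intervalIntegral.integral_mono_on ht1
          ((h.continuousOn_kinetic.mono hsub).intervalIntegrable_of_Icc ht1)
          (IntervalIntegrable.add (by simp) (hi.const_mul _)) fun s hs => ?_
        have hV := h.kinetic_nonneg s (hsub hs)
        have hN := h.base_nonneg (hsub hs)
        rcases le_total (V s) δ with hle | hle
        · have : 0 ≤ (δ ^ q)⁻¹ * (N s ^ q * V s) := by positivity
          linarith
        · have h1 : δ ^ q ≤ N s ^ q :=
            Real.rpow_le_rpow hδ.le (hle.trans (h.kinetic_le_base s (hsub hs))) hq
          have h2 : V s ≤ (δ ^ q)⁻¹ * (N s ^ q * V s) := by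
            rw [inv_mul_eq_div, le_div_iff₀ hδq, mul_comm]
            exact mul_le_mul_of_nonneg_right h1 hV
          linarith
    _ = δ + (δ ^ q)⁻¹ * ∫ s in t..(t + 1), N s ^ q * V s := by
        rw [intervalIntegral.integral_add (by simp) (hi.const_mul _),
          intervalIntegral.integral_const, intervalIntegral.integral_const_mul]
        simp
    _ ≤ δ + (δ ^ q)⁻¹ * δ ^ (q + 1) := by gcongr
    _ = 2 * δ := by
        rw [Real.rpow_add hδ, Real.rpow_one]; field_simp; ring

lemma abs_pairing_le (h : IsDissipative q γ c₀ c₁ K Y V N m) (hc₁ : 0 ≤ c₁) {s Z : ℝ} (hs : 0 ≤ s)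
    (hZ : Y s ≤ Z) : |m s| ≤ √(V s) * √(c₁ * Z) := by
  rw [← Real.sqrt_mul (h.kinetic_nonneg s hs)]
  refine Real.abs_le_sqrt ((h.pairing_sq_le s hs).trans ?_)
  have := h.kinetic_nonneg s hs
  gcongr

/-- The multiplier inequality is integrated, with Y bounded below by Y(t+1), N by c₀e, and |m| by √V
· √(c₁Y(t)), where 2√V ≤ √δ + V/√δ. No continuity of m' is available, so m is compared with the
integral of an upper bound for m'. -/
lemma pairing_sub_le (h : IsDissipative q γ c₀ c₁ K Y V N m) (hq : 0 ≤ q) (hγ : 0 < γ)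
    (hc₀ : 0 ≤ c₀) (hc₁ : 0 ≤ c₁) {t t₁ t₂ δ e : ℝ} (ht : 0 ≤ t) (hδ : 0 < δ) (he : Y t ≤ e)
    (h1 : t ≤ t₁) (h12 : t₁ ≤ t₂) (h2 : t₂ ≤ t + 1) :
    m t₂ - m t₁ ≤ (t₂ - t₁) * (K - Y (t + 1) + γ * (c₀ * e) ^ q * √(c₁ * Y t) / 2 * √δ) +
      (3 / 2 + γ * (c₀ * e) ^ q * √(c₁ * Y t) / 2 / √δ) * ∫ s in t₁..t₂, V s := by
  have hsub : Icc t₁ t₂ ⊆ Ici 0 := fun s hs => ht.trans (h1.trans hs.1)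
  have hVc := h.continuousOn_kinetic.mono hsub
  set B := γ * (c₀ * e) ^ q * √(c₁ * Y t) / 2 with hB
  have hB0 : 0 ≤ B := by
    have : 0 ≤ e := (h.energy_nonneg ht).trans he
    positivity
  have hsδ : 0 < √δ := Real.sqrt_pos.2 hδ
  choose! m' hm' hm using h.hasDerivAt_pairing
  have key := intervalIntegral.sub_le_integral_of_hasDeriv_right_of_le (g := m) (g' := m')
    (φ := fun s => (K - Y (t + 1) + B * √δ) + (3 / 2 + B / √δ) * V s) h12
    (h.continuousOn_pairing.mono hsub)
    (fun x hx => (hm' x (ht.trans_lt (h1.trans_lt hx.1))).hasDerivWithinAt)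
    ((continuousOn_const.add (continuousOn_const.mul hVc)).integrableOn_Icc) ?_
  · refine key.trans_eq ?_
    rw [intervalIntegral.integral_add (by simp)
      ((hVc.intervalIntegrable_of_Icc h12).const_mul _), intervalIntegral.integral_const,
      intervalIntegral.integral_const_mul, smul_eq_mul]
  · intro x hx
    have hxt : t < x := h1.trans_lt hx.1
    have hx0 : 0 < x := ht.trans_lt hxt
    have a1 := hm x hx0
    have a2 : Y (t + 1) ≤ Y x := h.antitoneOn hγ.le hx0.le (by simp; linarith)
      (hx.2.le.trans h2)
    have a3 : Y x ≤ Y t := h.antitoneOn hγ.le ht hx0.le hxt.le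
    have a4 : N x ^ q ≤ (c₀ * e) ^ q := by
      refine Real.rpow_le_rpow (h.base_nonneg hx0.le) ((h.base_le x hx0.le).trans ?_) hq
      gcongr
      linarith
    have a5 := h.abs_pairing_le hc₁ hx0.le a3
    have a6 : √(V x) ≤ (√δ + V x / √δ) / 2 := by
      have e1 : V x / √δ = √(V x) ^ 2 / √δ := by rw [Real.sq_sqrt (h.kinetic_nonneg x hx0.le)]
      rw [e1, le_div_iff₀ two_pos]
      have e2 := div_nonneg (sq_nonneg (√(V x) - √δ)) hsδ.le
      have e3 : (√(V x) - √δ) ^ 2 / √δ = √δ + √(V x) ^ 2 / √δ - √(V x) * 2 := by field_simp; ring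
      linarith
    have a7 : γ * N x ^ q * |m x| ≤ B * √δ + B / √δ * V x := by
      calc γ * N x ^ q * |m x| ≤ γ * (c₀ * e) ^ q * (((√δ + V x / √δ) / 2) * √(c₁ * Y t)) := by
            have := (Real.rpow_nonneg (h.base_nonneg hx0.le) q).trans a4
            gcongr
            exact a5.trans (by gcongr)
        _ = _ := by rw [hB]; ring
    linarith

/-- One step of the Nakao method. -/
lemma energy_le (h : IsDissipative q γ c₀ c₁ K Y V N m) (hq : 0 ≤ q) (hγ : 0 < γ)
    (hc₀ : 0 ≤ c₀) (hc₁ : 0 ≤ c₁) {t δ δ₀ e : ℝ} (ht : 0 ≤ t) (hδ : 0 < δ)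
    (hδ₀ : δ ≤ δ₀) (he : Y t ≤ e) (hD : Y t - Y (t + 1) ≤ γ * δ ^ (q + 1)) :
    Y t - 2 * K ≤ (12 + 2 * (γ * δ₀ ^ q) + (16 + 4 * (γ * (c₀ * e) ^ q)) ^ 2 * c₁) * δ := by
  have hI := h.integral_kinetic_le hq hγ ht hδ hD
  have hsub : Icc t (t + 1) ⊆ Ici 0 := fun s hs => ht.trans hs.1
  have hVc := h.continuousOn_kinetic.mono hsub
  have hmono : ∀ {a b}, t ≤ a → a ≤ b → b ≤ t + 1 → ∫ s in a..b, V s ≤ 2 * δ := by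
    intro a b ha hab hb
    refine le_trans (intervalIntegral.integral_mono_interval ha hab hb ?_
      (hVc.intervalIntegrable_of_Icc (by linarith))) hI
    exact (ae_restrict_iff' measurableSet_Ioc).2 (Eventually.of_forall fun s hs =>
      h.kinetic_nonneg s (ht.trans hs.1.le))
  -- On a quarter of the interval the mean of V is at most 8δ; 12δ makes the inequality strict.
  -- Taking t₁ in the first quarter and t₂ in the last ensures t₂ - t₁ ≥ 1/2.
  obtain ⟨t₁, ht₁, hV₁⟩ := exists_le_of_integral_le (V := V) (a := t) (b := t + 1 / 4) (c := 12 * δ)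
    (by linarith) (hVc.mono (Icc_subset_Icc le_rfl (by linarith)))
    ((hmono le_rfl (by linarith) (by linarith)).trans_lt (by linarith))
  obtain ⟨t₂, ht₂, hV₂⟩ := exists_le_of_integral_le (V := V) (a := t + 3 / 4) (b := t + 1)
    (c := 12 * δ) (by linarith) (hVc.mono (Icc_subset_Icc (by linarith) le_rfl))
    ((hmono (by linarith) (by linarith) le_rfl).trans_lt (by linarith))
  have ht12 : t₁ ≤ t₂ := by linarith [ht₁.2, ht₂.1]
  have hZ := h.energy_nonneg ht
  have he0 : 0 ≤ e := hZ.trans he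
  have hm : ∀ s, t ≤ s → V s ≤ 12 * δ → |m s| ≤ 4 * √δ * √(c₁ * Y t) := by
    intro s hs hVs
    refine (h.abs_pairing_le hc₁ (ht.trans hs)
      (h.antitoneOn hγ.le ht (ht.trans hs) hs)).trans ?_
    gcongr
    rw [Real.sqrt_le_left (by positivity), mul_pow, Real.sq_sqrt hδ.le]
    linarith
  have hm1 := hm t₁ ht₁.1 hV₁
  have hm2 := hm t₂ (by linarith [ht₂.1]) hV₂
  have key := h.pairing_sub_le hq hγ hc₀ hc₁ ht hδ he ht₁.1 ht12 ht₂.2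
  have hI12 := hmono ht₁.1 ht12 ht₂.2
  set Γ := γ * (c₀ * e) ^ q with hΓ
  have hΓ0 : 0 ≤ Γ := by positivity
  set R := √(c₁ * Y t) with hR
  have hR0 : 0 ≤ R := Real.sqrt_nonneg _
  have hR2 : R ^ 2 = c₁ * Y t := Real.sq_sqrt (by positivity)
  set r := √δ with hr
  have hr0 : 0 < r := Real.sqrt_pos.2 hδ
  have hr2 : r ^ 2 = δ := Real.sq_sqrt hδ.le
  have k1 : (3 / 2 + Γ * R / 2 / r) * ∫ s in t₁..t₂, V s ≤ 3 * δ + Γ * R * r := by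
    calc _ ≤ (3 / 2 + Γ * R / 2 / r) * (2 * δ) := by gcongr
      _ = 3 * δ + Γ * R * r := by rw [← hr2]; field_simp
  have hΓR : 0 ≤ Γ * R * r := by positivity
  have k2 : (t₂ - t₁) * (Γ * R / 2 * r) ≤ 1 * (Γ * R / 2 * r) :=
    mul_le_mul_of_nonneg_right (by linarith [ht₁.1, ht₂.2]) (by positivity)
  have k3 : (t₂ - t₁) * (Y (t + 1) - K) ≤ 3 * δ + (8 + 2 * Γ) * (R * r) := by
    have := neg_le_of_abs_le hm2
    have := le_of_abs_le hm1
    nlinarith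
  have k4 : 1 / 2 * (Y (t + 1) - K) ≤ 3 * δ + (8 + 2 * Γ) * (R * r) := by
    rcases le_total (Y (t + 1)) K with hle | hle
    · have : 0 ≤ (8 + 2 * Γ) * (R * r) := by positivity
      linarith
    · exact (mul_le_mul_of_nonneg_right (by linarith [ht₁.2, ht₂.1]) (by linarith)).trans k3
  have k5 : γ * δ ^ (q + 1) ≤ γ * δ₀ ^ q * δ := by
    rw [Real.rpow_add hδ, Real.rpow_one, mul_assoc]
    gcongr
  -- The pairing is of order √(Y(t)δ). Half of Y(t) is absorbed on the left, and doubling the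
  -- outcome turns K into 2K.
  have k6 : (16 + 4 * Γ) * (R * r) ≤ 1 / 2 * Y t + 1 / 2 * ((16 + 4 * Γ) ^ 2 * c₁ * δ) := by
    have e1 : R = √c₁ * √(Y t) := Real.sqrt_mul hc₁ _
    have e2 : √c₁ ^ 2 = c₁ := Real.sq_sqrt hc₁
    have e3 : √(Y t) ^ 2 = Y t := Real.sq_sqrt hZ
    have e4 := sq_nonneg (√(Y t) - (16 + 4 * Γ) * √c₁ * r)
    have e5 : (√(Y t) - (16 + 4 * Γ) * √c₁ * r) ^ 2 = √(Y t) ^ 2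
      + (16 + 4 * Γ) ^ 2 * √c₁ ^ 2 * r ^ 2 - 2 * ((16 + 4 * Γ) * (R * r)) := by rw [e1]; ring
    rw [e5, e2, e3, hr2] at e4
    linarith
  nlinarith

lemma rpow_energy_le (h : IsDissipative q γ c₀ c₁ K Y V N m) (hq : 0 ≤ q) (hγ : 0 < γ)
    (hc₀ : 0 ≤ c₀) (hc₁ : 0 ≤ c₁) {t e : ℝ} (ht : 0 ≤ t) (he : Y t ≤ e)
    (hpos : 0 ≤ Y t - 2 * K) :
    (Y t - 2 * K) ^ (q + 1) ≤ decayConst q γ c₀ c₁ e * (Y t - Y (t + 1)) := by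
  have he0 : 0 ≤ e := (h.energy_nonneg ht).trans he
  have hant := h.antitoneOn hγ.le ht (mem_Ici.2 (by linarith : 0 ≤ t + 1)) (by linarith)
  have hYt1 := h.energy_nonneg (t := t + 1) (by linarith)
  obtain ⟨D, hD⟩ : ∃ D, D = (Y t - Y (t + 1)) / γ := ⟨_, rfl⟩
  have hD0 : 0 ≤ D := by rw [hD]; exact div_nonneg (by linarith) hγ.le
  have hDe : D ≤ e / γ := by rw [hD]; gcongr; linarith
  have hYD : Y t - Y (t + 1) = γ * D := by rw [hD]; field_simp
  unfold decayConst
  rw [max_eq_left he0]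
  set G := 12 + 2 * (γ * ((e / γ) ^ (1 / (q + 1)) + 1) ^ q) +
    (16 + 4 * (γ * (c₀ * e) ^ q)) ^ 2 * c₁ with hG
  have hG0 : 0 < G := by rw [hG]; positivity
  have hstep : Y t - 2 * K ≤ G * D ^ (1 / (q + 1)) := by
    -- The natural choice δ = D^{1/(q+1)} may vanish, so a small η > 0 is added; η ≤ 1 keeps δ below
    -- the δ₀ that enters `decayConst`.
    refine le_of_forall_pos_le_add fun ε hε => ?_
    have hη : 0 < min 1 (ε / G) := lt_min one_pos (div_pos hε hG0)
    have hD1 : 0 ≤ D ^ (1 / (q + 1)) := by positivity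
    have := h.energy_le hq hγ hc₀ hc₁ ht (δ := D ^ (1 / (q + 1)) + min 1 (ε / G))
      (δ₀ := (e / γ) ^ (1 / (q + 1)) + 1) (by positivity)
      (add_le_add (Real.rpow_le_rpow hD0 hDe (by positivity)) (min_le_left _ _)) he (by
        rw [hYD]
        gcongr
        calc D = (D ^ (1 / (q + 1))) ^ (q + 1) := by
              rw [← Real.rpow_mul hD0, one_div_mul_cancel (by positivity), Real.rpow_one]
          _ ≤ _ := Real.rpow_le_rpow hD1 (by linarith) (by positivity))
    refine this.trans ?_
    rw [mul_add]
    gcongr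
    calc G * min 1 (ε / G) ≤ G * (ε / G) := by gcongr; exact min_le_right _ _
      _ = ε := by field_simp
  calc (Y t - 2 * K) ^ (q + 1) ≤ (G * D ^ (1 / (q + 1))) ^ (q + 1) :=
        Real.rpow_le_rpow hpos hstep (by positivity)
    _ = G ^ (q + 1) * D := by
        rw [Real.mul_rpow hG0.le (by positivity), ← Real.rpow_mul hD0,
          one_div_mul_cancel (by positivity), Real.rpow_one]
    _ = _ := by rw [hYD]; field_simp

/-- The upper estimate. -/
lemma energy_le_profile (h : IsDissipative q γ c₀ c₁ K Y V N m) (hq : 0 < q) (hγ : 0 < γ)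
    (hc₀ : 0 ≤ c₀) (hc₁ : 0 ≤ c₁) (hK : 0 ≤ K) {t : ℝ} (ht : 0 ≤ t) :
    Y t ≤ profile q (decayConst q γ c₀ c₁ (Y 0)) (Y 0) (max (t - 1) 0) + 2 * K := by
  have hC := decayConst_pos (q := q) hγ hc₀ hc₁ (Y 0)
  set C := decayConst q γ c₀ c₁ (Y 0) with hCdef
  have hY0 := h.energy_nonneg le_rfl
  have hant := h.antitoneOn hγ.le
  rcases le_or_gt (Y t) (2 * K) with hle | hlt
  · have := profile_nonneg hq.le hC.le hY0 (le_max_right (t - 1) 0)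
    linarith
  have hle0 : ∀ s, 0 ≤ s → Y s ≤ Y 0 := fun s hs => hant (mem_Ici.2 le_rfl) (mem_Ici.2 hs) hs
  -- Unit steps start at the fractional part of t, so their number ⌊t⌋ is at least (t - 1)⁺. Along
  -- them Y stays above Y(t) > 2K.
  have hiter : ∀ (k : ℕ) (s : ℝ), 0 ≤ s → 0 < Y (s + k) - 2 * K →
      (Y s - 2 * K) ^ (-q) + q / C * k ≤ (Y (s + k) - 2 * K) ^ (-q) := by
    intro k s hs
    induction k with
    | zero => intro _; simp
    | succ k ih =>
      intro hpos
      have hsk : 0 ≤ s + k := by positivity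
      have hmono : Y (s + k + 1) ≤ Y (s + k) :=
        hant (mem_Ici.2 hsk) (mem_Ici.2 (by linarith)) (by linarith)
      push_cast at hpos ⊢
      rw [← add_assoc] at hpos ⊢
      have h1 := ih (by linarith)
      have h2 := h.rpow_energy_le hq.le hγ hc₀ hc₁ hsk (hle0 _ hsk) (by linarith)
      have h3 := rpow_neg_add_le (a := Y (s + k) - 2 * K) (b := Y (s + k + 1) - 2 * K) hq hC hpos
        (by linarith) (h2.trans_eq (by rw [← hCdef]; ring))
      linarith
  have hfl := Nat.floor_le ht
  have hfl2 := Nat.lt_floor_add_one t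
  have hs : 0 ≤ t - ⌊t⌋₊ := by linarith
  have h1 := hiter ⌊t⌋₊ (t - ⌊t⌋₊) hs (by rw [sub_add_cancel]; linarith)
  rw [sub_add_cancel] at h1
  have hYs : Y t ≤ Y (t - ⌊t⌋₊) :=
    hant (mem_Ici.2 hs) (mem_Ici.2 ht) (by linarith [(Nat.cast_nonneg ⌊t⌋₊ : (0 : ℝ) ≤ _)])
  have hy0 : 0 < Y 0 := by linarith [hle0 t ht]
  have h2 : (Y 0) ^ (-q) ≤ (Y (t - ⌊t⌋₊) - 2 * K) ^ (-q) :=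
    Real.rpow_le_rpow_of_nonpos (by linarith) (by linarith [hle0 _ hs]) (by linarith)
  have hmax : max (t - 1) 0 ≤ ⌊t⌋₊ := max_le (by linarith) (Nat.cast_nonneg _)
  have h3 : q / C * max (t - 1) 0 + 1 / Y 0 ^ q ≤ (Y t - 2 * K) ^ (-q) := by
    rw [one_div, ← Real.rpow_neg hy0.le]
    have : q / C * max (t - 1) 0 ≤ q / C * ⌊t⌋₊ := by gcongr
    linarith
  have h4 : 0 < q / C * max (t - 1) 0 + 1 / Y 0 ^ q := by positivity
  have h5 := Real.rpow_le_rpow_of_nonpos h4 h3 (z := -(1 / q)) (by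
    rw [neg_nonpos]; positivity)
  rw [← Real.rpow_mul (by linarith)] at h5
  have e1 : -q * -(1 / q) = 1 := by field_simp
  rw [e1, Real.rpow_one] at h5
  unfold profile
  linarith

/-- The lower estimate. -/
lemma profile_le_energy (h : IsDissipative q γ c₀ c₁ K Y V N m) (hq : 0 < q) (hγ : 0 < γ)
    (hc₀ : 0 < c₀) (hY0 : 0 < Y 0) {t : ℝ} (ht : 0 ≤ t) :
    profile q (1 / (2 * γ * c₀ ^ q)) (Y 0) t ≤ Y t := by
  have hant := h.antitoneOn hγ.le
  have hle0 : ∀ s, 0 ≤ s → Y s ≤ Y 0 := fun s hs => hant (mem_Ici.2 le_rfl) (mem_Ici.2 hs) hs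
  set C := 2 * γ * c₀ ^ q with hCdef
  have hC : 0 < C := by positivity
  have hder : ∀ s, 0 ≤ s → γ * N s ^ q * V s ≤ C * (Y s ^ q * Y s) := by
    intro s hs
    have hY := h.energy_nonneg hs
    have h1 : N s ^ q ≤ c₀ ^ q * Y s ^ q := by
      rw [← Real.mul_rpow hc₀.le hY]
      exact Real.rpow_le_rpow (h.base_nonneg hs) (h.base_le s hs) hq.le
    have h2 := h.kinetic_le s hs
    calc γ * N s ^ q * V s ≤ γ * (c₀ ^ q * Y s ^ q) * (2 * Y s) := by
          have := h.kinetic_nonneg s hs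
          gcongr
      _ = _ := by rw [hCdef]; ring
  -- Strict positivity, needed before forming Y^{-q}: as Y ≤ Y(0), the energy satisfies the linear
  -- inequality Y' ≥ -C Y(0)^q Y, and an exponential integrating factor applies.
  have hpos : ∀ s, 0 ≤ s → 0 < Y s := by
    have hd : ∀ s, 0 < s → HasDerivAt (fun s => -(Real.exp (C * Y 0 ^ q * s) * Y s))
        (-(Real.exp (C * Y 0 ^ q * s) * (C * Y 0 ^ q) * Y s +
          Real.exp (C * Y 0 ^ q * s) * -(γ * N s ^ q * V s))) s := by
      intro s hs
      have h1 : HasDerivAt (fun s => Real.exp (C * Y 0 ^ q * s))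
          (Real.exp (C * Y 0 ^ q * s) * (C * Y 0 ^ q)) s := by
        simpa using ((hasDerivAt_id s).const_mul (C * Y 0 ^ q)).exp
      exact (h1.mul (h.hasDerivAt_energy s hs)).neg
    have hanti : AntitoneOn (fun s => -(Real.exp (C * Y 0 ^ q * s) * Y s)) (Ici 0) := by
      refine antitoneOn_of_deriv_nonpos (convex_Ici 0) ?_ ?_ ?_
      · have : Continuous fun s => Real.exp (C * Y 0 ^ q * s) := by fun_prop
        exact (this.continuousOn.mul h.continuousOn_energy).neg
      · rw [interior_Ici]
        exact fun s hs => (hd s hs).differentiableAt.differentiableWithinAt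
      · rw [interior_Ici]
        intro s hs
        rw [(hd s hs).deriv]
        have hs0 : 0 ≤ s := le_of_lt hs
        have h1 := hder s hs0
        have h2 : Y s ^ q * Y s ≤ Y 0 ^ q * Y s := by
          have := h.energy_nonneg hs0
          gcongr
          exact hle0 s hs0
        have h3 : γ * N s ^ q * V s ≤ C * Y 0 ^ q * Y s := by
          rw [mul_assoc C]
          exact h1.trans (by gcongr)
        have h4 := mul_le_mul_of_nonneg_left h3 (Real.exp_pos (C * Y 0 ^ q * s)).le
        linarith
    intro s hs
    have := hanti (mem_Ici.2 le_rfl) (mem_Ici.2 hs) hs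
    simp only [mul_zero, Real.exp_zero, one_mul, neg_le_neg_iff] at this
    exact pos_of_mul_pos_right (hY0.trans_le this) (Real.exp_pos _).le
  have hanti : AntitoneOn (fun s => Y s ^ (-q) - q * C * s) (Ici 0) := by
    have hd : ∀ s, 0 < s → HasDerivAt (fun s => Y s ^ (-q) - q * C * s)
        (-(γ * N s ^ q * V s) * (-q) * Y s ^ (-q - 1) - q * C) s := by
      intro s hs
      have h1 := (h.hasDerivAt_energy s hs).rpow_const (p := -q) (Or.inl (hpos s hs.le).ne')
      have h2 := h1.sub ((hasDerivAt_id s).const_mul (q * C))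
      rw [mul_one] at h2
      exact h2
    refine antitoneOn_of_deriv_nonpos (convex_Ici 0) ?_ ?_ ?_
    · exact (h.continuousOn_energy.rpow_const fun s hs => Or.inl (hpos s hs).ne').sub
        (by fun_prop)
    · rw [interior_Ici]
      exact fun s hs => (hd s hs).differentiableAt.differentiableWithinAt
    · rw [interior_Ici]
      intro s hs
      rw [(hd s hs).deriv]
      have hYs := hpos s (le_of_lt hs)
      have h1 := hder s (le_of_lt hs)
      have e1 : Y s ^ q * Y s * Y s ^ (-q - 1) = 1 := by
        nth_rewrite 2 [← Real.rpow_one (Y s)]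
        rw [← Real.rpow_add hYs, ← Real.rpow_add hYs]
        simp
      have h2 : γ * N s ^ q * V s * Y s ^ (-q - 1) ≤ C := by
        calc _ ≤ C * (Y s ^ q * Y s) * Y s ^ (-q - 1) := by gcongr
          _ = C := by rw [mul_assoc, e1, mul_one]
      nlinarith
  have h1 := hanti (mem_Ici.2 le_rfl) (mem_Ici.2 ht) ht
  simp only [mul_zero, sub_zero] at h1
  have hYt := hpos t ht
  have h2 : Y t ^ (-q) ≤ q / (1 / C) * t + 1 / Y 0 ^ q := by
    rw [one_div (Y 0 ^ q), ← Real.rpow_neg hY0.le]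
    have : q / (1 / C) * t = q * C * t := by field_simp
    linarith
  have h3 := Real.rpow_le_rpow_of_nonpos (Real.rpow_pos_of_pos hYt _) h2 (z := -(1 / q)) (by
    rw [neg_nonpos]; positivity)
  rw [← Real.rpow_mul hYt.le] at h3
  have e1 : -q * -(1 / q) = 1 := by field_simp
  rwa [e1, Real.rpow_one] at h3

end IsDissipative

/-- With x = (t - 1)⁺, (qx/C + e^{-q})(C/q + e^q) ≥ x + 1, and 2(x + 1) ≥ 1 + t. -/
lemma profile_le_mul_rpow {q C e t : ℝ} (hq : 0 < q) (hC : 0 < C) (he : 0 < e) (ht : 0 ≤ t) :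
    profile q C e (max (t - 1) 0) ≤ (2 * (C / q + e ^ q)) ^ (1 / q) * (1 + t) ^ (-(1 / q)) := by
  have h1 : (2 * (C / q + e ^ q))⁻¹ * (1 + t) ≤ q / C * max (t - 1) 0 + 1 / e ^ q := by
    rw [inv_mul_eq_div, div_le_iff₀ (by positivity)]
    have hx : 0 ≤ max (t - 1) 0 := le_max_right _ _
    have hx1 : t - 1 ≤ max (t - 1) 0 := le_max_left _ _
    have e1 : (q / C * max (t - 1) 0 + 1 / e ^ q) * (2 * (C / q + e ^ q)) =
        2 * (max (t - 1) 0 + 1) + 2 * (q / C * max (t - 1) 0 * e ^ q + C / q / e ^ q) := by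
      field_simp; ring
    rw [e1]
    have : 0 ≤ q / C * max (t - 1) 0 * e ^ q + C / q / e ^ q := by positivity
    linarith
  unfold profile
  refine (Real.rpow_le_rpow_of_nonpos (by positivity) h1 (by rw [neg_nonpos]; positivity)).trans_eq ?_
  rw [Real.mul_rpow (by positivity) (by positivity), Real.inv_rpow (by positivity),
    ← Real.rpow_neg (by positivity), neg_neg]

/-- In the variable x = at + b the quotient of the exponential by the profile is a constant times
x^{1/q} e^{-νx/a}, which tends to zero. -/
lemma exists_exp_lt_profile {q C e B ν : ℝ} (hq : 0 < q) (hC : 0 < C) (he : 0 < e) (hν : 0 < ν) :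
    ∃ t, 0 < t ∧ B * Real.exp (-ν * t) < profile q C e t := by
  set a := q / C with ha
  set b := 1 / e ^ q with hb
  have ha0 : 0 < a := by positivity
  have hb0 : 0 < b := by positivity
  have h1 := tendsto_rpow_mul_exp_neg_mul_atTop_nhds_zero (1 / q) (ν / a) (by positivity)
  have h2 : Tendsto (fun t : ℝ => a * t + b) atTop atTop :=
    tendsto_atTop_add_const_right _ _ (tendsto_id.const_mul_atTop ha0)
  have h3 := (h1.comp h2).const_mul (B * Real.exp (ν / a * b))
  rw [mul_zero] at h3
  obtain ⟨t, ht, ht0⟩ := ((h3.eventually_lt_const one_pos).and (eventually_gt_atTop 0)).exists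
  refine ⟨t, ht0, ?_⟩
  simp only [Function.comp_apply] at ht
  have hx : 0 < a * t + b := by positivity
  have e1 : Real.exp (ν / a * b) * Real.exp (-(ν / a) * (a * t + b)) = Real.exp (-ν * t) := by
    rw [← Real.exp_add]; congr 1; field_simp; ring
  have e2 : B * Real.exp (ν / a * b) * ((a * t + b) ^ (1 / q) *
      Real.exp (-(ν / a) * (a * t + b))) = B * Real.exp (-ν * t) * (a * t + b) ^ (1 / q) := by
    rw [← e1]; ring
  rw [e2] at ht
  unfold profile
  rw [Real.rpow_neg hx.le]
  rwa [← one_div, lt_div_iff₀ (Real.rpow_pos_of_pos hx _)]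

/-! ### Weak solutions are dissipative -/

section
variable {n : ℕ} {Ω : Opens (E n)} {bc : BoundaryCondition} {α q γ κ p Cf' Cf cf : ℝ} {f : ℝ → ℝ}

/-- The constant in `‖A^α u‖² + ‖v‖² ≤ c Ẽ(u, v)`. -/
def dampingConst (bc : BoundaryCondition) (Ω : Opens (E n)) (cf : ℝ) : ℝ :=
  (1 + 1 / sigmaOne bc Ω) * (4 / omega bc Ω cf) + 2

/-- The constant in `‖u‖² ≤ c Ẽ(u, v)`. -/
def poincareConst (bc : BoundaryCondition) (Ω : Opens (E n)) (cf : ℝ) : ℝ :=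
  4 / (sigmaOne bc Ω * omega bc Ω cf)

lemma omega_pos (h0 : 0 ≤ cf) (h1 : cf < sigmaOne bc Ω) : 0 < omega bc Ω cf := by
  have : 0 < sigmaOne bc Ω := h0.trans_lt h1
  rw [omega, sub_pos, div_lt_one this]
  exact h1

lemma dampingConst_pos (h0 : 0 ≤ cf) (h1 : cf < sigmaOne bc Ω) : 0 < dampingConst bc Ω cf := by
  have := omega_pos h0 h1
  have : 0 < sigmaOne bc Ω := h0.trans_lt h1
  unfold dampingConst
  positivity

lemma poincareConst_pos (h0 : 0 ≤ cf) (h1 : cf < sigmaOne bc Ω) : 0 < poincareConst bc Ω cf := by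
  have := omega_pos h0 h1
  have : 0 < sigmaOne bc Ω := h0.trans_lt h1
  unfold poincareConst
  positivity

lemma norm_opA_sq_le (hn : 1 ≤ n) (hb : Bornology.IsBounded (Ω : Set (E n)))
    (hf : IsSource n (sigmaOne bc Ω) f p Cf' Cf cf) (hκ : 0 ≤ κ) {hl u v : H Ω}
    (hu : u ∈ energySpace bc Ω) :
    ‖opA Ω u‖ ^ 2 ≤ 4 / omega bc Ω cf * modEnergy bc Ω κ f Cf cf hl u v := by
  have h1 := le_modEnergy hn hb hf hκ (hl := hl) (v := v) hu
  have hω := omega_pos hf.cf_nonneg hf.cf_lt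
  have h2 : omega bc Ω cf / 4 * ‖opA Ω u‖ ^ 2 ≤ modEnergy bc Ω κ f Cf cf hl u v := by
    linarith [sq_nonneg ‖v‖]
  calc ‖opA Ω u‖ ^ 2 = 4 / omega bc Ω cf * (omega bc Ω cf / 4 * ‖opA Ω u‖ ^ 2) := by field_simp
    _ ≤ _ := by gcongr

lemma norm_sq_le_modEnergy (hn : 1 ≤ n) (hb : Bornology.IsBounded (Ω : Set (E n)))
    (hf : IsSource n (sigmaOne bc Ω) f p Cf' Cf cf) (hκ : 0 ≤ κ) {hl u v : H Ω}
    (hu : u ∈ energySpace bc Ω) :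
    ‖u‖ ^ 2 ≤ poincareConst bc Ω cf * modEnergy bc Ω κ f Cf cf hl u v := by
  have h1 := norm_opA_sq_le hn hb hf hκ (hl := hl) (v := v) hu
  have h2 := sigmaOne_mul_norm_sq_le hn hb hu
  have hσ : 0 < sigmaOne bc Ω := hf.cf_nonneg.trans_lt hf.cf_lt
  have hω := omega_pos hf.cf_nonneg hf.cf_lt
  calc ‖u‖ ^ 2 = 1 / sigmaOne bc Ω * (sigmaOne bc Ω * ‖u‖ ^ 2) := by field_simp
    _ ≤ 1 / sigmaOne bc Ω * (4 / omega bc Ω cf * modEnergy bc Ω κ f Cf cf hl u v) := by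
        exact mul_le_mul_of_nonneg_left (h2.trans h1) (by positivity)
    _ = _ := by rw [poincareConst]; field_simp

lemma damping_le_modEnergy (hn : 1 ≤ n) (hb : Bornology.IsBounded (Ω : Set (E n)))
    (hα : α ∈ Icc (0 : ℝ) 1)
    (hf : IsSource n (sigmaOne bc Ω) f p Cf' Cf cf) (hκ : 0 ≤ κ) {hl u v : H Ω}
    (hu : u ∈ energySpace bc Ω) : fracNormSq Ω α u + ‖v‖ ^ 2 ≤
      dampingConst bc Ω cf * modEnergy bc Ω κ f Cf cf hl u v := by
  have h0 := norm_opA_sq_le hn hb hf hκ (hl := hl) (v := v) hu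
  have h1 := norm_sq_le_modEnergy hn hb hf hκ (hl := hl) (v := v) hu
  have h2 := fracNormSq_le hn hb hα (energySpace_subset_domA hn hb hu)
  have h3 := le_modEnergy hn hb hf hκ (hl := hl) (v := v) hu
  have hσ : 0 < sigmaOne bc Ω := hf.cf_nonneg.trans_lt hf.cf_lt
  have hω := omega_pos hf.cf_nonneg hf.cf_lt
  have h4 : 0 ≤ omega bc Ω cf / 4 * ‖opA Ω u‖ ^ 2 := by positivity
  have e : dampingConst bc Ω cf = poincareConst bc Ω cf + 4 / omega bc Ω cf + 2 := by
    rw [dampingConst, poincareConst]; field_simp; ring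
  rw [e]
  linarith

lemma modEnergy_pos (hn : 1 ≤ n) (hb : Bornology.IsBounded (Ω : Set (E n)))
    (hf : IsSource n (sigmaOne bc Ω) f p Cf' Cf cf) (hκ : 0 ≤ κ) {hl u v : H Ω}
    (hu : u ∈ energySpace bc Ω) (h : 0 < Kconst bc Ω Cf cf hl ∨ u ≠ 0 ∨ v ≠ 0) :
    0 < modEnergy bc Ω κ f Cf cf hl u v := by
  by_cases hu0 : u = 0
  · by_cases hv0 : v = 0
    · subst hu0 hv0
      rw [modEnergy_zero hn hb]
      simpa using h
    · have h3 := le_modEnergy hn hb hf hκ (hl := hl) (v := v) hu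
      have hω := omega_pos hf.cf_nonneg hf.cf_lt
      have h4 : 0 ≤ omega bc Ω cf / 4 * ‖opA Ω u‖ ^ 2 := by positivity
      have h5 : 0 < ‖v‖ := norm_pos_iff.2 hv0
      have h6 : 0 < 1 / 2 * ‖v‖ ^ 2 := by positivity
      linarith
  · have h1 := norm_sq_le_modEnergy hn hb hf hκ (hl := hl) (v := v) hu
    have h2 : 0 < ‖u‖ := norm_pos_iff.2 hu0
    exact pos_of_mul_pos_right ((pow_pos h2 2).trans_le h1)
      (poincareConst_pos hf.cf_nonneg hf.cf_lt).le

lemma IsWeakSolution.isDissipative {hl u₀ u₁ : H Ω} {u v : ℝ → H Ω}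
    (hs : IsWeakSolution bc Ω α q γ κ f hl u₀ u₁ u v)
    (hn : 1 ≤ n) (hb : Bornology.IsBounded (Ω : Set (E n))) (hα : α ∈ Icc (0 : ℝ) 1) (hq : 0 ≤ q)
    (hγ : 0 ≤ γ) (hκ : 0 ≤ κ) (hf : IsSource n (sigmaOne bc Ω) f p Cf' Cf cf) :
    IsDissipative q γ (dampingConst bc Ω cf) (poincareConst bc Ω cf) (Kconst bc Ω Cf cf hl)
      (fun t => modEnergy bc Ω κ f Cf cf hl (u t) (v t)) (fun t => ‖v t‖ ^ 2)
      (fun t => fracNormSq Ω α (u t) + ‖v t‖ ^ 2) (fun t => ⟪v t, u t⟫) where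
  continuousOn_energy := (hs.continuousOn_energy hn hb hf).add continuousOn_const
  continuousOn_kinetic := hs.continuousOn_right.norm.pow 2
  continuousOn_base := hs.continuousOn_damping hn hb hα
  continuousOn_pairing := hs.continuousOn_right.inner hs.continuousOn_left_H
  kinetic_nonneg _ _ := sq_nonneg _
  kinetic_le t ht := by
    have h3 := le_modEnergy hn hb hf hκ (hl := hl) (v := v t) (hs.mem_energySpace t ht)
    have hω := omega_pos hf.cf_nonneg hf.cf_lt
    have h4 : 0 ≤ omega bc Ω cf / 4 * ‖opA Ω (u t)‖ ^ 2 := by positivity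
    linarith
  kinetic_le_base t _ := le_add_of_nonneg_left (fracNormSq_nonneg hn hb α (u t))
  base_le t ht := damping_le_modEnergy hn hb hα hf hκ (hs.mem_energySpace t ht)
  pairing_sq_le t ht := by
    have h1 := norm_sq_le_modEnergy hn hb hf hκ (hl := hl) (v := v t) (hs.mem_energySpace t ht)
    have h2 := abs_real_inner_le_norm (v t) (u t)
    calc ⟪v t, u t⟫ ^ 2 = |⟪v t, u t⟫| ^ 2 := (sq_abs _).symm
      _ ≤ (‖v t‖ * ‖u t‖) ^ 2 := by gcongr
      _ = ‖v t‖ ^ 2 * ‖u t‖ ^ 2 := mul_pow _ _ _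
      _ ≤ _ := by gcongr
  hasDerivAt_energy t ht := (hs.hasDerivAt_energy hn hb hα hq hf ht).add_const _
  hasDerivAt_pairing t ht := by
    obtain ⟨m', hm', hle⟩ := hs.exists_hasDerivAt_inner_self hn hb hκ hf ht
    refine ⟨m', hm', ?_⟩
    have h1 := fracNormSq_nonneg hn hb α (u t)
    have h2 : 0 ≤ γ * (fracNormSq Ω α (u t) + ‖v t‖ ^ 2) ^ q := by positivity
    have h3 := mul_le_mul_of_nonneg_left (neg_abs_le ⟪v t, u t⟫) h2
    rw [modEnergy]
    linarith

end

end EnergyDampedBeam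


end

open EnergyDampedBeam

theorem proposition4p1 {n : ℕ} (hn : 1 ≤ n) (Ω : Opens (E n)) (hΩ : IsSmoothBoundedDomain Ω)
    (bc : BoundaryCondition) (α q γ cf : ℝ) (hα : α ∈ Icc (0 : ℝ) 1) (hq : 1 / 2 ≤ q)
    (hγ : 0 < γ) :
    -- `C₁` and the functions `C₂`, `M` depend only on `Ω`, the boundary condition,
    -- `α`, `q`, `γ` and `c_f`
    ∃ C₁ : ℝ, ∃ C₂ M : ℝ → ℝ, 0 < C₁ ∧ (∀ e, 0 < C₂ e) ∧ Monotone M ∧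
      ∀ (κ lam p Cf' Cf : ℝ) (f : ℝ → ℝ) (h u₀ u₁ : H Ω) (u v : ℝ → H Ω),
        0 ≤ κ → lam ∈ Icc (0 : ℝ) 1 →
        IsSource n (sigmaOne bc Ω) f p Cf' Cf cf →
        IsWeakSolution bc Ω α q γ κ f (lam • h) u₀ u₁ u v →
        -- two-sided estimate of the modified energy
        ((0 < Kconst bc Ω Cf cf (lam • h) ∨ u₀ ≠ 0 ∨ u₁ ≠ 0) →
          0 < modEnergy bc Ω κ f Cf cf (lam • h) (u 0) (v 0) ∧
          ∀ t, 0 < t →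
            profile q C₁
                (modEnergy bc Ω κ f Cf cf (lam • h) (u 0) (v 0)) t
              ≤ modEnergy bc Ω κ f Cf cf (lam • h) (u t) (v t) ∧
            modEnergy bc Ω κ f Cf cf (lam • h) (u t) (v t)
              ≤ profile q
                  (C₂ (modEnergy bc Ω κ f Cf cf (lam • h) (u 0) (v 0)))
                  (modEnergy bc Ω κ f Cf cf (lam • h) (u 0) (v 0))
                  (max (t - 1) 0)
                + 8 * Kconst bc Ω Cf cf (lam • h)) ∧
        -- the homogeneous case
        (h = 0 → Cf = 0 →
          ((u₀ ≠ 0 ∨ u₁ ≠ 0) →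
            0 < energy Ω κ f 0 (u 0) (v 0) ∧
            ∀ t, 0 < t →
              profile q C₁ (energy Ω κ f 0 (u 0) (v 0)) t ≤ energy Ω κ f 0 (u t) (v t) ∧
              energy Ω κ f 0 (u t) (v t) ≤
                profile q (C₂ (energy Ω κ f 0 (u 0) (v 0))) (energy Ω κ f 0 (u 0) (v 0))
                  (max (t - 1) 0)) ∧
          (u₀ = 0 → u₁ = 0 → ∀ t, 0 ≤ t → energy Ω κ f 0 (u t) (v t) = 0) ∧
          -- polynomial stability with rate `1/q`
          (∀ t, 0 ≤ t → energy Ω κ f 0 (u t) (v t)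
            ≤ M (energy Ω κ f 0 (u 0) (v 0)) * (1 + t) ^ (-(1 / q))) ∧
          -- no exponential decay
          ((u₀ ≠ 0 ∨ u₁ ≠ 0) → ¬ ∃ B ν : ℝ, 0 < ν ∧
            ∀ t, 0 ≤ t → energy Ω κ f 0 (u t) (v t) ≤ B * Real.exp (-ν * t))) := by
  have hb := hΩ.isBounded
  have hq0 : 0 < q := by linarith
  -- Outside this range there is no admissible source, and any constants serve.
  by_cases hcf : 0 ≤ cf ∧ cf < sigmaOne bc Ω
  swap
  · exact ⟨1, fun _ => 1, fun _ => 0, one_pos, fun _ => one_pos, monotone_const,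
      fun κ lam p Cf' Cf f h u₀ u₁ u v _ _ hf _ => absurd ⟨hf.cf_nonneg, hf.cf_lt⟩ hcf⟩
  obtain ⟨c₀, hc₀⟩ : ∃ c, c = dampingConst bc Ω cf := ⟨_, rfl⟩
  obtain ⟨c₁, hc₁⟩ : ∃ c, c = poincareConst bc Ω cf := ⟨_, rfl⟩
  have hc₀p : 0 < c₀ := hc₀ ▸ dampingConst_pos hcf.1 hcf.2
  have hc₁p : 0 < c₁ := hc₁ ▸ poincareConst_pos hcf.1 hcf.2
  have hC₁ : 0 < 1 / (2 * γ * c₀ ^ q) := by positivity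
  have hC₂ := decayConst_pos (q := q) hγ hc₀p.le hc₁p.le
  have hmono := decayConst_mono hq0.le hγ hc₀p.le hc₁p.le
  -- M is the factor from `profile_le_mul_rpow` with C = `decayConst`; `max e 0` makes it monotone
  -- on all of ℝ.
  refine ⟨1 / (2 * γ * c₀ ^ q), decayConst q γ c₀ c₁,
    fun e => (2 * (decayConst q γ c₀ c₁ e / q + max e 0 ^ q)) ^ (1 / q), hC₁, hC₂, ?_, ?_⟩
  · intro a b hab
    have h1 := hmono hab
    have h2 := (hC₂ a).le
    have h3 : 0 ≤ max a 0 := le_max_right _ _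
    dsimp only
    gcongr
  intro κ lam p Cf' Cf f h u₀ u₁ u v hκ _ hf hs
  have hdiss := hs.isDissipative hn hb hα hq0.le hγ.le hκ hf
  rw [← hc₀, ← hc₁] at hdiss
  have hK := Kconst_nonneg rfl hf (lam • h)
  have hu0 := hs.mem_energySpace 0 le_rfl
  have hest : (0 < Kconst bc Ω Cf cf (lam • h) ∨ u₀ ≠ 0 ∨ u₁ ≠ 0) →
      0 < modEnergy bc Ω κ f Cf cf (lam • h) (u 0) (v 0) ∧ ∀ t, 0 < t →
        profile q (1 / (2 * γ * c₀ ^ q)) (modEnergy bc Ω κ f Cf cf (lam • h) (u 0) (v 0)) t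
          ≤ modEnergy bc Ω κ f Cf cf (lam • h) (u t) (v t) := by
    intro hpos
    have h1 : 0 < modEnergy bc Ω κ f Cf cf (lam • h) (u 0) (v 0) :=
      modEnergy_pos hn hb hf hκ hu0 (by rwa [hs.init_left, hs.init_right])
    exact ⟨h1, fun t ht => hdiss.profile_le_energy hq0 hγ hc₀p h1 ht.le⟩
  -- The method yields the remainder 2K, which is stronger than the stated 8K.
  have hup := fun t (ht : 0 ≤ t) => hdiss.energy_le_profile hq0 hγ hc₀p.le hc₁p.le hK ht
  refine ⟨fun hpos => ⟨(hest hpos).1, fun t ht => ⟨(hest hpos).2 t ht,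
    (hup t ht.le).trans (by linarith)⟩⟩, ?_⟩
  rintro rfl rfl
  -- With K = 0 the modified energy is the energy itself, and the homogeneous statements are
  -- instances of the general estimates.
  have hK0 : Kconst bc Ω 0 cf (lam • (0 : H Ω)) = 0 := by simp [Kconst]
  have hmod : ∀ a b : H Ω, modEnergy bc Ω κ f 0 cf (lam • (0 : H Ω)) a b = energy Ω κ f 0 a b := by
    intro a b
    rw [modEnergy, hK0, smul_zero, add_zero]
  simp only [hmod, hK0, mul_zero, add_zero, lt_self_iff_false, false_or] at hest hup
  have hnn : ∀ t, 0 ≤ t → 0 ≤ energy Ω κ f 0 (u t) (v t) := by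
    intro t ht
    rw [← hmod]
    exact hdiss.energy_nonneg ht
  have hzero : u₀ = 0 → u₁ = 0 → ∀ t, 0 ≤ t → energy Ω κ f 0 (u t) (v t) = 0 := by
    intro h1 h2 t ht
    have h3 := hdiss.antitoneOn hγ.le (mem_Ici.2 le_rfl) (mem_Ici.2 ht) ht
    simp only at h3
    rw [hs.init_left, hs.init_right, h1, h2, modEnergy_zero hn hb, hK0, hmod] at h3
    exact le_antisymm h3 (hnn t ht)
  refine ⟨fun hne => ⟨(hest hne).1, fun t ht => ⟨(hest hne).2 t ht, hup t ht.le⟩⟩, hzero, ?_, ?_⟩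
  · intro t ht
    dsimp only
    by_cases hne : u₀ ≠ 0 ∨ u₁ ≠ 0
    · have h1 := (hest hne).1
      rw [max_eq_left h1.le]
      exact (hup t ht).trans (profile_le_mul_rpow hq0 (hC₂ _) h1 ht)
    · push Not at hne
      rw [hzero hne.1 hne.2 t ht]
      have h2 := (hC₂ (energy Ω κ f 0 (u 0) (v 0))).le
      positivity
  · rintro hne ⟨B, ν, hν, hB⟩
    obtain ⟨t, ht, hlt⟩ := exists_exp_lt_profile (B := B) hq0 hC₁ (hest hne).1 hν
    exact absurd (hlt.trans_le ((hest hne).2 t ht)) (hB t ht.le).not_gt
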